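/- Let $d\ge 1$, and let $\Phi$ be a probability measure on the finite configurations $\varphi:\mathbb Z^d\to\{0,1,2,\dots\}$. For such $\varphi$ put $\|\varphi\|=\sum_{z}\varphi(z)$ and $\|\varphi\|_r=\sum_{z}|z|^r\varphi(z)$ for $r>0$, where $|\cdot|$ is the Euclidean norm. Assume that $\Phi$ is irreducible, that is, there is no proper subgroup $G$ of $\mathbb Z^d$ such that almost surely $\varphi$ vanishes outside $G$; and assume $\mathbb E[\|\varphi\|^2]<\infty$, $\mathbb E[\|\varphi\|_1^2]<\infty$ and $\mathbb E[\|\varphi\|_2]<\infty$, where $\varphi$ has law $\Phi$. Put $\lambda=\mathbb E\|\varphi\|$. Consider the continuous-time branching random walk started at time $0$ with a single ball at the origin: every ball has its own independent unit-rate Poisson clock, and whenever the clock of a ball at $z$ rings, that ball stays where it is, an independent copy $\varphi$ of the offspring configuration is drawn from $\Phi$, and $\varphi(y)$ new balls are placed at $z+y$ for every $y\in\mathbb Z^d$. Let $X_z(t)$ be the number of balls at $z$ at time $t$, let $\|X(t)\|=\sum_z X_z(t)$, and let $p_z(t)=e^{-\lambda t}\,\mathbb E[X_{-z}(t)]$.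 Then for every $t\ge 1$ the process is almost surely finite at time $t$, the expectations $\mathbb E\|X(t)\|$ and $\mathbb E[X_z(t)]$ are finite, and there are constants $0<c,C<\infty$, depending only on $d$ and $\Phi$, such that for all $t\ge1$: 1. $\displaystyle\sup_{z\in\mathbb Z^d}p_z(t)\le C\,t^{-d/2}$; 2. $\displaystyle c\,t^{-d/2}\le\sum_{z\in\mathbb Z^d}p_z(t)^2\le C\,t^{-d/2}$; 3. $\displaystyle e^{-2\lambda t}\sum_{z\in\mathbb Z^d}\mathbb E\Big[\big(X_z(t)-p_{-z}(t)\,\|X(t)\|\big)^2\Big]\le C\,t^{-(d+2)/2}$ (in particular the left-hand side is finite). -/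

import Mathlib

open MeasureTheory ProbabilityTheory

noncomputable section

namespace BranchingWalk

/-- The lattice `ℤ^d`. -/
abbrev Site (d : ℕ) : Type := Fin d → ℤ

/-- Finite non-negative configurations on `ℤ^d`: the number of balls at each site. -/
abbrev Config (d : ℕ) : Type := Site d →₀ ℕ

/-- The (countable) set of finite configurations carries the discrete sigma-algebra. -/
instance (d : ℕ) : MeasurableSpace (Config d) := ⊤

/-- The Euclidean norm of a lattice site. -/
def siteNorm {d : ℕ} (z : Site d) : ℝ := ‖WithLp.toLp 2 (fun i => (z i : ℝ))‖

/-- `‖φ‖`, the total number of balls of a finite configuration. -/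
def mass {d : ℕ} (φ : Config d) : ℝ := φ.sum fun _ n => (n : ℝ)

/-- `‖φ‖_r = ∑ z, |z| ^ r * φ z`, the displacement of a finite configuration. -/
def displacement {d : ℕ} (r : ℕ) (φ : Config d) : ℝ :=
  φ.sum fun z n => siteNorm z ^ r * (n : ℝ)

/-- The offspring law `Φ` is irreducible if it is not supported on a proper subgroup of `ℤ^d`:
a subgroup that almost surely contains every occupied site of `φ` is the whole lattice. -/
def Irreducible {d : ℕ} (Φ : Measure (Config d)) : Prop :=
  ∀ G : AddSubgroup (Site d), (∀ᵐ φ ∂Φ, ∀ z, φ z ≠ 0 → z ∈ G) → G = ⊤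

/-- `λ = E ‖φ‖`, the mean number of offspring. -/
def rate {d : ℕ} (Φ : Measure (Config d)) : ℝ := ∫ φ, mass φ ∂Φ

/-- What is present right after a ring of the clock of a ball: `none` is the ball itself, which
stays where it is, and `some (y, k)` is the `k`-th new ball that is placed at displacement `y`
(it is really there only if `k < φ y`, where `φ` is the configuration drawn at that ring). -/
abbrev Letter (d : ℕ) : Type := Option (Site d × ℕ)

/-- Family-tree labels, with the most recent letter at the head of the list. The empty word is the
initial ball up to its first ring. The word `none :: w` is the same ball as `w`, but between
the ring that ends `w` and the following ring; the word `some (y, k) :: w` is a new ball, created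
when `w` rings, up to its own first ring. -/
abbrev Label (d : ℕ) : Type := List (Letter d)

/-- The source of randomness: each label `w` has a waiting time `(ω w).1` until the next ring of
the clock of this ball and a configuration `(ω w).2` of offspring that is produced at this ring. -/
abbrev Sample (d : ℕ) : Type := Label d → ℝ × Config d

/-- All waiting times are exponential with mean `1` (so that every ball has a unit-rate Poisson
clock), all offspring configurations have law `Φ`, and everything is independent. -/
def law {d : ℕ} (Φ : Measure (Config d)) [IsProbabilityMeasure Φ] : Measure (Sample d) :=
  haveI : IsProbabilityMeasure (expMeasure 1) := isProbabilityMeasure_expMeasure one_pos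
  Measure.infinitePi fun _ : Label d => (expMeasure 1).prod Φ

/-- The time at which the label becomes active (the previous ring, or the birth of the ball). -/
def start {d : ℕ} (ω : Sample d) : Label d → ℝ
  | [] => 0
  | _ :: w => start ω w + (ω w).1

/-- The label is really used: each new ball along its line of descent has been produced. -/
def IsUsed {d : ℕ} (ω : Sample d) : Label d → Prop
  | [] => True
  | none :: w => IsUsed ω w
  | some (y, k) :: w => IsUsed ω w ∧ k < (ω w).2 y

/-- The site of the ball with the given label, the initial ball being at the origin. -/
def position {d : ℕ} : Label d → Site d
  | [] => 0
  | none :: w => position w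
  | some (y, _) :: w => position w + y

/-- The set of labels of the balls present at time `t` (one label for each ball). -/
def present {d : ℕ} (ω : Sample d) (t : ℝ) : Set (Label d) :=
  {w | IsUsed ω w ∧ start ω w ≤ t ∧ t < start ω w + (ω w).1}

/-- `X_z(t)`, the number of balls at the site `z` at time `t`. -/
def count {d : ℕ} (z : Site d) (t : ℝ) (ω : Sample d) : ℝ :=
  ({w ∈ present ω t | position w = z}.ncard : ℝ)

/-- `‖X(t)‖`, the total number of balls at time `t`. -/
def total {d : ℕ} (t : ℝ) (ω : Sample d) : ℝ := ((present ω t).ncard : ℝ)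

/-- `p_z(t) = e^{-λ t} E[X_{-z}(t)]`. -/
def meanShare {d : ℕ} (Φ : Measure (Config d)) [IsProbabilityMeasure Φ] (z : Site d) (t : ℝ) : ℝ :=
  Real.exp (-(rate Φ * t)) * ∫ ω, count (-z) t ω ∂(law Φ)

end BranchingWalk

end

noncomputable section

namespace BranchingWalk

open scoped ENNReal ComplexConjugate

variable {d : ℕ}

section

/-! Everything comes from conditioning on the first ring. The recursion `pop_succ` splits the family
tree into its root and subtrees indexed by letters, and `lintegral_law` makes the subtrees
independent of the root and of each other.

Means. A label of length `k` costs `k` exponential waits, so the mean population is a Poisson(`t`)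
mixture of convolution powers of `step` (`meanPop_top`). Hence the normalized mean `heat` (the
kernel p with z reflected) has Fourier series exp(t(ĵ(θ) - λ)), where ĵ is the transform of `jump`;
its modulus is exp(-t D(θ)/2) with D = `dissipation` (`fourierSum_heat`, `norm_fourierSum_heat`).
Irreducibility gives D(θ) ≥ c|θ|² on the cube (`exists_le_dissipation`). Gaussian integration then
gives the sup bound, and the upper ℓ² bound follows because the kernel has mass 1. The second
displacement moment gives D(θ) ≤ C|θ|², hence the lower ℓ² bound through Parseval.

Deviations. Freeze the profile β = `heat` at the final time T, and let F(t, x) be the sum over z of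
the mean square of X_z(t) - β(z)‖X(t)‖ for the process started at x (`totalDev`). By independence of
the subtrees, the second moment of their sum is at most the sum of the second moments plus the
square of the sum of the means. So F satisfies a linear renewal inequality (`exists_totalDev_le`),
forced by squared differences of heat kernels at times r ≤ T and at shifted sites. By Parseval such
a difference gains a factor |θ|, so its squared ℓ² norm is of order (1+r)^{-(d+2)/2}
(`exists_tsum_heat_sub_sq_le`).

The homogeneous equation grows only like e^{λt}, while the forcing grows at a rate close to 2λ and
therefore dominates. A multiple of H(x)e^{γt}, with λ < γ < 2λ and H quadratic (`exists_lyapunov`),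
is a supersolution. The a priori bound A e^{2λt} (`secondMoment_le`) starts an iteration in which
the excess over the supersolution shrinks by a fixed factor at each use of the inequality
(`supersolution_step`). Letting the iteration run to infinity and setting t = T, x = 0 gives the
third bound (`exists_tsum_devSq_heat_le`). -/

instance : DiscreteMeasurableSpace (Config d) := ⟨fun _ => trivial⟩

/-! ### Family trees -/

/-- The displacement of a letter: the ball itself does not move. -/
def letterSite : Letter d → Site d
  | none => 0
  | some (y, _) => y

/-- The letters which are really used when the configuration `φ` is drawn. -/
def letters (φ : Config d) : Finset (Letter d) :=
  Finset.insertNone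
    ((φ.support.sigma fun y => Finset.range (φ y)).map (Equiv.sigmaEquivProd _ _).toEmbedding)

lemma none_mem_letters (φ : Config d) : none ∈ letters φ := by simp [letters]

lemma some_mem_letters {φ : Config d} {y : Site d} {k : ℕ} :
    some (y, k) ∈ letters φ ↔ k < φ y := by
  simp only [letters, Finset.some_mem_insertNone, Finset.mem_map, Finset.mem_sigma,
    Finsupp.mem_support_iff, Finset.mem_range, Equiv.coe_toEmbedding, Sigma.exists,
    Equiv.sigmaEquivProd_apply, Prod.mk.injEq]
  constructor
  · rintro ⟨a, b, ⟨-, h⟩, rfl, rfl⟩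
    exact h
  · intro h
    exact ⟨y, k, ⟨by omega, h⟩, rfl, rfl⟩

lemma sum_letters {M : Type*} [AddCommMonoid M] (φ : Config d) (g : Site d → M) :
    ∑ a ∈ letters φ, g (letterSite a) = g 0 + φ.sum fun y n => n • g y := by
  rw [letters, Finset.sum_insertNone, Finset.sum_map, Finset.sum_sigma]
  simp [letterSite, Finsupp.sum]

/-- The randomness of the subtree that starts with the letter `a`. -/
def subtree (ω : Sample d) (a : Letter d) : Sample d := fun w => ω (w ++ [a])

/-- Labels grow at the head, so the first ring of the process is recorded by the last list entry.
The defining recursions run from the head; this lemma and the next two turn them around, by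
induction on the label, so that the tree can be cut at its root. -/
lemma start_append (ω : Sample d) (a : Letter d) (w : Label d) :
    start ω (w ++ [a]) = (ω []).1 + start (subtree ω a) w := by
  induction w with
  | nil => simp [start]
  | cons b w ih => simp only [List.cons_append, start, ih, subtree, add_assoc]

lemma isUsed_append (ω : Sample d) (a : Letter d) (w : Label d) :
    IsUsed ω (w ++ [a]) ↔ a ∈ letters (ω []).2 ∧ IsUsed (subtree ω a) w := by
  induction w with
  | nil =>
    rcases a with _ | ⟨y, k⟩
    · simp [IsUsed, none_mem_letters]
    · simp [IsUsed, some_mem_letters]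
  | cons b w ih =>
    rcases b with _ | ⟨y, k⟩
    · simp only [List.cons_append, IsUsed, ih]
    · simp only [List.cons_append, IsUsed, ih, subtree, and_assoc]

lemma position_append (a : Letter d) (w : Label d) :
    position (w ++ [a]) = letterSite a + position w := by
  induction w with
  | nil => rcases a with _ | ⟨y, k⟩ <;> simp [position, letterSite]
  | cons b w ih =>
    rcases b with _ | ⟨y, k⟩
    · simp only [List.cons_append, position, ih]
    · simp only [List.cons_append, position, ih, add_assoc]

lemma nil_mem_present {ω : Sample d} {t : ℝ} :
    [] ∈ present ω t ↔ 0 ≤ t ∧ t < (ω []).1 := by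
  simp [present, IsUsed, start]

lemma append_mem_present {ω : Sample d} {t : ℝ} {a : Letter d} {w : Label d} :
    w ++ [a] ∈ present ω t ↔
      a ∈ letters (ω []).2 ∧ w ∈ present (subtree ω a) (t - (ω []).1) := by
  simp only [present, Set.mem_ofPred_eq, isUsed_append, start_append, subtree, and_assoc]
  refine and_congr_right fun _ => and_congr_right fun _ => ?_
  constructor <;> rintro ⟨h₁, h₂⟩ <;> constructor <;> linarith

/-- The decomposition of a nonempty label into its oldest letter and a label in the subtree. -/
def labelEquiv (d : ℕ) : Option (Letter d × Label d) ≃ Label d :=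
  Equiv.ofBijective (fun o => o.elim [] fun p => p.2 ++ [p.1]) <| by
    constructor
    · rintro (_ | ⟨a, w⟩) (_ | ⟨b, v⟩) h
      · rfl
      · exact absurd h.symm (by simp)
      · exact absurd h (by simp)
      · obtain ⟨h₁, h₂⟩ := List.append_inj' (t₁ := [a]) (t₂ := [b]) h rfl
        change w = v at h₁
        rw [h₁, List.singleton_inj.1 h₂]
    · intro w
      rcases List.eq_nil_or_concat w with h | ⟨v, a, h⟩
      · exact ⟨none, h.symm⟩
      · exact ⟨some (a, v), by simpa using h.symm⟩

lemma tsum_label (g : Label d → ℝ≥0∞) :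
    ∑' w, g w = g [] + ∑' a : Letter d, ∑' w, g (w ++ [a]) := by
  rw [← (labelEquiv d).tsum_eq g, ← ENNReal.tsum_prod,
    ← (Equiv.optionEquivSumPUnit.{0} (Letter d × Label d)).symm.tsum_eq,
    ENNReal.summable.tsum_sum ENNReal.summable, add_comm]
  congr 1
  simp only [tsum_fintype, Finset.univ_unique, Finset.sum_singleton]
  rfl

/-- The balls present at time `t` whose label has length less than `n`. -/
def alive (n : ℕ∞) (t : ℝ) (ω : Sample d) : Set (Label d) :=
  {w | w ∈ present ω t ∧ (w.length : ℕ∞) < n}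

/-- The sum of `f` over the balls present at time `t` whose label has length less than `n`. -/
def pop (n : ℕ∞) (f : Site d → ℝ≥0∞) (t : ℝ) (ω : Sample d) : ℝ≥0∞ :=
  ∑' w, (alive n t ω).indicator (fun w => f (position w)) w

lemma pop_zero (f : Site d → ℝ≥0∞) (t : ℝ) (ω : Sample d) : pop 0 f t ω = 0 := by
  simp [pop, alive]

/-- The contribution of the initial ball before its first ring. -/
def rootPop (f : Site d → ℝ≥0∞) (t : ℝ) (p : ℝ × Config d) : ℝ≥0∞ :=
  (Set.Ico 0 p.1).indicator (fun _ => f 0) t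

/-- The branching recursion. Labels whose oldest letter was not produced contribute nothing, which
makes the sum over letters finite. Since `⊤ + 1 = ⊤`, the same statement is a fixed-point equation
for the whole population. -/
lemma pop_succ (n : ℕ∞) (f : Site d → ℝ≥0∞) (t : ℝ) (ω : Sample d) :
    pop (n + 1) f t ω = rootPop f t (ω []) + ∑ a ∈ letters (ω []).2,
      pop n (fun x => f (letterSite a + x)) (t - (ω []).1) (subtree ω a) := by
  rw [pop, tsum_label]
  congr 1
  · have : ([] : Label d) ∈ alive (n + 1) t ω ↔ t ∈ Set.Ico 0 (ω []).1 := by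
      simp [alive, nil_mem_present]
    by_cases h : t ∈ Set.Ico 0 (ω []).1
    · simp [rootPop, h, this.2 h, position]
    · simp [rootPop, h, this.not.2 h]
  · rw [tsum_eq_sum (s := letters (ω []).2)]
    · refine Finset.sum_congr rfl fun a ha => tsum_congr fun w => ?_
      have : w ++ [a] ∈ alive (n + 1) t ω ↔ w ∈ alive n (t - (ω []).1) (subtree ω a) := by
        simp [alive, append_mem_present, ha]
      by_cases h : w ∈ alive n (t - (ω []).1) (subtree ω a)
      · rw [Set.indicator_of_mem h, Set.indicator_of_mem (this.2 h), position_append]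
      · rw [Set.indicator_of_notMem h, Set.indicator_of_notMem (this.not.2 h)]
    · intro a ha
      simp only [ENNReal.tsum_eq_zero]
      intro w
      refine Set.indicator_of_notMem (fun h => ha ?_) _
      exact (append_mem_present.1 h.1).1

/-! ### Measurability -/

lemma measurable_start (w : Label d) : Measurable fun ω : Sample d => start ω w := by
  induction w with
  | nil => exact measurable_const
  | cons b w ih => exact ih.add (measurable_pi_apply w).fst

lemma measurableSet_isUsed (w : Label d) : MeasurableSet {ω : Sample d | IsUsed ω w} := by
  induction w with
  | nil => simp [IsUsed]
  | cons b w ih =>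
    rcases b with _ | ⟨y, k⟩
    · exact ih
    · refine ih.inter ?_
      have h : MeasurableSet {φ : Config d | k < φ y} := MeasurableSet.of_discrete
      exact (measurable_pi_apply (X := fun _ : Label d => ℝ × Config d) w).snd h

lemma measurableSet_mem_present (w : Label d) :
    MeasurableSet {p : ℝ × Sample d | w ∈ present p.2 p.1} := by
  refine (measurable_snd (measurableSet_isUsed w)).inter ?_
  have h : Measurable fun p : ℝ × Sample d => start p.2 w :=
    (measurable_start w).comp measurable_snd
  refine (measurableSet_le h measurable_fst).inter
    (measurableSet_lt measurable_fst (h.add ?_))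
  exact ((measurable_pi_apply (X := fun _ : Label d => ℝ × Config d) w).comp measurable_snd).fst

/-- Joint measurability is needed because the recursion evaluates the subtrees at the random
remaining time. -/
lemma measurable_pop_prod (n : ℕ∞) (f : Site d → ℝ≥0∞) :
    Measurable fun p : ℝ × Sample d => pop n f p.1 p.2 := by
  refine Measurable.tsum fun w => ?_
  by_cases hw : (w.length : ℕ∞) < n
  · have : (fun p : ℝ × Sample d => (alive n p.1 p.2).indicator (fun w => f (position w)) w)
        = {p : ℝ × Sample d | w ∈ present p.2 p.1}.indicator fun _ => f (position w) := by
      ext p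
      have h : w ∈ alive n p.1 p.2 ↔ w ∈ present p.2 p.1 := and_iff_left hw
      by_cases hp : w ∈ present p.2 p.1
      · rw [Set.indicator_of_mem (h.2 hp), Set.indicator_of_mem (by exact hp)]
      · rw [Set.indicator_of_notMem (h.not.2 hp), Set.indicator_of_notMem (by exact hp)]
    rw [this]
    exact measurable_const.indicator (measurableSet_mem_present w)
  · simp [Set.indicator, alive, hw]

lemma measurable_pop {γ : Type*} [MeasurableSpace γ] (n : ℕ∞) (f : Site d → ℝ≥0∞)
    {t : γ → ℝ} {ω : γ → Sample d} (ht : Measurable t) (hω : Measurable ω) :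
    Measurable fun x => pop n f (t x) (ω x) :=
  (measurable_pop_prod n f).comp (ht.prodMk hω)

lemma measurable_rootPop (f : Site d → ℝ≥0∞) (t : ℝ) : Measurable (rootPop f t) := by
  have : rootPop f t = {p : ℝ × Config d | 0 ≤ t ∧ t < p.1}.indicator fun _ => f 0 := by
    ext p
    simp [rootPop, Set.indicator]
  rw [this]
  refine measurable_const.indicator ?_
  exact (MeasurableSet.const _).inter (measurableSet_lt measurable_const measurable_fst)

lemma measurable_config_apply {γ M : Type*} [MeasurableSpace γ] [MeasurableSpace M]
    (F : Config d → γ → M) (hF : ∀ φ, Measurable (F φ)) {φ : γ → Config d} (hφ : Measurable φ) :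
    Measurable fun x => F (φ x) x := by
  have h : Measurable (Function.uncurry F) := measurable_from_prod_countable_right hF
  have h' : Measurable fun x => (φ x, x) := hφ.prodMk measurable_id
  exact h.comp h'

lemma measurable_sum_letters {γ M : Type*} [MeasurableSpace γ] [AddCommMonoid M]
    [MeasurableSpace M] [MeasurableAdd₂ M] {φ : γ → Config d} (hφ : Measurable φ)
    {F : Letter d → γ → M} (hF : ∀ a, Measurable (F a)) :
    Measurable fun x => ∑ a ∈ letters (φ x), F a x :=
  measurable_config_apply (fun φ x => ∑ a ∈ letters φ, F a x)
    (fun φ => Finset.measurable_fun_sum (letters φ) fun a _ => hF a) hφ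

/-! ### The branching property -/

/-- The law of the waiting time and the offspring configuration of a ball. -/
def mark (Φ : Measure (Config d)) : Measure (ℝ × Config d) := (expMeasure 1).prod Φ

instance : IsProbabilityMeasure (expMeasure 1) := isProbabilityMeasure_expMeasure one_pos

variable (Φ : Measure (Config d)) [IsProbabilityMeasure Φ]

instance : IsProbabilityMeasure (mark Φ) := by unfold mark; infer_instance

lemma law_eq : law Φ = Measure.infinitePi fun _ : Label d => mark Φ := rfl

instance : IsProbabilityMeasure (law Φ) := by rw [law_eq]; infer_instance

/-- The joint law of independent subtrees, one for each letter. -/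
def forest : Measure (Letter d → Sample d) := Measure.infinitePi fun _ : Letter d => law Φ

instance : IsProbabilityMeasure (forest Φ) := by unfold forest; infer_instance

lemma measurable_subtree : Measurable (subtree (d := d)) :=
  measurable_pi_lambda _ fun _ => measurable_pi_lambda _ fun _ => measurable_pi_apply _

/-- Different pairs of an oldest letter and a remaining label give different labels, so an injective
reindexing of the product law followed by currying produces independent copies of the whole process.
-/
lemma map_subtree : (law Φ).map subtree = forest Φ := by
  have hinj : Function.Injective fun q : Letter d × Label d => q.2 ++ [q.1] := by
    rintro ⟨a, w⟩ ⟨b, v⟩ h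
    obtain ⟨h₁, h₂⟩ := List.append_inj' h rfl
    simp_all
  have h₁ := Measure.map_infinitePi_infinitePi_of_inj (P := fun _ : Label d => mark Φ) hinj
  have h₂ := Measure.infinitePi_map_curry (fun (_ : Letter d) (_ : Label d) => mark Φ)
  rw [← h₁, Measure.map_map (by fun_prop) (by fun_prop)] at h₂
  exact h₂

/-- The root reads only the coordinate `[]`, the subtrees only nonempty labels, and families over
disjoint sets of coordinates are independent. -/
lemma indepFun_root_subtree :
    IndepFun (fun ω : Sample d => ω []) subtree (law Φ) := by
  have hind : iIndep (fun w : Label d => MeasurableSpace.comap (fun ω : Sample d => ω w)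
      inferInstance) (law Φ) := by
    have := iIndepFun_infinitePi (P := fun _ : Label d => mark Φ) (X := fun _ x => x)
      (fun _ => measurable_id)
    exact this
  have h := indep_iSup_of_disjoint (S := {[]}) (T := {[]}ᶜ)
    (fun w => (measurable_pi_apply w).comap_le) hind disjoint_compl_right
  refine indep_of_indep_of_le_left (indep_of_indep_of_le_right h ?_) ?_
  · rw [← measurable_iff_comap_le]
    -- The source carries the σ-algebra generated by the coordinates other than `[]`, not the
    -- default one, so it has to be left to unification.
    refine @measurable_pi_lambda _ _ _ (_) _ _ fun a => @measurable_pi_lambda _ _ _ (_) _ _ fun w => ?_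
    rw [measurable_iff_comap_le]
    exact le_iSup₂_of_le (w ++ [a]) (by simp) le_rfl
  · exact le_iSup₂_of_le [] rfl le_rfl

lemma map_root_subtree :
    (law Φ).map (fun ω => (ω [], subtree ω)) = (mark Φ).prod (forest Φ) := by
  rw [(indepFun_iff_map_prod_eq_prod_map_map (measurable_pi_apply _).aemeasurable measurable_subtree.aemeasurable).1
    (indepFun_root_subtree Φ), map_subtree, law_eq, Measure.infinitePi_map_eval]

lemma lintegral_law {G : (ℝ × Config d) × (Letter d → Sample d) → ℝ≥0∞} (hG : Measurable G) :
    ∫⁻ ω, G (ω [], subtree ω) ∂law Φ = ∫⁻ p, ∫⁻ η, G (p, η) ∂forest Φ ∂mark Φ := by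
  rw [← lintegral_prod _ hG.aemeasurable, ← map_root_subtree,
    lintegral_map hG ((measurable_pi_apply _).prodMk measurable_subtree)]

lemma map_forest_eval (a : Letter d) : (forest Φ).map (fun η => η a) = law Φ :=
  Measure.infinitePi_map_eval _ a

lemma lintegral_forest_eval (a : Letter d) {g : Sample d → ℝ≥0∞} (hg : Measurable g) :
    ∫⁻ η, g (η a) ∂forest Φ = ∫⁻ ω, g ω ∂law Φ := by
  rw [← map_forest_eval Φ a, lintegral_map hg (measurable_pi_apply a)]

lemma iIndepFun_forest {M : Type*} [MeasurableSpace M] {g : Letter d → Sample d → M}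
    (hg : ∀ a, Measurable (g a)) : iIndepFun (fun a η => g a (η a)) (forest Φ) :=
  iIndepFun_infinitePi hg

end

section

/-! ### Convolution with the exponential law -/

/-- A real function, set to `0` at negative times. -/
def causal (g : ℝ → ℝ) : ℝ → ℝ≥0∞ := (Set.Ici 0).indicator fun t => ENNReal.ofReal (g t)

lemma causal_of_nonneg (g : ℝ → ℝ) {t : ℝ} (ht : 0 ≤ t) : causal g t = ENNReal.ofReal (g t) :=
  Set.indicator_of_mem (by exact ht) _

lemma causal_of_neg (g : ℝ → ℝ) {t : ℝ} (ht : t < 0) : causal g t = 0 :=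
  Set.indicator_of_notMem (by simpa using ht) _

lemma measurable_causal {g : ℝ → ℝ} (hg : Measurable g) : Measurable (causal g) :=
  hg.ennreal_ofReal.indicator measurableSet_Ici

lemma lintegral_expMeasure {g : ℝ → ℝ≥0∞} (hg : Measurable g) :
    ∫⁻ s, g s ∂expMeasure 1 = ∫⁻ s in Set.Ici 0, ENNReal.ofReal (Real.exp (-s)) * g s := by
  have h : expMeasure 1 = volume.withDensity (exponentialPDF 1) := rfl
  have hm : Measurable (exponentialPDF 1) := (measurable_exponentialPDFReal 1).ennreal_ofReal
  rw [h, lintegral_withDensity_eq_lintegral_mul _ hm hg, ← lintegral_indicator measurableSet_Ici]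
  refine lintegral_congr fun s => ?_
  by_cases hs : 0 ≤ s
  · rw [Set.indicator_of_mem (by exact hs)]
    simp [exponentialPDF_of_nonneg hs]
  · rw [Set.indicator_of_notMem (by exact hs)]
    simp [exponentialPDF_of_neg (not_le.1 hs)]

/-- Extension by zero to negative times cuts the exponential average off at `t`, so renewal
equations need no case distinction on whether the first ring precedes `t`. -/
lemma lintegral_causal {g : ℝ → ℝ} (hg : Continuous g) (hg0 : ∀ t, 0 ≤ t → 0 ≤ g t) (t : ℝ) :
    ∫⁻ s, causal g (t - s) ∂expMeasure 1
      = causal (fun t => ∫ s in 0..t, Real.exp (-s) * g (t - s)) t := by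
  have hm : Measurable fun s => causal g (t - s) :=
    (measurable_causal hg.measurable).comp (measurable_const.sub measurable_id)
  rw [lintegral_expMeasure hm, ← lintegral_indicator measurableSet_Ici]
  have h : ∀ s, (Set.Ici (0 : ℝ)).indicator
      (fun s => ENNReal.ofReal (Real.exp (-s)) * causal g (t - s)) s
      = (Set.Icc 0 t).indicator (fun s => ENNReal.ofReal (Real.exp (-s) * g (t - s))) s := by
    intro s
    by_cases hs : 0 ≤ s
    · rw [Set.indicator_of_mem (by exact hs)]
      by_cases hst : s ≤ t
      · rw [Set.indicator_of_mem (by exact ⟨hs, hst⟩), causal_of_nonneg _ (sub_nonneg.2 hst),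
          ENNReal.ofReal_mul (Real.exp_pos _).le]
      · rw [Set.indicator_of_notMem (fun h => hst h.2), causal_of_neg _ (by linarith), mul_zero]
    · rw [Set.indicator_of_notMem (by exact hs), Set.indicator_of_notMem (fun h => hs h.1)]
  rw [lintegral_congr h, lintegral_indicator measurableSet_Icc]
  rcases lt_or_ge t 0 with ht | ht
  · rw [causal_of_neg _ ht, Set.Icc_eq_empty (by linarith), Measure.restrict_empty,
      lintegral_zero_measure]
  · rw [causal_of_nonneg _ ht, intervalIntegral.integral_of_le ht,
      ← integral_Icc_eq_integral_Ioc, ofReal_integral_eq_lintegral_ofReal]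
    · exact (by fun_prop : Continuous fun s => Real.exp (-s) * g (t - s)).integrableOn_Icc
    · filter_upwards [ae_restrict_mem measurableSet_Icc] with s hs
      exact mul_nonneg (Real.exp_pos _).le (hg0 _ (sub_nonneg.2 hs.2))

/-- `e^{γ t}` for `t ≥ 0`, and `0` for `t < 0`. -/
def causalExp (γ : ℝ) : ℝ → ℝ≥0∞ := causal fun t => Real.exp (γ * t)

lemma measurable_causalExp (γ : ℝ) : Measurable (causalExp γ) :=
  measurable_causal (by fun_prop)

/-- Exponentials solve the renewal equation in which each ring produces `1 + γ` descendants on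
average. They are the test functions for all later comparisons. -/
lemma lintegral_causalExp {γ : ℝ} (hγ : -1 < γ) (t : ℝ) :
    causalExp (-1) t + ENNReal.ofReal (1 + γ) * ∫⁻ s, causalExp γ (t - s) ∂expMeasure 1
      = causalExp γ t := by
  have h1 : 0 < 1 + γ := by linarith
  unfold causalExp
  rw [lintegral_causal (by fun_prop) fun _ _ => (Real.exp_pos _).le]
  rcases lt_or_ge t 0 with ht | ht
  · simp [causal_of_neg _ ht]
  rw [causal_of_nonneg _ ht, causal_of_nonneg _ ht, causal_of_nonneg _ ht]
  have hint : ∫ s in 0..t, Real.exp (-s) * Real.exp (γ * (t - s))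
      = (Real.exp (γ * t) - Real.exp (-t)) / (1 + γ) := by
    have hd : ∀ s ∈ Set.uIcc 0 t, HasDerivAt
        (fun s => -Real.exp (γ * t - (1 + γ) * s) / (1 + γ))
        (Real.exp (-s) * Real.exp (γ * (t - s))) s := by
      intro s _
      have : HasDerivAt (fun s => γ * t - (1 + γ) * s) (-((1 + γ) * 1)) s :=
        ((hasDerivAt_id s).const_mul (1 + γ)).const_sub _
      refine (this.exp.neg.div_const (1 + γ)).congr_deriv ?_
      rw [← Real.exp_add, show -s + γ * (t - s) = γ * t - (1 + γ) * s by ring]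
      field_simp
    have hc : Continuous fun s => Real.exp (-s) * Real.exp (γ * (t - s)) := by fun_prop
    rw [intervalIntegral.integral_eq_sub_of_hasDerivAt hd (hc.intervalIntegrable 0 t)]
    rw [show γ * t - (1 + γ) * t = -t by ring]
    simp only [mul_zero, sub_zero]
    ring
  have hle : Real.exp (-t) ≤ Real.exp (γ * t) := Real.exp_le_exp.2 (by nlinarith)
  rw [hint, ← ENNReal.ofReal_mul h1.le, mul_div_cancel₀ _ h1.ne', neg_one_mul,
    ← ENNReal.ofReal_add (Real.exp_pos _).le (by linarith), add_sub_cancel]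

/-- The Poisson weights `e^{-t} t ^ k / k!` for `t ≥ 0`. -/
def poissonWeight (k : ℕ) : ℝ → ℝ≥0∞ :=
  causal fun t => Real.exp (-t) * (t ^ k / k.factorial)

lemma measurable_poissonWeight (k : ℕ) : Measurable (poissonWeight k) :=
  measurable_causal (by fun_prop)

lemma poissonWeight_zero : poissonWeight 0 = causalExp (-1) := by
  simp [poissonWeight, causalExp]

/-- One more exponential wait raises the Poisson count by one: the two exponentials multiply to `exp
(-t)`, and only a monomial is left to integrate. -/
lemma lintegral_poissonWeight (k : ℕ) (t : ℝ) :
    ∫⁻ s, poissonWeight k (t - s) ∂expMeasure 1 = poissonWeight (k + 1) t := by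
  unfold poissonWeight
  rw [lintegral_causal (by fun_prop) fun t ht => by positivity]
  rcases lt_or_ge t 0 with ht | ht
  · simp [causal_of_neg _ ht]
  rw [causal_of_nonneg _ ht, causal_of_nonneg _ ht]
  congr 1
  have hd : ∀ s ∈ Set.uIcc 0 t, HasDerivAt
      (fun s => -(Real.exp (-t) * ((t - s) ^ (k + 1) / (k + 1).factorial)))
      (Real.exp (-s) * (Real.exp (-(t - s)) * ((t - s) ^ k / k.factorial))) s := by
    intro s _
    have h : HasDerivAt (fun s => t - s) (-1) s := (hasDerivAt_id s).const_sub _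
    refine (((h.pow (k + 1)).div_const
      ((k + 1).factorial : ℝ)).const_mul (Real.exp (-t))).neg.congr_deriv ?_
    rw [← mul_assoc, ← Real.exp_add, show -s + -(t - s) = -t by ring, Nat.factorial_succ]
    push_cast
    have : (k.factorial : ℝ) ≠ 0 := by positivity
    have : (k + 1 : ℝ) ≠ 0 := by positivity
    field_simp
  have hc : Continuous fun s =>
      Real.exp (-s) * (Real.exp (-(t - s)) * ((t - s) ^ k / k.factorial)) := by fun_prop
  rw [intervalIntegral.integral_eq_sub_of_hasDerivAt hd (hc.intervalIntegrable 0 t)]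
  simp

/-! ### The intensity of the walk -/

variable (Φ : Measure (Config d))

/-- The mean number of new balls at displacement `y`. -/
def intensity (y : Site d) : ℝ≥0∞ := ∫⁻ φ, (φ y : ℝ≥0∞) ∂Φ

/-- The mean number of balls at displacement `y` after a ring, including the old ball. -/
def step (y : Site d) : ℝ≥0∞ := Set.indicator {0} 1 y + intensity Φ y

lemma sum_letters_eq_tsum (φ : Config d) (g : Site d → ℝ≥0∞) :
    ∑ a ∈ letters φ, g (letterSite a) = g 0 + ∑' y, (φ y : ℝ≥0∞) * g y := by
  rw [sum_letters, Finsupp.sum, tsum_eq_sum (s := φ.support)]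
  · simp
  · intro y hy
    simp [Finsupp.notMem_support_iff.1 hy]

/-- The many-to-one formula: in the mean, a ring acts as a weighted random-walk step that includes
staying put. -/
lemma lintegral_letters [IsProbabilityMeasure Φ] (g : Site d → ℝ≥0∞) :
    ∫⁻ φ, ∑ a ∈ letters φ, g (letterSite a) ∂Φ = ∑' y, step Φ y * g y := by
  simp_rw [sum_letters_eq_tsum, step, add_mul]
  rw [ENNReal.tsum_add, lintegral_add_left measurable_const,
    lintegral_tsum fun _ => Measurable.aemeasurable (Measurable.of_discrete)]
  congr 1
  · rw [tsum_eq_single 0 fun y hy => by simp [hy]]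
    simp
  · refine tsum_congr fun y => ?_
    rw [lintegral_mul_const _ Measurable.of_discrete, intensity]

/-- The mean of `f` over the `k`-th generation. -/
def gen : ℕ → (Site d → ℝ≥0∞) → ℝ≥0∞
  | 0, f => f 0
  | k + 1, f => ∑' y, step Φ y * gen k fun x => f (y + x)

lemma gen_mul (k : ℕ) (c : ℝ≥0∞) (f : Site d → ℝ≥0∞) :
    gen Φ k (fun x => c * f x) = c * gen Φ k f := by
  induction k generalizing f with
  | zero => rfl
  | succ k ih =>
    simp only [gen, ih fun x => f (_ + x)]
    rw [← ENNReal.tsum_mul_left]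
    exact tsum_congr fun y => by ring

lemma gen_tsum {ι : Type*} (k : ℕ) (f : ι → Site d → ℝ≥0∞) :
    gen Φ k (fun x => ∑' i, f i x) = ∑' i, gen Φ k (f i) := by
  induction k generalizing f with
  | zero => rfl
  | succ k ih =>
    simp only [gen, ih fun i x => f i (_ + x)]
    rw [ENNReal.tsum_comm]
    exact tsum_congr fun y => by rw [ENNReal.tsum_mul_left]

/-- The mean number of particles of the `k`-th generation at `z`. -/
def genAt (k : ℕ) (z : Site d) : ℝ≥0∞ := gen Φ k (Set.indicator {z} 1)

lemma gen_eq_tsum (k : ℕ) (f : Site d → ℝ≥0∞) :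
    gen Φ k f = ∑' z, f z * genAt Φ k z := by
  have h : f = fun x => ∑' z, f z * Set.indicator {z} 1 x := by
    ext x
    rw [tsum_eq_single x fun z hz => by simp [Ne.symm hz]]
    simp
  conv_lhs => rw [h]
  rw [gen_tsum]
  exact tsum_congr fun z => gen_mul Φ k _ _

lemma genAt_zero (z : Site d) : genAt Φ 0 z = Set.indicator {0} 1 z := by
  simp [genAt, gen, Set.indicator, eq_comm]

lemma indicator_shift (y z : Site d) :
    (fun x => Set.indicator {z} (1 : Site d → ℝ≥0∞) (y + x)) = Set.indicator {z - y} 1 := by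
  ext x
  simp [Set.indicator, eq_sub_iff_add_eq, add_comm]

lemma genAt_succ (k : ℕ) (z : Site d) :
    genAt Φ (k + 1) z = ∑' y, step Φ y * genAt Φ k (z - y) := by
  simp only [genAt, gen, indicator_shift]

/-! ### First moments -/

lemma lintegral_mark {g : ℝ → Config d → ℝ≥0∞} (hg : ∀ φ, Measurable fun s => g s φ) :
    ∫⁻ p, g p.1 p.2 ∂mark Φ = ∫⁻ s, ∫⁻ φ, g s φ ∂Φ ∂expMeasure 1 := by
  have h : Measurable fun p : ℝ × Config d => g p.1 p.2 :=
    measurable_config_apply (fun φ (p : ℝ × Config d) => g p.1 φ)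
      (fun φ => (hg φ).comp measurable_fst) measurable_snd
  rw [mark, lintegral_prod _ h.aemeasurable]

variable [IsProbabilityMeasure Φ]

lemma expMeasure_Ioi {t : ℝ} (ht : 0 ≤ t) :
    expMeasure 1 (Set.Ioi t) = ENNReal.ofReal (Real.exp (-t)) := by
  have h := prob_compl_eq_one_sub (μ := expMeasure 1) (measurableSet_Iic (a := t))
  rw [Set.compl_Iic] at h
  rw [h, ← ofReal_cdf, cdf_expMeasure_eq one_pos, if_pos ht, ← ENNReal.ofReal_one,
    ← ENNReal.ofReal_sub _ (by simpa using ht)]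
  simp

lemma lintegral_rootPop (f : Site d → ℝ≥0∞) (t : ℝ) :
    ∫⁻ p, rootPop f t p ∂mark Φ = causalExp (-1) t * f 0 := by
  have h : rootPop f t = fun p : ℝ × Config d =>
      ({s : ℝ | 0 ≤ t ∧ t < s} ×ˢ (Set.univ : Set (Config d))).indicator (fun _ => f 0) p := by
    ext p
    simp [rootPop, Set.indicator]
  have hm : MeasurableSet {s : ℝ | 0 ≤ t ∧ t < s} :=
    (MeasurableSet.const _).inter (measurableSet_lt measurable_const measurable_id)
  rw [h, lintegral_indicator_const (hm.prod .univ), mark, Measure.prod_prod, measure_univ,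
    mul_one, mul_comm]
  rcases lt_or_ge t 0 with ht | ht
  · simp [causalExp, causal_of_neg _ ht, not_le.2 ht]
  · have : {s : ℝ | 0 ≤ t ∧ t < s} = Set.Ioi t := by ext; simp [ht]
    rw [this, expMeasure_Ioi ht, causalExp, causal_of_nonneg _ ht, neg_one_mul]

/-- The mean of `f` over the balls at time `t` with label of length less than `n`. -/
def meanPop (n : ℕ∞) (f : Site d → ℝ≥0∞) (t : ℝ) : ℝ≥0∞ := ∫⁻ ω, pop n f t ω ∂law Φ

lemma measurable_meanPop (n : ℕ∞) (f : Site d → ℝ≥0∞) : Measurable (meanPop Φ n f) :=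
  (measurable_pop_prod n f).lintegral_prod_right'

lemma meanPop_succ (n : ℕ∞) (f : Site d → ℝ≥0∞) (t : ℝ) :
    meanPop Φ (n + 1) f t = causalExp (-1) t * f 0 +
      ∫⁻ s, ∑' y, step Φ y * meanPop Φ n (fun x => f (y + x)) (t - s) ∂expMeasure 1 := by
  have hm : Measurable fun q : (ℝ × Config d) × (Letter d → Sample d) =>
      ∑ a ∈ letters q.1.2, pop n (fun x => f (letterSite a + x)) (t - q.1.1) (q.2 a) := by
    refine measurable_sum_letters measurable_fst.snd fun a => measurable_pop n _ ?_ ?_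
    · exact measurable_const.sub measurable_fst.fst
    · exact (measurable_pi_apply a).comp measurable_snd
  rw [meanPop, lintegral_congr fun ω => pop_succ n f t ω,
    lintegral_law Φ (G := fun q => rootPop f t q.1 + ∑ a ∈ letters q.1.2,
      pop n (fun x => f (letterSite a + x)) (t - q.1.1) (q.2 a))
      (((measurable_rootPop f t).comp measurable_fst).add hm)]
  have h : ∀ p : ℝ × Config d, ∫⁻ η, (rootPop f t p + ∑ a ∈ letters p.2,
      pop n (fun x => f (letterSite a + x)) (t - p.1) (η a)) ∂forest Φ
      = rootPop f t p +
        ∑ a ∈ letters p.2, meanPop Φ n (fun x => f (letterSite a + x)) (t - p.1) := by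
    intro p
    have hp : ∀ a, Measurable fun ω => pop n (fun x => f (letterSite a + x)) (t - p.1) ω :=
      fun a => measurable_pop n _ measurable_const measurable_id
    have hp' : ∀ a, Measurable fun η : Letter d → Sample d =>
        pop n (fun x => f (letterSite a + x)) (t - p.1) (η a) :=
      fun a => (hp a).comp (measurable_pi_apply a)
    rw [lintegral_add_left measurable_const, lintegral_const, measure_univ, mul_one,
      lintegral_finsetSum _ fun a _ => hp' a]
    congr 1
    exact Finset.sum_congr rfl fun a _ => lintegral_forest_eval Φ a (hp a)
  rw [lintegral_congr h, lintegral_add_left (measurable_rootPop f t), lintegral_rootPop,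
    lintegral_mark Φ (g := fun s φ => ∑ a ∈ letters φ,
      meanPop Φ n (fun x => f (letterSite a + x)) (t - s))]
  · congr 1
    refine lintegral_congr fun s => ?_
    exact lintegral_letters Φ fun y => meanPop Φ n (fun x => f (y + x)) (t - s)
  · exact fun φ => Finset.measurable_fun_sum _ fun a _ =>
      (measurable_meanPop Φ n _).comp (measurable_const.sub measurable_id)

/-- Every letter, `none` included, costs one unit-rate exponential wait. Hence the label length has
Poisson weights, while the displacements contribute a convolution power of `step`. -/
lemma meanPop_nat (n : ℕ) (f : Site d → ℝ≥0∞) (t : ℝ) :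
    meanPop Φ n f t = ∑ k ∈ Finset.range n, poissonWeight k t * gen Φ k f := by
  induction n generalizing f t with
  | zero => simp [meanPop, pop_zero]
  | succ n ih =>
    have hm : ∀ k, Measurable fun s => poissonWeight k (t - s) := fun k =>
      (measurable_poissonWeight k).comp (measurable_const.sub measurable_id)
    rw [Nat.cast_succ, meanPop_succ, Finset.sum_range_succ', add_comm, poissonWeight_zero]
    congr 1
    have h : ∀ s, ∑' y, step Φ y * meanPop Φ n (fun x => f (y + x)) (t - s)
        = ∑ k ∈ Finset.range n, poissonWeight k (t - s) * gen Φ (k + 1) f := by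
      intro s
      simp only [ih, gen, Finset.mul_sum, ← ENNReal.tsum_mul_left]
      rw [Summable.tsum_finsetSum fun _ _ => ENNReal.summable]
      exact Finset.sum_congr rfl fun k _ => tsum_congr fun y => by ring
    rw [lintegral_congr h, lintegral_finsetSum _ fun k _ => (hm k).mul_const _]
    refine Finset.sum_congr rfl fun k _ => ?_
    rw [lintegral_mul_const _ (hm k), lintegral_poissonWeight]

/-! ### From truncated trees to the whole tree. -/

lemma alive_mono {m n : ℕ∞} (h : m ≤ n) (t : ℝ) (ω : Sample d) : alive m t ω ⊆ alive n t ω :=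
  fun _ hw => ⟨hw.1, hw.2.trans_le h⟩

lemma pop_mono {m n : ℕ∞} (h : m ≤ n) (f : Site d → ℝ≥0∞) (t : ℝ) (ω : Sample d) :
    pop m f t ω ≤ pop n f t ω :=
  ENNReal.tsum_le_tsum fun _ => Set.indicator_le_indicator_of_subset (alive_mono h t ω)
    (fun _ => zero_le) _

lemma pop_top_eq_iSup (f : Site d → ℝ≥0∞) (t : ℝ) (ω : Sample d) :
    pop ⊤ f t ω = ⨆ n : ℕ, pop n f t ω := by
  refine le_antisymm ?_ (iSup_le fun n => pop_mono le_top f t ω)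
  rw [pop, ENNReal.tsum_eq_iSup_sum]
  refine iSup_le fun s => ?_
  refine le_iSup_of_le (s.sup List.length + 1) ?_
  refine le_trans (Finset.sum_le_sum fun w hw => ?_) (ENNReal.sum_le_tsum s)
  by_cases h : w ∈ alive ⊤ t ω
  · have : w ∈ alive ((s.sup List.length + 1 : ℕ) : ℕ∞) t ω :=
      ⟨h.1, by exact_mod_cast Nat.lt_succ_of_le (Finset.le_sup (f := List.length) hw)⟩
    rw [Set.indicator_of_mem h, Set.indicator_of_mem this]
  · rw [Set.indicator_of_notMem h]
    exact zero_le

lemma meanPop_top (f : Site d → ℝ≥0∞) (t : ℝ) :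
    meanPop Φ ⊤ f t = ∑' k, poissonWeight k t * gen Φ k f := by
  rw [ENNReal.tsum_eq_iSup_nat]
  simp only [← meanPop_nat]
  have hm : ∀ n : ℕ, Measurable fun ω : Sample d => pop n f t ω :=
    fun n => measurable_pop n f measurable_const measurable_id
  rw [meanPop, lintegral_congr fun ω => pop_top_eq_iSup f t ω, lintegral_iSup hm]
  · rfl
  · exact fun m n h ω => pop_mono (by exact_mod_cast h) f t ω

end

section

/-! ### Second moment of the total number of balls -/

lemma mass_nonneg (φ : Config d) : 0 ≤ mass φ := by
  unfold mass
  exact Finset.sum_nonneg fun _ _ => Nat.cast_nonneg _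

lemma card_letters (φ : Config d) : ((letters φ).card : ℝ) = 1 + mass φ := by
  have h := sum_letters φ fun _ => (1 : ℝ)
  simpa [mass] using h

lemma ofReal_one_add_mass (φ : Config d) :
    ENNReal.ofReal (1 + mass φ) = ((letters φ).card : ℝ≥0∞) := by
  rw [← card_letters, ENNReal.ofReal_natCast]

lemma rate_nonneg (Φ : Measure (Config d)) : 0 ≤ rate Φ := integral_nonneg mass_nonneg

variable {Φ : Measure (Config d)} [IsProbabilityMeasure Φ]

lemma integrable_mass (h : Integrable (fun φ => mass φ ^ 2) Φ) : Integrable (mass (d := d)) Φ := by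
  have hm : AEStronglyMeasurable (mass (d := d)) Φ :=
    (Measurable.of_discrete (f := mass (d := d))).aestronglyMeasurable
  exact ((memLp_two_iff_integrable_sq hm).2 h).integrable one_le_two

lemma lintegral_card_letters (h : Integrable (mass (d := d)) Φ) :
    ∫⁻ φ, ((letters φ).card : ℝ≥0∞) ∂Φ = ENNReal.ofReal (1 + rate Φ) := by
  simp_rw [← ofReal_one_add_mass]
  have h1 : Integrable (fun φ : Config d => 1 + mass φ) Φ := (integrable_const 1).add h
  rw [← ofReal_integral_eq_lintegral_ofReal h1
    (ae_of_all _ fun φ => add_nonneg zero_le_one (mass_nonneg φ)),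
    integral_add (integrable_const 1) h]
  simp [rate]

lemma lintegral_card_letters_sq_lt_top (h : Integrable (fun φ => mass φ ^ 2) Φ) :
    ∫⁻ φ, ((letters φ).card : ℝ≥0∞) ^ 2 ∂Φ < ∞ := by
  have h1 : Integrable (fun φ : Config d => (1 + mass φ) ^ 2) Φ := by
    have := ((integrable_const (1 : ℝ)).add ((integrable_mass h).const_mul 2)).add h
    refine this.congr (ae_of_all _ fun φ => ?_)
    simp only [Pi.add_apply]
    ring
  have h2 := h1.lintegral_lt_top
  simpa only [ENNReal.ofReal_pow (add_nonneg zero_le_one (mass_nonneg _)),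
    ofReal_one_add_mass] using h2

lemma tsum_step (h : Integrable (mass (d := d)) Φ) :
    ∑' y, step Φ y = ENNReal.ofReal (1 + rate Φ) := by
  have := lintegral_letters Φ fun _ => 1
  simp only [Finset.sum_const, nsmul_eq_mul, mul_one] at this
  rw [← this, lintegral_card_letters h]

lemma gen_one (h : Integrable (mass (d := d)) Φ) (k : ℕ) :
    gen Φ k 1 = ENNReal.ofReal (1 + rate Φ) ^ k := by
  induction k with
  | zero => simp [gen]
  | succ k ih =>
    simp only [gen]
    have : (fun x : Site d => (1 : Site d → ℝ≥0∞) (0 + x)) = 1 := rfl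
    have h1 : ∀ y : Site d, (fun x : Site d => (1 : Site d → ℝ≥0∞) (y + x)) = 1 := fun _ => rfl
    simp_rw [h1, ih]
    rw [ENNReal.tsum_mul_right, tsum_step h, pow_succ, mul_comm]

lemma tsum_poissonWeight {a : ℝ} (ha : 0 ≤ a) (t : ℝ) :
    ∑' k, poissonWeight k t * ENNReal.ofReal a ^ k = causalExp (a - 1) t := by
  rcases lt_or_ge t 0 with ht | ht
  · simp [poissonWeight, causalExp, causal_of_neg _ ht]
  simp only [poissonWeight, causalExp, causal_of_nonneg _ ht]
  have h : ∀ k : ℕ, ENNReal.ofReal (Real.exp (-t) * (t ^ k / k.factorial)) * ENNReal.ofReal a ^ k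
      = ENNReal.ofReal (Real.exp (-t) * ((t * a) ^ k / k.factorial)) := by
    intro k
    rw [← ENNReal.ofReal_pow ha, ← ENNReal.ofReal_mul (by positivity), mul_pow]
    congr 1
    ring
  have hs : HasSum (fun k : ℕ => Real.exp (-t) * ((t * a) ^ k / k.factorial))
      (Real.exp (-t) * Real.exp (t * a)) := by
    refine HasSum.mul_left _ ?_
    have := NormedSpace.expSeries_div_hasSum_exp (t * a)
    rwa [← Real.exp_eq_exp_ℝ] at this
  simp_rw [h]
  rw [← ENNReal.ofReal_tsum_of_nonneg (fun k => by positivity) hs.summable, hs.tsum_eq,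
    ← Real.exp_add]
  congr 2
  ring

lemma meanPop_one (h : Integrable (mass (d := d)) Φ) (t : ℝ) :
    meanPop Φ ⊤ 1 t = causalExp (rate Φ) t := by
  simp_rw [meanPop_top, gen_one h]
  rw [tsum_poissonWeight (by linarith [rate_nonneg Φ]), add_sub_cancel_left]

lemma meanPop_mono {m n : ℕ∞} (hmn : m ≤ n) (f : Site d → ℝ≥0∞) (t : ℝ) :
    meanPop Φ m f t ≤ meanPop Φ n f t :=
  lintegral_mono fun ω => pop_mono hmn f t ω

/-- Waiting times are nonnegative only almost surely, so `present` need not be empty at negative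
times for every sample; the vanishing is a statement about means. -/
lemma meanPop_of_neg (n : ℕ∞) (f : Site d → ℝ≥0∞) {t : ℝ} (ht : t < 0) :
    meanPop Φ n f t = 0 := by
  refine le_antisymm ((meanPop_mono le_top f t).trans ?_) zero_le
  simp [meanPop_top, poissonWeight, causal_of_neg _ ht]

/-- Off-diagonal terms factor by independence; the squared means that complete the double sum on the
diagonal are nonnegative. -/
lemma lintegral_forest_sum_sq_le {g : Letter d → Sample d → ℝ≥0∞} (hg : ∀ a, Measurable (g a))
    (s : Finset (Letter d)) :
    ∫⁻ η, (∑ a ∈ s, g a (η a)) ^ 2 ∂forest Φ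
      ≤ ∑ a ∈ s, ∫⁻ ω, g a ω ^ 2 ∂law Φ + (∑ a ∈ s, ∫⁻ ω, g a ω ∂law Φ) ^ 2 := by
  classical
  have hm : ∀ a, Measurable fun η : Letter d → Sample d => g a (η a) :=
    fun a => (hg a).comp (measurable_pi_apply a)
  have h1 : ∀ η : Letter d → Sample d, (∑ a ∈ s, g a (η a)) ^ 2
      = ∑ a ∈ s, ∑ b ∈ s, g a (η a) * g b (η b) := by
    intro η
    rw [sq, Finset.sum_mul_sum]
  have hmm : ∀ a b, Measurable fun η : Letter d → Sample d => g a (η a) * g b (η b) :=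
    fun a b => (hm a).mul (hm b)
  rw [lintegral_congr h1, lintegral_finsetSum _ fun a _ =>
    Finset.measurable_fun_sum _ fun b _ => hmm a b]
  simp_rw [lintegral_finsetSum s fun b _ => hmm _ b]
  rw [sq, Finset.sum_mul_sum, ← Finset.sum_add_distrib]
  refine Finset.sum_le_sum fun a ha => ?_
  have h2 : ∀ b ∈ s, ∫⁻ η, g a (η a) * g b (η b) ∂forest Φ
      ≤ (if b = a then ∫⁻ ω, g a ω ^ 2 ∂law Φ else 0)
        + (∫⁻ ω, g a ω ∂law Φ) * ∫⁻ ω, g b ω ∂law Φ := by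
    intro b _
    by_cases hab : b = a
    · subst hab
      rw [if_pos rfl]
      refine le_add_right (le_of_eq ?_)
      simp_rw [← sq]
      exact lintegral_forest_eval Φ b ((hg b).pow_const 2)
    · rw [if_neg hab, zero_add]
      have hi := (iIndepFun_forest Φ hg).indepFun (Ne.symm hab)
      have := lintegral_mul_eq_lintegral_mul_lintegral_of_indepFun (hm a) (hm b) hi
      rw [lintegral_forest_eval Φ a (hg a), lintegral_forest_eval Φ b (hg b)] at this
      exact this.le
  refine (Finset.sum_le_sum h2).trans ?_
  rw [Finset.sum_add_distrib, Finset.sum_ite_eq' s a, if_pos ha]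

variable (Φ) in
/-- The second moment of the number of balls with label of length less than `n`. -/
def secondMoment (n : ℕ∞) (t : ℝ) : ℝ≥0∞ := ∫⁻ ω, pop n 1 t ω ^ 2 ∂law Φ

variable (Φ) in
lemma measurable_secondMoment (n : ℕ∞) : Measurable (secondMoment Φ n) :=
  ((measurable_pop_prod n 1).pow_const 2).lintegral_prod_right'

lemma causalExp_sq (γ t : ℝ) : causalExp γ t ^ 2 = causalExp (2 * γ) t := by
  rcases lt_or_ge t 0 with ht | ht
  · simp [causalExp, causal_of_neg _ ht]
  · simp only [causalExp, causal_of_nonneg _ ht]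
    rw [← ENNReal.ofReal_pow (Real.exp_pos _).le, ← Real.exp_nat_mul]
    push_cast
    ring_nf

lemma lintegral_rootPop_sq (f : Site d → ℝ≥0∞) (t : ℝ) :
    ∫⁻ p, rootPop f t p ^ 2 ∂mark Φ = causalExp (-1) t * f 0 ^ 2 := by
  rw [← lintegral_rootPop Φ (fun x => f x ^ 2)]
  refine lintegral_congr fun p => ?_
  by_cases h : t ∈ Set.Ico 0 p.1 <;> simp [rootPop, h]

lemma secondMoment_succ_le (h : Integrable (mass (d := d)) Φ) (n : ℕ∞) (t : ℝ) :
    secondMoment Φ (n + 1) t ≤ causalExp (-1) t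
      + ENNReal.ofReal (1 + rate Φ) * ∫⁻ s, secondMoment Φ n (t - s) ∂expMeasure 1
      + (∫⁻ φ, ((letters φ).card : ℝ≥0∞) ^ 2 ∂Φ)
        * ∫⁻ s, causalExp (2 * rate Φ) (t - s) ∂expMeasure 1 := by
  have hm : Measurable fun q : (ℝ × Config d) × (Letter d → Sample d) =>
      ∑ a ∈ letters q.1.2, pop n 1 (t - q.1.1) (q.2 a) := by
    refine measurable_sum_letters measurable_fst.snd fun a => measurable_pop n _ ?_ ?_
    · exact measurable_const.sub measurable_fst.fst
    · exact (measurable_pi_apply a).comp measurable_snd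
  have hG : Measurable fun q : (ℝ × Config d) × (Letter d → Sample d) =>
      (rootPop 1 t q.1 + ∑ a ∈ letters q.1.2, pop n 1 (t - q.1.1) (q.2 a)) ^ 2 :=
    (((measurable_rootPop 1 t).comp measurable_fst).add hm).pow_const 2
  have hrec : ∀ ω : Sample d, pop (n + 1) 1 t ω ^ 2 = (rootPop 1 t (ω []) +
      ∑ a ∈ letters (ω []).2, pop n 1 (t - (ω []).1) (subtree ω a)) ^ 2 :=
    fun ω => congrArg (· ^ 2) (pop_succ n 1 t ω)
  rw [secondMoment, lintegral_congr hrec, lintegral_law Φ hG]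
  have hp : ∀ p : ℝ × Config d, Measurable fun ω : Sample d => pop n 1 (t - p.1) ω :=
    fun p => measurable_pop n _ measurable_const measurable_id
  have hbound : ∀ p : ℝ × Config d,
      ∫⁻ η, (rootPop 1 t p + ∑ a ∈ letters p.2, pop n 1 (t - p.1) (η a)) ^ 2 ∂forest Φ
      ≤ rootPop 1 t p ^ 2 + ((letters p.2).card * secondMoment Φ n (t - p.1)
        + (letters p.2).card ^ 2 * causalExp (2 * rate Φ) (t - p.1)) := by
    intro p
    have hpa : ∀ a, Measurable fun η : Letter d → Sample d => pop n 1 (t - p.1) (η a) :=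
      fun a => (hp p).comp (measurable_pi_apply a)
    have hS : Measurable fun η : Letter d → Sample d =>
        ∑ a ∈ letters p.2, pop n 1 (t - p.1) (η a) :=
      Finset.measurable_fun_sum _ fun a _ => hpa a
    have hexp : ∀ η : Letter d → Sample d,
        (rootPop 1 t p + ∑ a ∈ letters p.2, pop n 1 (t - p.1) (η a)) ^ 2
        = rootPop 1 t p ^ 2 + 2 * rootPop 1 t p * (∑ a ∈ letters p.2, pop n 1 (t - p.1) (η a))
          + (∑ a ∈ letters p.2, pop n 1 (t - p.1) (η a)) ^ 2 := fun η => by ring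
    rw [lintegral_congr hexp, lintegral_add_right _ (hS.pow_const 2),
      lintegral_add_left measurable_const, lintegral_const, measure_univ, mul_one,
      lintegral_const_mul _ hS, lintegral_finsetSum _ fun a _ => hpa a]
    simp_rw [lintegral_forest_eval Φ _ (hp p)]
    -- The root label and its subtrees do not coexist: before the first ring the subtrees are
    -- evaluated at a negative time, and from then on the root term is zero.
    have hcross : 2 * rootPop 1 t p * ∑ a ∈ letters p.2, ∫⁻ ω, pop n 1 (t - p.1) ω ∂law Φ
        = 0 := by
      by_cases ht : t ∈ Set.Ico 0 p.1
      · have : ∫⁻ ω, pop n 1 (t - p.1) ω ∂law Φ = 0 :=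
          meanPop_of_neg n 1 (sub_neg.2 ht.2)
        simp [this]
      · simp [rootPop, ht]
    rw [hcross, add_zero]
    gcongr
    refine (lintegral_forest_sum_sq_le (g := fun _ => pop n 1 (t - p.1)) (fun _ => hp p) _).trans ?_
    rw [Finset.sum_const, nsmul_eq_mul, Finset.sum_const, nsmul_eq_mul, mul_pow, ← causalExp_sq,
      ← meanPop_one h]
    gcongr
    · exact le_rfl
    · exact meanPop_mono le_top 1 _
  refine (lintegral_mono hbound).trans ?_
  have hms : Measurable fun s => secondMoment Φ n (t - s) :=
    (measurable_secondMoment Φ n).comp (measurable_const.sub measurable_id)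
  have hmc : Measurable fun s => causalExp (2 * rate Φ) (t - s) :=
    (measurable_causalExp _).comp (measurable_const.sub measurable_id)
  rw [lintegral_add_left ((measurable_rootPop 1 t).pow_const 2), lintegral_rootPop_sq,
    lintegral_mark Φ (g := fun s φ => (letters φ).card * secondMoment Φ n (t - s)
        + (letters φ).card ^ 2 * causalExp (2 * rate Φ) (t - s))
      fun φ => (hms.const_mul _).add (hmc.const_mul _)]
  have hinner : ∀ s, ∫⁻ φ, ((letters φ).card * secondMoment Φ n (t - s)
        + (letters φ).card ^ 2 * causalExp (2 * rate Φ) (t - s)) ∂Φ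
      = ENNReal.ofReal (1 + rate Φ) * secondMoment Φ n (t - s)
        + (∫⁻ φ, ((letters φ).card : ℝ≥0∞) ^ 2 ∂Φ) * causalExp (2 * rate Φ) (t - s) := by
    intro s
    rw [lintegral_add_left Measurable.of_discrete, lintegral_mul_const _ Measurable.of_discrete,
      lintegral_mul_const _ Measurable.of_discrete, lintegral_card_letters h]
  rw [lintegral_congr hinner, lintegral_add_left (hms.const_mul _), lintegral_const_mul _ hms,
    lintegral_const_mul _ hmc, add_assoc]
  simp

/-- The truncated second moment starts from zero and stays below a fixed supersolution of its
renewal inequality. Induction on the truncation thus proves finiteness without presupposing it, and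
monotone convergence removes the truncation. -/
lemma secondMoment_le (h : Integrable (fun φ => mass φ ^ 2) Φ) (hr : 0 < rate Φ) :
    ∃ A : ℝ, 1 ≤ A ∧ ∀ t, secondMoment Φ ⊤ t ≤ ENNReal.ofReal A * causalExp (2 * rate Φ) t := by
  set K := ∫⁻ φ, ((letters φ).card : ℝ≥0∞) ^ 2 ∂Φ with hK
  have hKt : K ≠ ∞ := (lintegral_card_letters_sq_lt_top h).ne
  -- Chosen so that `(1 + λ) A + K ≤ (1 + 2 λ) A`, that is, `K ≤ λ A`.
  set A : ℝ := 1 + K.toReal / rate Φ with hA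
  have hA1 : 1 ≤ A := le_add_of_nonneg_right (div_nonneg ENNReal.toReal_nonneg hr.le)
  refine ⟨A, hA1, fun t => ?_⟩
  have hKA : ENNReal.ofReal (1 + rate Φ) * ENNReal.ofReal A + K
      ≤ ENNReal.ofReal A * ENNReal.ofReal (1 + 2 * rate Φ) := by
    rw [← ENNReal.ofReal_toReal hKt, ← ENNReal.ofReal_mul (by linarith),
      ← ENNReal.ofReal_mul (by linarith), ← ENNReal.ofReal_add (by positivity)
      ENNReal.toReal_nonneg]
    refine ENNReal.ofReal_le_ofReal ?_
    have : A * rate Φ = rate Φ + K.toReal := by rw [hA]; field_simp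
    nlinarith
  have hA1' : 1 ≤ ENNReal.ofReal A := by simpa using ENNReal.ofReal_le_ofReal hA1
  have hn : ∀ (n : ℕ) (t : ℝ), secondMoment Φ n t ≤ ENNReal.ofReal A * causalExp (2 * rate Φ) t := by
    intro n
    induction n with
    | zero => intro t; simp [secondMoment, pop_zero]
    | succ n ih =>
      intro t
      have hmc : Measurable fun s => causalExp (2 * rate Φ) (t - s) :=
        (measurable_causalExp _).comp (measurable_const.sub measurable_id)
      set I := ∫⁻ s, causalExp (2 * rate Φ) (t - s) ∂expMeasure 1 with hI
      have h1 : ∫⁻ s, secondMoment Φ n (t - s) ∂expMeasure 1 ≤ ENNReal.ofReal A * I := by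
        rw [hI, ← lintegral_const_mul _ hmc]
        exact lintegral_mono fun s => ih _
      rw [Nat.cast_succ]
      calc secondMoment Φ (n + 1) t
          ≤ causalExp (-1) t + ENNReal.ofReal (1 + rate Φ) * (ENNReal.ofReal A * I) + K * I := by
            refine (secondMoment_succ_le (integrable_mass h) n t).trans ?_
            gcongr
        _ = causalExp (-1) t + (ENNReal.ofReal (1 + rate Φ) * ENNReal.ofReal A + K) * I := by ring
        _ ≤ ENNReal.ofReal A * causalExp (-1) t
            + (ENNReal.ofReal A * ENNReal.ofReal (1 + 2 * rate Φ)) * I := by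
            gcongr
            exact le_mul_of_one_le_left' hA1'
        _ = ENNReal.ofReal A * (causalExp (-1) t + ENNReal.ofReal (1 + 2 * rate Φ) * I) := by ring
        _ = ENNReal.ofReal A * causalExp (2 * rate Φ) t := by
            rw [hI, lintegral_causalExp (by linarith)]
  have hsup : secondMoment Φ ⊤ t = ⨆ n : ℕ, secondMoment Φ n t := by
    have hm : ∀ n : ℕ, Measurable fun ω : Sample d => pop n 1 t ω ^ 2 :=
      fun n => (measurable_pop n 1 measurable_const measurable_id).pow_const 2
    have hsq : ∀ ω : Sample d, pop ⊤ 1 t ω ^ 2 = ⨆ n : ℕ, pop n 1 t ω ^ 2 := by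
      intro ω
      rw [pop_top_eq_iSup]
      exact Monotone.map_iSup_of_continuousAt (f := fun x : ℝ≥0∞ => x ^ 2)
        (ENNReal.continuous_pow 2).continuousAt (fun a b h => pow_le_pow_left' h 2) (by simp)
    rw [secondMoment, lintegral_congr hsq, lintegral_iSup hm]
    · rfl
    · exact fun m n h ω => pow_le_pow_left' (pop_mono (by exact_mod_cast h) 1 t ω) 2
  rw [hsup]
  exact iSup_le fun n => hn n t

end

section

/-! ### Fourier series of summable functions on the lattice -/

/-- The uniform measure on the interval `(-1/2, 1/2]`. -/
def unitInterval' : Measure ℝ := volume.restrict (Set.Ioc (-(1 / 2)) (1 / 2))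

instance : IsProbabilityMeasure unitInterval' := ⟨by
  rw [unitInterval', Measure.restrict_apply_univ, Real.volume_Ioc]
  norm_num⟩

/-- The uniform measure on the cube `(-1/2, 1/2]^d`. -/
def cube (d : ℕ) : Measure (Fin d → ℝ) := Measure.pi fun _ => unitInterval'

instance : IsProbabilityMeasure (cube d) := by unfold cube; infer_instance

/-- The character `θ ↦ exp (2 π i z · θ)`. -/
def chr (z : Site d) (θ : Fin d → ℝ) : ℂ :=
  Complex.exp ((2 * Real.pi * ∑ j, (z j : ℝ) * θ j : ℝ) * Complex.I)

lemma norm_chr (z : Site d) (θ : Fin d → ℝ) : ‖chr z θ‖ = 1 := Complex.norm_exp_ofReal_mul_I _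

lemma chr_zero (θ : Fin d → ℝ) : chr 0 θ = 1 := by simp [chr]

lemma chr_add (z w : Site d) (θ : Fin d → ℝ) : chr (z + w) θ = chr z θ * chr w θ := by
  simp only [chr, ← Complex.exp_add, ← add_mul, ← Complex.ofReal_add, ← mul_add,
    ← Finset.sum_add_distrib, Pi.add_apply, Int.cast_add]

lemma chr_neg (z : Site d) (θ : Fin d → ℝ) : chr (-z) θ = conj (chr z θ) := by
  have h : ∑ j, ((-z) j : ℝ) * θ j = -∑ j, (z j : ℝ) * θ j := by simp
  rw [chr, chr, ← Complex.exp_conj, map_mul, Complex.conj_ofReal, Complex.conj_I, h]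
  congr 1
  push_cast
  ring

@[fun_prop]
lemma continuous_chr (z : Site d) : Continuous (chr z) := by
  unfold chr
  fun_prop

lemma integral_exp_int (n : ℤ) :
    ∫ x, Complex.exp ((2 * Real.pi * (n * x) : ℝ) * Complex.I) ∂unitInterval'
      = if n = 0 then 1 else 0 := by
  split_ifs with h
  · simp [h]
  · rw [unitInterval', ← intervalIntegral.integral_of_le (by norm_num)]
    have hc : (2 * Real.pi * n * Complex.I : ℂ) ≠ 0 := by
      simp [h, Real.pi_ne_zero]
    have : ∀ x : ℝ, ((2 * Real.pi * (n * x) : ℝ) * Complex.I : ℂ)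
        = (2 * Real.pi * n * Complex.I) * x := by
      intro x
      push_cast
      ring
    simp_rw [this]
    rw [integral_exp_mul_complex hc, div_eq_zero_iff, sub_eq_zero]
    left
    rw [Complex.exp_eq_exp_iff_exists_int]
    refine ⟨n, ?_⟩
    push_cast
    ring

lemma integral_chr (z : Site d) : ∫ θ, chr z θ ∂cube d = if z = 0 then 1 else 0 := by
  have h : ∀ θ, chr z θ
      = ∏ j, Complex.exp ((2 * Real.pi * (z j * θ j) : ℝ) * Complex.I) := by
    intro θ
    rw [chr, ← Complex.exp_sum, ← Finset.sum_mul, ← Complex.ofReal_sum, Finset.mul_sum]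
  simp_rw [h]
  rw [cube, integral_fintype_prod_eq_prod (𝕜 := ℂ)
    (fun (j : Fin d) (x : ℝ) => Complex.exp ((2 * Real.pi * (z j * x) : ℝ) * Complex.I))]
  simp_rw [integral_exp_int]
  split_ifs with hz
  · simp [hz]
  · obtain ⟨j, hj⟩ := Function.ne_iff.1 hz
    exact Finset.prod_eq_zero (Finset.mem_univ j) (if_neg hj)

/-- The Fourier series with coefficients `q`. -/
def fourierSum (q : Site d → ℝ) (θ : Fin d → ℝ) : ℂ := ∑' z, (q z : ℂ) * chr z θ

lemma summable_mul_chr {q : Site d → ℝ} (hq : Summable q) (θ : Fin d → ℝ) :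
    Summable fun z => (q z : ℂ) * chr z θ := by
  refine Summable.of_norm ?_
  simpa [norm_chr] using hq.abs

lemma continuous_fourierSum {q : Site d → ℝ} (hq : Summable q) : Continuous (fourierSum q) :=
  continuous_tsum (fun z => continuous_const.mul (continuous_chr z)) hq.abs fun z θ => by
    simp [norm_chr]

lemma norm_fourierSum_le {q : Site d → ℝ} (hq : Summable q) (θ : Fin d → ℝ) :
    ‖fourierSum q θ‖ ≤ ∑' z, |q z| := by
  refine tsum_of_norm_bounded hq.abs.hasSum fun z => ?_
  simp [norm_chr]

lemma integrable_cube_of_continuous_of_bounded {f : (Fin d → ℝ) → ℂ} (hf : Continuous f) (C : ℝ)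
    (hC : ∀ θ, ‖f θ‖ ≤ C) : Integrable f (cube d) :=
  Integrable.of_bound hf.aestronglyMeasurable C (ae_of_all _ hC)

lemma integral_fourierSum {q : Site d → ℝ} (hq : Summable q) (w : Site d) :
    ∫ θ, conj (chr w θ) * fourierSum q θ ∂cube d = q w := by
  have h1 : ∀ z θ, conj (chr w θ) * ((q z : ℂ) * chr z θ) = q z * chr (z - w) θ := by
    intro z θ
    rw [sub_eq_add_neg, chr_add, chr_neg]
    ring
  have h2 : ∀ z, ∫ θ, conj (chr w θ) * ((q z : ℂ) * chr z θ) ∂cube d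
      = if z = w then (q z : ℂ) else 0 := by
    intro z
    simp_rw [h1]
    rw [integral_const_mul, integral_chr]
    simp [sub_eq_zero]
  have h3 := hasSum_integral_of_summable_integral_norm (μ := cube d)
    (F := fun z θ => conj (chr w θ) * ((q z : ℂ) * chr z θ))
    (fun z => integrable_cube_of_continuous_of_bounded (by
      have := continuous_chr w
      fun_prop) |q z| fun θ => by simp [norm_chr]) (by simpa [norm_chr] using hq.abs)
  simp_rw [h2] at h3
  have h4 := h3.tsum_eq
  rw [tsum_eq_single w fun z hz => if_neg hz, if_pos rfl] at h4
  simp_rw [tsum_mul_left] at h4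
  exact h4.symm

/-- Parseval's identity. -/
lemma hasSum_sq_fourierSum {q : Site d → ℝ} (hq : Summable q) :
    HasSum (fun z => q z ^ 2) (∫ θ, ‖fourierSum q θ‖ ^ 2 ∂cube d) := by
  have hF := continuous_fourierSum hq
  have hb := norm_fourierSum_le hq
  have h1 : ∀ z, ∫ θ, conj ((q z : ℂ) * chr z θ) * fourierSum q θ ∂cube d = ((q z ^ 2 : ℝ) : ℂ) := by
    intro z
    simp_rw [map_mul, mul_assoc]
    rw [integral_const_mul, integral_fourierSum hq]
    simp [sq]
  have h3 := hasSum_integral_of_summable_integral_norm (μ := cube d)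
    (F := fun z θ => conj ((q z : ℂ) * chr z θ) * fourierSum q θ)
    (fun z => integrable_cube_of_continuous_of_bounded (by fun_prop) (|q z| * ∑' z, |q z|)
      fun θ => by
        simpa [norm_chr] using mul_le_mul_of_nonneg_left (hb θ) (abs_nonneg (q z)))
    (by
      refine Summable.of_nonneg_of_le (fun z => integral_nonneg fun θ => norm_nonneg _)
        (fun z => ?_) (hq.abs.mul_right (∑' z, |q z|))
      refine (integral_mono_of_nonneg (ae_of_all _ fun θ => norm_nonneg _)
        (integrable_const (|q z| * ∑' z, |q z|)) (ae_of_all _ fun θ => ?_)).trans (by simp)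
      simpa [norm_chr] using mul_le_mul_of_nonneg_left (hb θ) (abs_nonneg (q z)))
  simp_rw [h1] at h3
  have h5 : ∀ θ, ∑' z, conj ((q z : ℂ) * chr z θ) * fourierSum q θ
      = ((‖fourierSum q θ‖ ^ 2 : ℝ) : ℂ) := by
    intro θ
    rw [tsum_mul_right, ← Complex.conj_tsum]
    exact (Complex.conj_mul' _).trans (by norm_cast)
  simp_rw [h5] at h3
  rw [integral_complex_ofReal] at h3
  exact Complex.hasSum_ofReal.1 h3

/-- Fourier inversion with unimodular characters; this is the source of the sup bound. -/
lemma abs_le_integral_norm_fourierSum {q : Site d → ℝ} (hq : Summable q) (w : Site d) :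
    |q w| ≤ ∫ θ, ‖fourierSum q θ‖ ∂cube d := by
  have h := norm_integral_le_integral_norm (μ := cube d) fun θ => conj (chr w θ) * fourierSum q θ
  rw [integral_fourierSum hq] at h
  simpa [norm_chr] using h

/-! ### Gaussian integrals over the cube -/

/-- The squared Euclidean norm of a frequency. -/
def normSqr (θ : Fin d → ℝ) : ℝ := ∑ j, θ j ^ 2

lemma normSqr_nonneg (θ : Fin d → ℝ) : 0 ≤ normSqr θ := Finset.sum_nonneg fun _ _ => sq_nonneg _

@[fun_prop]
lemma continuous_normSqr : Continuous (normSqr (d := d)) := by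
  unfold normSqr
  fun_prop

lemma ae_cube_mem : ∀ᵐ θ ∂cube d, ∀ j, |θ j| ≤ 1 / 2 := by
  rw [cube, ae_all_iff]
  intro j
  have h : ∀ᵐ x ∂unitInterval', |x| ≤ 1 / 2 := by
    filter_upwards [ae_restrict_mem measurableSet_Ioc] with x hx
    exact abs_le.2 ⟨hx.1.le, hx.2⟩
  exact (Measure.quasiMeasurePreserving_eval (μ := fun _ : Fin d => unitInterval') j).ae h

lemma normSqr_le {θ : Fin d → ℝ} (h : ∀ j, |θ j| ≤ 1 / 2) : normSqr θ ≤ d / 4 := by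
  have h1 : ∀ j ∈ Finset.univ, θ j ^ 2 ≤ 1 / 4 := by
    intro j _
    rw [← sq_abs]
    nlinarith [h j, abs_nonneg (θ j)]
  refine (Finset.sum_le_sum h1).trans (le_of_eq ?_)
  simp
  ring

lemma integral_exp_normSqr (c : ℝ) :
    ∫ θ, Real.exp (-(c * normSqr θ)) ∂cube d
      = (∫ x, Real.exp (-c * x ^ 2) ∂unitInterval') ^ d := by
  have h : ∀ θ : Fin d → ℝ, Real.exp (-(c * normSqr θ)) = ∏ j, Real.exp (-c * θ j ^ 2) := by
    intro θ
    rw [← Real.exp_sum, normSqr, ← Finset.mul_sum, neg_mul]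
  simp_rw [h]
  rw [cube, integral_fintype_prod_eq_prod (𝕜 := ℝ) (fun (_ : Fin d) (x : ℝ) => Real.exp (-c * x ^ 2))]
  simp

lemma integrable_exp_normSqr {c : ℝ} (hc : 0 ≤ c) :
    Integrable (fun θ : Fin d → ℝ => Real.exp (-(c * normSqr θ))) (cube d) := by
  refine Integrable.of_bound (by fun_prop) 1 (ae_of_all _ fun θ => ?_)
  rw [Real.norm_eq_abs, Real.abs_exp, Real.exp_le_one_iff]
  exact neg_nonpos.2 (mul_nonneg hc (normSqr_nonneg θ))

lemma integral_exp_normSqr_le {c : ℝ} (hc : 0 < c) :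
    ∫ θ : Fin d → ℝ, Real.exp (-(c * normSqr θ)) ∂cube d ≤ (Real.pi / c) ^ ((d : ℝ) / 2) := by
  rw [integral_exp_normSqr]
  have h1 : ∫ x, Real.exp (-c * x ^ 2) ∂unitInterval' ≤ (Real.pi / c) ^ (1 / 2 : ℝ) := by
    rw [← Real.sqrt_eq_rpow, ← integral_gaussian]
    exact setIntegral_le_integral (integrable_exp_neg_mul_sq hc)
      (ae_of_all _ fun x => (Real.exp_pos _).le)
  calc _ ≤ ((Real.pi / c) ^ (1 / 2 : ℝ)) ^ d :=
        pow_le_pow_left₀ (integral_nonneg fun x => (Real.exp_pos _).le) h1 d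
    _ = _ := by
        rw [← Real.rpow_natCast, ← Real.rpow_mul (by positivity)]
        congr 1
        ring

/-- Only the box of side `t ^ (-1/2)` is kept; it lies in the cube because `t ≥ 1`, and in each
coordinate the exponent is at least `-M` there. -/
lemma le_integral_exp_normSqr {M t : ℝ} (hM : 0 ≤ M) (ht : 1 ≤ t) :
    Real.exp (-(M * d)) * t ^ (-(d : ℝ) / 2)
      ≤ ∫ θ : Fin d → ℝ, Real.exp (-(M * t * normSqr θ)) ∂cube d := by
  rw [integral_exp_normSqr]
  have ht0 : 0 < t := by linarith
  set δ : ℝ := t ^ (-(1 / 2) : ℝ) with hδ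
  have hδ0 : 0 < δ := Real.rpow_pos_of_pos ht0 _
  have hδ1 : δ ≤ 1 := Real.rpow_le_one_of_one_le_of_nonpos ht (by norm_num)
  have hδt : t * δ ^ 2 = 1 := by
    rw [hδ, ← Real.rpow_natCast, ← Real.rpow_mul ht0.le]
    norm_num
    rw [Real.rpow_neg_one, mul_inv_cancel₀ ht0.ne']
  have h1 : Real.exp (-M) * δ ≤ ∫ x, Real.exp (-(M * t) * x ^ 2) ∂unitInterval' := by
    have hsub : Set.Ioc (-(δ / 2)) (δ / 2) ⊆ Set.Ioc (-(1 / 2) : ℝ) (1 / 2) :=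
      Set.Ioc_subset_Ioc (by linarith) (by linarith)
    have hc : Continuous fun x : ℝ => Real.exp (-(M * t) * x ^ 2) := by fun_prop
    have hint : IntegrableOn (fun x : ℝ => Real.exp (-(M * t) * x ^ 2))
        (Set.Ioc (-(1 / 2) : ℝ) (1 / 2)) := hc.integrableOn_Ioc
    calc Real.exp (-M) * δ = ∫ x in Set.Ioc (-(δ / 2)) (δ / 2), Real.exp (-M) := by
          rw [setIntegral_const, Real.volume_real_Ioc_of_le (by linarith)]
          simp only [smul_eq_mul]
          ring
      _ ≤ ∫ x in Set.Ioc (-(δ / 2)) (δ / 2), Real.exp (-(M * t) * x ^ 2) := by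
          refine setIntegral_mono_on (integrableOn_const (by simp)) (hint.mono_set hsub)
            measurableSet_Ioc fun x hx => ?_
          refine Real.exp_le_exp.2 ?_
          have hx2 : x ^ 2 ≤ δ ^ 2 := by
            refine sq_le_sq' ?_ ?_
            · linarith [hx.1]
            · linarith [hx.2]
          have : M * (t * x ^ 2) ≤ M * 1 := by
            rw [← hδt]
            gcongr
          linarith
      _ ≤ _ := setIntegral_mono_set hint (ae_of_all _ fun x => (Real.exp_pos _).le)
          hsub.eventuallyLE
  calc Real.exp (-(M * d)) * t ^ (-(d : ℝ) / 2) = (Real.exp (-M) * δ) ^ d := by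
        rw [mul_pow, ← Real.exp_nat_mul, hδ, ← Real.rpow_natCast, ← Real.rpow_mul ht0.le]
        congr 2 <;> ring
    _ ≤ _ := pow_le_pow_left₀ (by positivity) h1 d

end

section

/-! ### The Fourier transform of the mean -/

/-- Finiteness of the double sum is absolute summability of the complex double series, which permits
the interchange. -/
lemma fourierSum_toReal_tsum {ι : Type*} {F : ι → Site d → ℝ≥0∞}
    (hF : ∑' i, ∑' z, F i z ≠ ∞) (θ : Fin d → ℝ) :
    fourierSum (fun z => (∑' i, F i z).toReal) θ
      = ∑' i, fourierSum (fun z => (F i z).toReal) θ := by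
  have hp : ∑' p : ι × Site d, F p.1 p.2 ≠ ∞ := by rwa [ENNReal.tsum_prod']
  have hs : Summable fun p : ι × Site d => (F p.1 p.2).toReal := ENNReal.summable_toReal hp
  have hs' : Summable (Function.uncurry fun (i : ι) (z : Site d) =>
      ((F i z).toReal : ℂ) * chr z θ) := by
    refine Summable.of_norm ?_
    refine hs.congr fun p => ?_
    simp [Function.uncurry, norm_chr]
  have hne : ∀ i z, F i z ≠ ∞ := fun i z => ENNReal.ne_top_of_tsum_ne_top
    (ENNReal.ne_top_of_tsum_ne_top hF i) z
  unfold fourierSum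
  rw [← hs'.tsum_comm]
  refine tsum_congr fun z => ?_
  beta_reduce
  rw [ENNReal.tsum_toReal_eq fun i => hne i z, Complex.ofReal_tsum, tsum_mul_right]

variable (Φ : Measure (Config d))

/-- The mean number of new balls at displacement `y`, as a real number. -/
def jump (y : Site d) : ℝ := (intensity Φ y).toReal

lemma jump_nonneg (y : Site d) : 0 ≤ jump Φ y := ENNReal.toReal_nonneg

/-- The mean number of balls at `z` at time `t`, normalized by the mean of the total number. -/
def heat [IsProbabilityMeasure Φ] (t : ℝ) (z : Site d) : ℝ :=
  Real.exp (-(rate Φ * t)) * (meanPop Φ ⊤ (Set.indicator {z} 1) t).toReal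

lemma heat_nonneg [IsProbabilityMeasure Φ] (t : ℝ) (z : Site d) : 0 ≤ heat Φ t z :=
  mul_nonneg (Real.exp_pos _).le ENNReal.toReal_nonneg

lemma displacement_nonneg (r : ℕ) (φ : Config d) : 0 ≤ displacement r φ :=
  Finset.sum_nonneg fun _ _ => mul_nonneg (pow_nonneg (norm_nonneg _) _) (Nat.cast_nonneg _)

lemma siteNorm_nonneg (z : Site d) : 0 ≤ siteNorm z := norm_nonneg _

lemma ofReal_displacement (r : ℕ) (φ : Config d) :
    ENNReal.ofReal (displacement r φ) = ∑' y, (φ y : ℝ≥0∞) * ENNReal.ofReal (siteNorm y ^ r) := by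
  rw [displacement, Finsupp.sum, ENNReal.ofReal_sum_of_nonneg fun z _ =>
    mul_nonneg (pow_nonneg (siteNorm_nonneg z) r) (Nat.cast_nonneg _), tsum_eq_sum (s := φ.support)]
  · refine Finset.sum_congr rfl fun z _ => ?_
    rw [ENNReal.ofReal_mul (pow_nonneg (siteNorm_nonneg z) r), ENNReal.ofReal_natCast, mul_comm]
  · intro y hy
    simp [Finsupp.notMem_support_iff.1 hy]

lemma displacement_zero (φ : Config d) : displacement 0 φ = mass φ := by
  simp [displacement, mass]

variable {Φ}

lemma tsum_intensity_mul {r : ℕ} (h : Integrable (displacement (d := d) r) Φ) :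
    ∑' y, intensity Φ y * ENNReal.ofReal (siteNorm y ^ r)
      = ENNReal.ofReal (∫ φ, displacement r φ ∂Φ) := by
  rw [ofReal_integral_eq_lintegral_ofReal h (ae_of_all _ (displacement_nonneg r))]
  simp_rw [ofReal_displacement]
  rw [lintegral_tsum fun _ => Measurable.aemeasurable (Measurable.of_discrete)]
  refine tsum_congr fun y => ?_
  rw [lintegral_mul_const _ Measurable.of_discrete, intensity]

lemma hasSum_jump_mul {r : ℕ} (h : Integrable (displacement (d := d) r) Φ) :
    HasSum (fun y => jump Φ y * siteNorm y ^ r) (∫ φ, displacement r φ ∂Φ) := by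
  have h1 := tsum_intensity_mul h
  have h2 := ENNReal.hasSum_toReal (h1.trans_ne ENNReal.ofReal_ne_top)
  have h3 := congrArg ENNReal.toReal h1
  rw [ENNReal.toReal_ofReal (integral_nonneg (displacement_nonneg r)),
    ENNReal.tsum_toReal_eq fun y => ENNReal.ne_top_of_tsum_ne_top
      (h1.trans_ne ENNReal.ofReal_ne_top) y] at h3
  rw [h3] at h2
  refine h2.congr_fun ?_
  intro y
  rw [ENNReal.toReal_mul, ENNReal.toReal_ofReal (pow_nonneg (siteNorm_nonneg y) r), jump]

lemma hasSum_jump (h : Integrable (mass (d := d)) Φ) : HasSum (jump Φ) (rate Φ) := by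
  have h0 : displacement (d := d) 0 = mass := funext displacement_zero
  have := hasSum_jump_mul (Φ := Φ) (r := 0) (by rwa [h0])
  simpa [h0, rate] using this

lemma intensity_ne_top (h : Integrable (mass (d := d)) Φ) (y : Site d) : intensity Φ y ≠ ∞ := by
  have h0 : displacement (d := d) 0 = mass := funext displacement_zero
  have h1 := tsum_intensity_mul (Φ := Φ) (r := 0) (by rwa [h0])
  simp only [pow_zero, ENNReal.ofReal_one, mul_one] at h1
  exact ENNReal.ne_top_of_tsum_ne_top (h1.trans_ne ENNReal.ofReal_ne_top) y

lemma fourierSum_step (h : Integrable (mass (d := d)) Φ) (θ : Fin d → ℝ) :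
    fourierSum (fun y => (step Φ y).toReal) θ = 1 + fourierSum (jump Φ) θ := by
  have h1 : ∀ y : Site d, ((step Φ y).toReal : ℂ) * chr y θ
      = (if y = 0 then 1 else 0) + (jump Φ y : ℂ) * chr y θ := by
    intro y
    rw [step, ENNReal.toReal_add _ (intensity_ne_top h y)]
    · by_cases hy : y = 0
      · simp [hy, chr_zero, jump]
      · simp [hy, jump]
    · by_cases hy : y = 0 <;> simp [hy]
  unfold fourierSum
  simp_rw [h1]
  rw [Summable.tsum_add (hasSum_ite_eq 0 (1 : ℂ)).summable
    (summable_mul_chr (hasSum_jump h).summable θ), tsum_ite_eq]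

/-! ### Bounds for the characteristic exponent -/

lemma abs_dot_le (y : Site d) (θ : Fin d → ℝ) :
    |∑ j, (y j : ℝ) * θ j| ≤ siteNorm y * Real.sqrt (normSqr θ) := by
  have h := abs_real_inner_le_norm (WithLp.toLp 2 (fun i => (y i : ℝ))) (WithLp.toLp 2 θ)
  have h1 : ‖WithLp.toLp 2 θ‖ = Real.sqrt (normSqr θ) := by
    rw [EuclideanSpace.norm_eq]
    simp [normSqr]
  rw [h1] at h
  simpa [siteNorm, PiLp.inner_apply, mul_comm] using h

lemma norm_chr_sub_one_le (y : Site d) (θ : Fin d → ℝ) :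
    ‖chr y θ - 1‖ ≤ 2 * Real.pi * siteNorm y * Real.sqrt (normSqr θ) := by
  have h := Real.norm_exp_I_mul_ofReal_sub_one_le (x := 2 * Real.pi * ∑ j, (y j : ℝ) * θ j)
  rw [mul_comm Complex.I, Real.norm_eq_abs, abs_mul, abs_of_pos Real.two_pi_pos] at h
  refine h.trans ?_
  rw [mul_assoc (2 * Real.pi)]
  exact mul_le_mul_of_nonneg_left (abs_dot_le y θ) Real.two_pi_pos.le

lemma norm_sub_one_sq {c : ℂ} (hc : ‖c‖ = 1) : ‖c - 1‖ ^ 2 = 2 * (1 - c.re) := by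
  have h := Complex.sq_norm c
  rw [hc, Complex.normSq_apply] at h
  rw [Complex.sq_norm, Complex.normSq_apply]
  simp only [Complex.sub_re, Complex.one_re, Complex.sub_im, Complex.one_im]
  nlinarith

variable (Φ) in
/-- Twice the real part of the characteristic exponent of the walk. -/
def dissipation (θ : Fin d → ℝ) : ℝ := ∑' y, jump Φ y * ‖chr y θ - 1‖ ^ 2

lemma summable_dissipation (h : Integrable (mass (d := d)) Φ) (θ : Fin d → ℝ) :
    Summable fun y => jump Φ y * ‖chr y θ - 1‖ ^ 2 := by
  refine Summable.of_nonneg_of_le (fun y => mul_nonneg (jump_nonneg Φ y) (sq_nonneg _))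
    (fun y => ?_) ((hasSum_jump h).summable.mul_right 4)
  have h1 : ‖chr y θ - 1‖ ≤ 2 := by
    refine (norm_sub_le _ _).trans ?_
    rw [norm_chr, norm_one]
    norm_num
  have : ‖chr y θ - 1‖ ^ 2 ≤ 4 := by nlinarith [norm_nonneg (chr y θ - 1)]
  exact mul_le_mul_of_nonneg_left this (jump_nonneg Φ y)

lemma dissipation_nonneg (θ : Fin d → ℝ) : 0 ≤ dissipation Φ θ :=
  tsum_nonneg fun y => mul_nonneg (jump_nonneg Φ y) (sq_nonneg _)

/-- For unimodular c, `|c - 1|² = 2 (1 - Re c)`. A drift affects only the imaginary part, so the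
decay of the kernel does not see it. -/
lemma re_exponent (h : Integrable (mass (d := d)) Φ) (θ : Fin d → ℝ) :
    (fourierSum (jump Φ) θ - rate Φ).re = -(dissipation Φ θ / 2) := by
  have h1 := Complex.hasSum_re (summable_mul_chr (hasSum_jump h).summable θ).hasSum
  have h2 : HasSum (fun y => -(jump Φ y * ‖chr y θ - 1‖ ^ 2 / 2))
      ((fourierSum (jump Φ) θ).re - rate Φ) := by
    refine (h1.sub (hasSum_jump h)).congr_fun fun y => ?_
    rw [norm_sub_one_sq (norm_chr y θ), Complex.re_ofReal_mul]
    ring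
  have h3 := ((summable_dissipation h θ).hasSum.div_const 2).neg
  rw [Complex.sub_re, Complex.ofReal_re]
  exact h2.unique h3

lemma dissipation_le (h : Integrable (mass (d := d)) Φ)
    (h2 : Integrable (displacement (d := d) 2) Φ) (θ : Fin d → ℝ) :
    dissipation Φ θ ≤ 4 * Real.pi ^ 2 * (∫ φ, displacement 2 φ ∂Φ) * normSqr θ := by
  have hs := ((hasSum_jump_mul h2).mul_left (4 * Real.pi ^ 2)).mul_right (normSqr θ)
  rw [← hs.tsum_eq]
  refine (summable_dissipation h θ).tsum_le_tsum (fun y => ?_) hs.summable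
  have h3 : ‖chr y θ - 1‖ ^ 2 ≤ (2 * Real.pi * siteNorm y * Real.sqrt (normSqr θ)) ^ 2 :=
    pow_le_pow_left₀ (norm_nonneg _) (norm_chr_sub_one_le y θ) 2
  rw [mul_pow, Real.sq_sqrt (normSqr_nonneg θ)] at h3
  calc _ ≤ jump Φ y * ((2 * Real.pi * siteNorm y) ^ 2 * normSqr θ) :=
        mul_le_mul_of_nonneg_left h3 (jump_nonneg Φ y)
    _ = _ := by ring

/-- The walk may have a drift, so the exponent is in general no better than linear in the frequency;
the first displacement moment suffices for this. -/
lemma norm_exponent_le (h : Integrable (mass (d := d)) Φ)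
    (h1 : Integrable (displacement (d := d) 1) Φ) (θ : Fin d → ℝ) :
    ‖fourierSum (jump Φ) θ - rate Φ‖
      ≤ 2 * Real.pi * (∫ φ, displacement 1 φ ∂Φ) * Real.sqrt (normSqr θ) := by
  have hs := ((hasSum_jump_mul h1).mul_left (2 * Real.pi)).mul_right (Real.sqrt (normSqr θ))
  have h2 : HasSum (fun y => (jump Φ y : ℂ) * (chr y θ - 1)) (fourierSum (jump Φ) θ - rate Φ) := by
    refine ((summable_mul_chr (hasSum_jump h).summable θ).hasSum.sub
      (Complex.hasSum_ofReal.2 (hasSum_jump h))).congr_fun fun y => ?_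
    ring
  rw [← h2.tsum_eq]
  refine tsum_of_norm_bounded hs fun y => ?_
  rw [norm_mul, Complex.norm_real, Real.norm_of_nonneg (jump_nonneg Φ y)]
  calc _ ≤ jump Φ y * (2 * Real.pi * siteNorm y * Real.sqrt (normSqr θ)) :=
        mul_le_mul_of_nonneg_left (norm_chr_sub_one_le y θ) (jump_nonneg Φ y)
    _ = _ := by ring

lemma jump_eq_zero_iff (h : Integrable (mass (d := d)) Φ) (z : Site d) :
    jump Φ z = 0 ↔ ∀ᵐ φ ∂Φ, φ z = 0 := by
  rw [jump, ENNReal.toReal_eq_zero_iff, or_iff_left (intensity_ne_top h z), intensity,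
    lintegral_eq_zero_iff Measurable.of_discrete]
  refine Filter.eventually_congr (ae_of_all _ fun φ => ?_)
  simp

/-- If the rate vanished, every configuration would almost surely be empty and the trivial subgroup
would have to be the whole lattice, which `1 ≤ d` excludes. -/
lemma rate_pos (hd : 1 ≤ d) (hirr : Irreducible Φ) (h : Integrable (mass (d := d)) Φ) :
    0 < rate Φ := by
  refine lt_of_le_of_ne (rate_nonneg Φ) fun h0 => ?_
  have h1 := (hasSum_zero_iff_of_nonneg (jump_nonneg Φ)).1 (h0 ▸ hasSum_jump h)
  have h2 : ∀ᵐ φ ∂Φ, ∀ z, φ z ≠ 0 → z ∈ (⊥ : AddSubgroup (Site d)) := by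
    rw [ae_all_iff]
    intro z
    filter_upwards [(jump_eq_zero_iff h z).1 (congrFun h1 z)] with φ hφ hz
    exact absurd hφ hz
  have h3 := hirr ⊥ h2
  have h4 : (fun _ => 1 : Site d) ∈ (⊥ : AddSubgroup (Site d)) := h3 ▸ AddSubgroup.mem_top _
  have h5 := congrFun ((AddSubgroup.mem_bot).1 h4) ⟨0, hd⟩
  simp at h5

lemma exists_norm_chr_sub_one_sq_le (hirr : Irreducible Φ) (h : Integrable (mass (d := d)) Φ)
    (v : Site d) : ∃ C, ∀ θ, ‖chr v θ - 1‖ ^ 2 ≤ C * dissipation Φ θ := by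
  let G : AddSubgroup (Site d) :=
    { carrier := {v | ∃ C, ∀ θ, ‖chr v θ - 1‖ ^ 2 ≤ C * dissipation Φ θ}
      zero_mem' := ⟨0, fun θ => by simp [chr_zero]⟩
      add_mem' := by
        rintro v w ⟨C, hC⟩ ⟨D, hD⟩
        refine ⟨2 * C + 2 * D, fun θ => ?_⟩
        have h1 : ‖chr (v + w) θ - 1‖ ≤ ‖chr v θ - 1‖ + ‖chr w θ - 1‖ := by
          have : chr (v + w) θ - 1 = chr w θ * (chr v θ - 1) + (chr w θ - 1) := by
            rw [chr_add]
            ring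
          rw [this]
          refine (norm_add_le _ _).trans (le_of_eq ?_)
          rw [norm_mul, norm_chr, one_mul]
        have h2 := pow_le_pow_left₀ (norm_nonneg _) h1 2
        nlinarith [hC θ, hD θ, sq_nonneg (‖chr v θ - 1‖ - ‖chr w θ - 1‖)]
      neg_mem' := by
        rintro v ⟨C, hC⟩
        refine ⟨C, fun θ => ?_⟩
        have : ‖chr (-v) θ - 1‖ = ‖chr v θ - 1‖ := by
          rw [chr_neg, ← Complex.norm_conj (chr v θ - 1)]
          simp
        rw [this]
        exact hC θ }
  have hG : G = ⊤ := by
    refine hirr G ?_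
    rw [ae_all_iff]
    intro z
    by_cases hz : jump Φ z = 0
    · filter_upwards [(jump_eq_zero_iff h z).1 hz] with φ hφ hz
      exact absurd hφ hz
    · refine ae_of_all _ fun φ _ => ⟨(jump Φ z)⁻¹, fun θ => ?_⟩
      have hpos : 0 < jump Φ z := lt_of_le_of_ne (jump_nonneg Φ z) (Ne.symm hz)
      rw [le_inv_mul_iff₀ hpos]
      exact (summable_dissipation h θ).le_tsum z fun y _ =>
        mul_nonneg (jump_nonneg Φ y) (sq_nonneg _)
  have : v ∈ G := hG ▸ AddSubgroup.mem_top v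
  exact this

/-- Jordan's inequality `|sin (π x)| ≥ 2 |x|`, valid exactly on the range of frequencies in the
cube. -/
lemma sixteen_mul_sq_le (j : Fin d) {θ : Fin d → ℝ} (hθ : |θ j| ≤ 1 / 2) :
    16 * θ j ^ 2 ≤ ‖chr (Pi.single j 1) θ - 1‖ ^ 2 := by
  have hsum : ∑ i, ((Pi.single j 1 : Site d) i : ℝ) * θ i = θ j := by
    rw [Finset.sum_eq_single j]
    · simp
    · intro i _ hi
      simp [hi]
    · simp
  have h1 : ‖chr (Pi.single j 1) θ - 1‖ = 2 * |Real.sin (Real.pi * θ j)| := by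
    rw [chr, hsum, mul_comm _ Complex.I, Complex.norm_exp_I_mul_ofReal_sub_one, norm_mul,
      Real.norm_eq_abs, Real.norm_eq_abs, abs_two]
    congr 3
    ring
  have h2 : 2 * |θ j| ≤ |Real.sin (Real.pi * θ j)| := by
    have hpi := Real.pi_pos
    have h3 := Real.mul_le_sin (x := Real.pi * |θ j|) (by positivity) (by nlinarith)
    have h4 : |Real.sin (Real.pi * θ j)| = |Real.sin (Real.pi * |θ j|)| := by
      rcases abs_cases (θ j) with ⟨h, _⟩ | ⟨h, _⟩
      · rw [h]
      · rw [h, mul_neg, Real.sin_neg, abs_neg]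
    rw [h4]
    refine le_trans (le_of_eq ?_) (h3.trans (le_abs_self _))
    field_simp
  rw [h1, mul_pow, sq_abs, ← sq_abs (θ j), ← sq_abs (Real.sin _)]
  have := pow_le_pow_left₀ (by positivity) h2 2
  nlinarith

/-- Nondegeneracy of the walk. -/
lemma exists_le_dissipation (hirr : Irreducible Φ) (h : Integrable (mass (d := d)) Φ) :
    ∃ κ : ℝ, 0 < κ ∧ ∀ θ : Fin d → ℝ, (∀ j, |θ j| ≤ 1 / 2) →
      κ * normSqr θ ≤ dissipation Φ θ / 2 := by
  choose C hC using fun j : Fin d => exists_norm_chr_sub_one_sq_le hirr h (Pi.single j 1)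
  -- The constants `C j` carry no sign information; absolute values and the extra `1` make `S`
  -- positive.
  set S : ℝ := ∑ j, |C j| + 1 with hS
  have hS0 : 0 < S := by positivity
  refine ⟨S⁻¹ / 2, by positivity, fun θ hθ => ?_⟩
  have h1 : normSqr θ ≤ S * dissipation Φ θ := by
    have h2 : ∀ j ∈ Finset.univ, θ j ^ 2 ≤ |C j| * dissipation Φ θ := by
      intro j _
      have h3 := (sixteen_mul_sq_le j (hθ j)).trans (hC j θ)
      have h4 := mul_le_mul_of_nonneg_right (le_abs_self (C j)) (dissipation_nonneg (Φ := Φ) θ)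
      nlinarith [sq_nonneg (θ j)]
    refine (Finset.sum_le_sum h2).trans ?_
    rw [← Finset.sum_mul]
    exact mul_le_mul_of_nonneg_right (by linarith) (dissipation_nonneg θ)
  have : S⁻¹ * normSqr θ ≤ dissipation Φ θ := by
    rw [inv_mul_le_iff₀ hS0]
    exact h1
  linarith

/-! ### The mean number of balls at a site -/

variable [IsProbabilityMeasure Φ]

lemma tsum_genAt (h : Integrable (mass (d := d)) Φ) (k : ℕ) :
    ∑' z, genAt Φ k z = ENNReal.ofReal (1 + rate Φ) ^ k := by
  rw [← gen_one h, gen_eq_tsum]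
  simp

lemma fourierSum_genAt (h : Integrable (mass (d := d)) Φ) (k : ℕ) (θ : Fin d → ℝ) :
    fourierSum (fun z => (genAt Φ k z).toReal) θ = (1 + fourierSum (jump Φ) θ) ^ k := by
  induction k with
  | zero =>
    simp only [genAt_zero, fourierSum, pow_zero]
    rw [tsum_eq_single 0 fun z hz => by simp [hz]]
    simp [chr_zero]
  | succ k ih =>
    have hsum : ∀ y, ∑' z, step Φ y * genAt Φ k (z - y)
        = step Φ y * ENNReal.ofReal (1 + rate Φ) ^ k := by
      intro y
      have h1 := (Equiv.subRight y).tsum_eq (genAt Φ k)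
      simp only [Equiv.subRight_apply] at h1
      rw [ENNReal.tsum_mul_left, h1, tsum_genAt h]
    simp_rw [genAt_succ]
    rw [fourierSum_toReal_tsum]
    · have : ∀ y, fourierSum (fun z => (step Φ y * genAt Φ k (z - y)).toReal) θ
          = ((step Φ y).toReal * chr y θ) * (1 + fourierSum (jump Φ) θ) ^ k := by
        intro y
        rw [← ih]
        unfold fourierSum
        rw [← tsum_mul_left, ← (Equiv.addRight y).tsum_eq]
        refine tsum_congr fun z => ?_
        simp only [ENNReal.toReal_mul, Equiv.coe_addRight, add_sub_cancel_right, chr_add]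
        push_cast
        ring
      simp_rw [this]
      rw [tsum_mul_right, pow_succ', ← fourierSum_step h]
      rfl
    · simp_rw [hsum]
      rw [ENNReal.tsum_mul_right, tsum_step h]
      exact ENNReal.mul_ne_top ENNReal.ofReal_ne_top (ENNReal.pow_ne_top ENNReal.ofReal_ne_top)

lemma causalExp_ne_top (γ t : ℝ) : causalExp γ t ≠ ∞ := by
  rcases lt_or_ge t 0 with ht | ht
  · simp [causalExp, causal_of_neg _ ht]
  · simp [causalExp, causal_of_nonneg _ ht]

lemma tsum_meanPop (h : Integrable (mass (d := d)) Φ) (t : ℝ) :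
    ∑' z, meanPop Φ ⊤ (Set.indicator {z} 1) t = causalExp (rate Φ) t := by
  simp_rw [meanPop_top]
  rw [ENNReal.tsum_comm]
  simp_rw [ENNReal.tsum_mul_left]
  have : ∀ k, ∑' z, gen Φ k (Set.indicator {z} 1) = ENNReal.ofReal (1 + rate Φ) ^ k :=
    fun k => tsum_genAt h k
  simp_rw [this]
  rw [tsum_poissonWeight (by linarith [rate_nonneg Φ]), add_sub_cancel_left]

lemma hasSum_heat (h : Integrable (mass (d := d)) Φ) {t : ℝ} (ht : 0 ≤ t) :
    HasSum (heat Φ t) 1 := by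
  have h1 := tsum_meanPop h t
  have h2 := ENNReal.hasSum_toReal (h1.trans_ne (causalExp_ne_top _ _))
  have h3 := congrArg ENNReal.toReal h1
  rw [ENNReal.tsum_toReal_eq fun y => ENNReal.ne_top_of_tsum_ne_top
      (h1.trans_ne (causalExp_ne_top _ _)) y] at h3
  rw [h3, causalExp, causal_of_nonneg _ ht, ENNReal.toReal_ofReal (Real.exp_pos _).le] at h2
  have h4 := h2.mul_left (Real.exp (-(rate Φ * t)))
  rwa [← Real.exp_add, neg_add_cancel, Real.exp_zero] at h4

/-- Convolution powers become powers of `1 + ĵ`, with ĵ the transform of `jump`; the Poisson weights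
sum them to an exponential, and the summand `1` cancels the factor `exp (-t)`. -/
lemma fourierSum_heat (h : Integrable (mass (d := d)) Φ) {t : ℝ} (ht : 0 ≤ t) (θ : Fin d → ℝ) :
    fourierSum (heat Φ t) θ = Complex.exp (t * (fourierSum (jump Φ) θ - rate Φ)) := by
  have h1 : fourierSum (heat Φ t) θ = Real.exp (-(rate Φ * t)) *
      fourierSum (fun z => (∑' k, poissonWeight k t * genAt Φ k z).toReal) θ := by
    unfold fourierSum
    rw [← tsum_mul_left]
    refine tsum_congr fun z => ?_
    rw [heat, meanPop_top]
    push_cast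
    rw [mul_assoc]
    rfl
  rw [h1, fourierSum_toReal_tsum]
  · have h2 : ∀ k, fourierSum (fun z => (poissonWeight k t * genAt Φ k z).toReal) θ
        = Complex.exp (-t) * ((t * (1 + fourierSum (jump Φ) θ)) ^ k / k.factorial) := by
      intro k
      have : fourierSum (fun z => (poissonWeight k t * genAt Φ k z).toReal) θ
          = (poissonWeight k t).toReal * fourierSum (fun z => (genAt Φ k z).toReal) θ := by
        unfold fourierSum
        rw [← tsum_mul_left]
        refine tsum_congr fun z => ?_
        simp only [ENNReal.toReal_mul]
        push_cast
        ring
      rw [this, fourierSum_genAt h, poissonWeight, causal_of_nonneg _ ht,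
        ENNReal.toReal_ofReal (by positivity), mul_pow]
      push_cast
      ring
    simp_rw [h2]
    rw [tsum_mul_left]
    have h3 := (NormedSpace.expSeries_div_hasSum_exp (t * (1 + fourierSum (jump Φ) θ))).tsum_eq
    rw [← Complex.exp_eq_exp_ℂ] at h3
    rw [h3]
    push_cast
    rw [← Complex.exp_add, ← Complex.exp_add]
    congr 1
    ring
  · simp_rw [ENNReal.tsum_mul_left, tsum_genAt h]
    rw [tsum_poissonWeight (by linarith [rate_nonneg Φ])]
    exact causalExp_ne_top _ _

lemma norm_fourierSum_heat (h : Integrable (mass (d := d)) Φ) {t : ℝ} (ht : 0 ≤ t)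
    (θ : Fin d → ℝ) :
    ‖fourierSum (heat Φ t) θ‖ = Real.exp (-(t * dissipation Φ θ / 2)) := by
  rw [fourierSum_heat h ht, Complex.norm_exp, Complex.re_ofReal_mul, re_exponent h]
  congr 1
  ring

end

section

/-! ### Local estimates for the mean -/

/-- Mean value inequality on the convex half-plane where the derivative of `exp` has norm at most
one. -/
lemma norm_exp_sub_one_le_of_re_nonpos {w : ℂ} (hw : w.re ≤ 0) : ‖Complex.exp w - 1‖ ≤ ‖w‖ := by
  have hconv : Convex ℝ {z : ℂ | z.re ≤ 0} := convex_halfSpace_re_le 0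
  have h := hconv.norm_image_sub_le_of_norm_hasDerivWithin_le (f := Complex.exp)
    (f' := Complex.exp) (C := 1) (x := 0) (y := w)
    (fun z _ => (Complex.hasDerivAt_exp z).hasDerivWithinAt)
    (fun z hz => by
      rw [Complex.norm_exp, Real.exp_le_one_iff]
      exact hz) (by simp) hw
  simpa using h

variable {Φ : Measure (Config d)}

/-- On the cube `normSqr θ ≤ d / 4`, so replacing `r` by `1 + r` costs a bounded factor. This keeps
the estimates uniform down to `r = 0`, as the renewal argument requires. -/
lemma exp_dissipation_le {κ r : ℝ} (hκ : 0 < κ) (hr : 0 ≤ r) {θ : Fin d → ℝ}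
    (hθ : ∀ j, |θ j| ≤ 1 / 2) (h : κ * normSqr θ ≤ dissipation Φ θ / 2) :
    Real.exp (-(r * dissipation Φ θ / 2))
      ≤ Real.exp (κ * d / 4) * Real.exp (-(κ * (1 + r) * normSqr θ)) := by
  rw [← Real.exp_add]
  refine Real.exp_le_exp.2 ?_
  have h1 := mul_le_mul_of_nonneg_left h hr
  have h2 := mul_le_mul_of_nonneg_left (normSqr_le hθ) hκ.le
  linarith

variable [IsProbabilityMeasure Φ]

/-- The decay of the heat kernel. -/
lemma exists_heat_le (hirr : Irreducible Φ) (h : Integrable (mass (d := d)) Φ) :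
    ∃ C : ℝ, 0 < C ∧ ∀ r, 0 ≤ r → ∀ z, heat Φ r z ≤ C * (1 + r) ^ (-(d : ℝ) / 2) := by
  obtain ⟨κ, hκ, hdis⟩ := exists_le_dissipation hirr h
  refine ⟨Real.exp (κ * d / 4) * (Real.pi / κ) ^ ((d : ℝ) / 2), by positivity, fun r hr z => ?_⟩
  have hr1 : 0 < 1 + r := by linarith
  have h1 := abs_le_integral_norm_fourierSum (hasSum_heat h hr).summable z
  refine (le_abs_self _).trans (h1.trans ?_)
  simp_rw [norm_fourierSum_heat h hr]
  have h2 : ∫ θ, Real.exp (-(r * dissipation Φ θ / 2)) ∂cube d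
      ≤ ∫ θ, Real.exp (κ * d / 4) * Real.exp (-(κ * (1 + r) * normSqr θ)) ∂cube d := by
    refine integral_mono_of_nonneg (ae_of_all _ fun θ => (Real.exp_pos _).le)
      ((integrable_exp_normSqr (by positivity)).const_mul _) ?_
    filter_upwards [ae_cube_mem] with θ hθ
    exact exp_dissipation_le hκ hr hθ (hdis θ hθ)
  refine h2.trans ?_
  rw [integral_const_mul, mul_assoc]
  refine mul_le_mul_of_nonneg_left ?_ (Real.exp_pos _).le
  refine (integral_exp_normSqr_le (by positivity)).trans (le_of_eq ?_)
  rw [← div_div, Real.div_rpow (by positivity) hr1.le, div_eq_mul_inv, ← Real.rpow_neg hr1.le,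
    neg_div]

/-- The lower bound for the `ℓ²` norm of the heat kernel. -/
lemma exists_le_tsum_heat_sq (h : Integrable (mass (d := d)) Φ)
    (h2 : Integrable (displacement (d := d) 2) Φ) :
    ∃ c : ℝ, 0 < c ∧ ∀ t, 1 ≤ t → c * t ^ (-(d : ℝ) / 2) ≤ ∑' z, heat Φ t z ^ 2 := by
  set M : ℝ := 4 * Real.pi ^ 2 * ∫ φ, displacement 2 φ ∂Φ with hM
  have hM0 : 0 ≤ M := mul_nonneg (by positivity) (integral_nonneg (displacement_nonneg 2))
  refine ⟨Real.exp (-(M * d)), Real.exp_pos _, fun t ht => ?_⟩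
  have ht0 : 0 ≤ t := by linarith
  have hq := (hasSum_heat h ht0).summable
  rw [(hasSum_sq_fourierSum hq).tsum_eq]
  refine (le_integral_exp_normSqr hM0 ht).trans ?_
  refine integral_mono_of_nonneg (ae_of_all _ fun θ => (Real.exp_pos _).le) ?_
    (ae_of_all _ fun θ => ?_)
  · refine Integrable.of_bound (C := 1)
      ((continuous_fourierSum hq).norm.pow 2).aestronglyMeasurable (ae_of_all _ fun θ => ?_)
    rw [Real.norm_of_nonneg (sq_nonneg _), norm_fourierSum_heat h ht0, ← Real.exp_nat_mul,
      Real.exp_le_one_iff]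
    have := mul_nonneg ht0 (dissipation_nonneg (Φ := Φ) θ)
    push_cast
    linarith
  · beta_reduce
    rw [norm_fourierSum_heat h ht0, ← Real.exp_nat_mul]
    refine Real.exp_le_exp.2 ?_
    have := mul_le_mul_of_nonneg_left (dissipation_le h h2 θ) ht0
    rw [← hM] at this
    push_cast
    linarith

lemma fourierSum_shift {q : Site d → ℝ} (u : Site d) (θ : Fin d → ℝ) :
    fourierSum (fun z => q (z - u)) θ = chr u θ * fourierSum q θ := by
  unfold fourierSum
  rw [← tsum_mul_left, ← (Equiv.addRight u).tsum_eq]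
  refine tsum_congr fun z => ?_
  simp only [Equiv.coe_addRight, add_sub_cancel_right, chr_add]
  ring

lemma summable_shift {q : Site d → ℝ} (hq : Summable q) (u : Site d) :
    Summable fun z => q (z - u) := (Equiv.subRight u).summable_iff.2 hq

lemma mul_exp_le (x : ℝ) : x * Real.exp (-(2 * x)) ≤ Real.exp (-x) := by
  have h : x ≤ Real.exp x := by linarith [Real.add_one_le_exp x]
  calc x * Real.exp (-(2 * x)) ≤ Real.exp x * Real.exp (-(2 * x)) :=
        mul_le_mul_of_nonneg_right h (Real.exp_pos _).le
    _ = Real.exp (-x) := by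
        rw [← Real.exp_add]
        congr 1
        ring

/-- The regularity of the heat kernel in space and time, in the `ℓ²` sense. -/
lemma exists_tsum_heat_sub_sq_le (hirr : Irreducible Φ) (h : Integrable (mass (d := d)) Φ)
    (h1 : Integrable (displacement (d := d) 1) Φ) :
    ∃ C : ℝ, 0 < C ∧ ∀ r s, 0 ≤ r → 0 ≤ s → ∀ u : Site d,
      (Summable fun z => (heat Φ r (z - u) - heat Φ (r + s) z) ^ 2) ∧
      ∑' z, (heat Φ r (z - u) - heat Φ (r + s) z) ^ 2
        ≤ C * (siteNorm u + s) ^ 2 * (1 + r) ^ (-((d : ℝ) + 2) / 2) := by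
  obtain ⟨κ, hκ, hdis⟩ := exists_le_dissipation hirr h
  set S : ℝ := ∫ φ, displacement 1 φ ∂Φ with hS
  have hS0 : 0 ≤ S := integral_nonneg (displacement_nonneg 1)
  set B : ℝ := 2 * Real.pi * (1 + S) with hB
  have hB0 : 0 < B := mul_pos Real.two_pi_pos (by linarith)
  refine ⟨B ^ 2 * Real.exp (κ * d / 2) * κ⁻¹ * (Real.pi / κ) ^ ((d : ℝ) / 2), by positivity,
    fun r s hr hs u => ?_⟩
  have hr1 : 0 < 1 + r := by linarith
  have hq1 := summable_shift (hasSum_heat h hr).summable u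
  have hq2 := (hasSum_heat h (add_nonneg hr hs)).summable
  have hq := hq1.sub hq2
  have hP := hasSum_sq_fourierSum hq
  refine ⟨hP.summable, ?_⟩
  rw [hP.tsum_eq]
  -- The shift in space and the delay in time both act as multipliers; each multiplier differs from
  -- `1` by a term of first order in the frequency.
  have hF : ∀ θ, fourierSum (fun z => heat Φ r (z - u) - heat Φ (r + s) z) θ
      = fourierSum (heat Φ r) θ * ((chr u θ - 1)
        - (Complex.exp (s * (fourierSum (jump Φ) θ - rate Φ)) - 1)) := by
    intro θ
    have : fourierSum (fun z => heat Φ r (z - u) - heat Φ (r + s) z) θ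
        = fourierSum (fun z => heat Φ r (z - u)) θ - fourierSum (heat Φ (r + s)) θ := by
      unfold fourierSum
      rw [← (summable_mul_chr hq1 θ).tsum_sub (summable_mul_chr hq2 θ)]
      refine tsum_congr fun z => ?_
      push_cast
      ring
    rw [this, fourierSum_shift, fourierSum_heat h (add_nonneg hr hs), fourierSum_heat h hr]
    push_cast
    rw [add_mul, Complex.exp_add]
    ring
  have hu := siteNorm_nonneg u
  have hdiff : ∀ θ, ‖(chr u θ - 1) - (Complex.exp (s * (fourierSum (jump Φ) θ - rate Φ)) - 1)‖
      ≤ B * (siteNorm u + s) * Real.sqrt (normSqr θ) := by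
    intro θ
    refine (norm_sub_le _ _).trans ?_
    have e1 := norm_chr_sub_one_le u θ
    have e2 : ‖Complex.exp (s * (fourierSum (jump Φ) θ - rate Φ)) - 1‖
        ≤ s * (2 * Real.pi * S * Real.sqrt (normSqr θ)) := by
      refine (norm_exp_sub_one_le_of_re_nonpos ?_).trans ?_
      · rw [Complex.re_ofReal_mul, re_exponent h]
        have := mul_nonneg hs (dissipation_nonneg (Φ := Φ) θ)
        linarith
      · rw [norm_mul, Complex.norm_real, Real.norm_of_nonneg hs]
        exact mul_le_mul_of_nonneg_left (norm_exponent_le h h1 θ) hs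
    have hsq := Real.sqrt_nonneg (normSqr θ)
    have hpi := Real.two_pi_pos
    calc _ ≤ 2 * Real.pi * siteNorm u * Real.sqrt (normSqr θ)
          + s * (2 * Real.pi * S * Real.sqrt (normSqr θ)) := add_le_add e1 e2
      _ = 2 * Real.pi * Real.sqrt (normSqr θ) * (siteNorm u + s * S) := by ring
      _ ≤ 2 * Real.pi * Real.sqrt (normSqr θ) * ((1 + S) * (siteNorm u + s)) := by
          refine mul_le_mul_of_nonneg_left ?_ (by positivity)
          nlinarith [mul_nonneg hS0 hu]
      _ = _ := by rw [hB]; ring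
  have hpt : ∀ θ : Fin d → ℝ, (∀ j, |θ j| ≤ 1 / 2) →
      ‖fourierSum (fun z => heat Φ r (z - u) - heat Φ (r + s) z) θ‖ ^ 2
      ≤ (B ^ 2 * Real.exp (κ * d / 2) * κ⁻¹ * (siteNorm u + s) ^ 2 * (1 + r)⁻¹)
        * Real.exp (-(κ * (1 + r) * normSqr θ)) := by
    intro θ hθ
    rw [hF, norm_mul, norm_fourierSum_heat h hr, mul_pow]
    have e1 := pow_le_pow_left₀ (Real.exp_pos _).le (exp_dissipation_le hκ hr hθ (hdis θ hθ)) 2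
    have e2 := pow_le_pow_left₀ (norm_nonneg _) (hdiff θ) 2
    rw [mul_pow, Real.sq_sqrt (normSqr_nonneg θ)] at e2
    -- Absorbing the factor `normSqr θ` into half of the Gaussian leaves `(κ (1 + r))⁻¹`, the gain
    -- from exponent `d / 2` to `(d + 2) / 2`.
    have e3 := mul_exp_le (κ * (1 + r) * normSqr θ)
    have hk : κ * (1 + r) ≠ 0 := by positivity
    calc _ ≤ (Real.exp (κ * d / 4) * Real.exp (-(κ * (1 + r) * normSqr θ))) ^ 2
          * ((B * (siteNorm u + s)) ^ 2 * normSqr θ) := by gcongr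
      _ = B ^ 2 * Real.exp (κ * d / 2) * κ⁻¹ * (siteNorm u + s) ^ 2 * (1 + r)⁻¹
          * (κ * (1 + r) * normSqr θ * Real.exp (-(2 * (κ * (1 + r) * normSqr θ)))) := by
          rw [mul_pow, ← Real.exp_nat_mul, ← Real.exp_nat_mul]
          rw [show ((2 : ℕ) : ℝ) * (κ * d / 4) = κ * d / 2 by push_cast; ring,
            show ((2 : ℕ) : ℝ) * -(κ * (1 + r) * normSqr θ)
              = -(2 * (κ * (1 + r) * normSqr θ)) by push_cast; ring]
          field_simp
      _ ≤ _ := by gcongr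
  calc _ ≤ ∫ θ, (B ^ 2 * Real.exp (κ * d / 2) * κ⁻¹ * (siteNorm u + s) ^ 2 * (1 + r)⁻¹)
        * Real.exp (-(κ * (1 + r) * normSqr θ)) ∂cube d := by
        refine integral_mono_of_nonneg (ae_of_all _ fun θ => sq_nonneg _)
          ((integrable_exp_normSqr (by positivity)).const_mul _) ?_
        filter_upwards [ae_cube_mem] with θ hθ
        exact hpt θ hθ
    _ ≤ (B ^ 2 * Real.exp (κ * d / 2) * κ⁻¹ * (siteNorm u + s) ^ 2 * (1 + r)⁻¹)
        * (Real.pi / (κ * (1 + r))) ^ ((d : ℝ) / 2) := by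
        rw [integral_const_mul]
        refine mul_le_mul_of_nonneg_left (integral_exp_normSqr_le (by positivity)) (by positivity)
    _ = _ := by
        have e : (Real.pi / (κ * (1 + r))) ^ ((d : ℝ) / 2)
            = (Real.pi / κ) ^ ((d : ℝ) / 2) * (1 + r) ^ (-((d : ℝ) / 2)) := by
          rw [← div_div, Real.div_rpow (by positivity) hr1.le, Real.rpow_neg hr1.le]
          rfl
        rw [e, show -((d : ℝ) + 2) / 2 = -1 + -((d : ℝ) / 2) by ring,
          Real.rpow_add hr1, Real.rpow_neg_one]
        ring

end

section

/-! ### Deviations of the local numbers of balls -/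

/-- The number of balls at `z`, valued in `ℝ≥0∞`. -/
abbrev popAt (z : Site d) (t : ℝ) (ω : Sample d) : ℝ≥0∞ := pop ⊤ (Set.indicator {z} 1) t ω

lemma popAt_eq_encard (z : Site d) (t : ℝ) (ω : Sample d) :
    popAt z t ω = ({w ∈ present ω t | position w = z}.encard : ℝ≥0∞) := by
  rw [← ENNReal.tsum_set_one, tsum_subtype _ fun _ => (1 : ℝ≥0∞), popAt, pop]
  refine tsum_congr fun w => ?_
  by_cases h : w ∈ present ω t
  · by_cases hz : position w = z <;> simp [Set.indicator, alive, h, hz]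
  · simp [Set.indicator, alive, h]

lemma pop_one_eq_encard (t : ℝ) (ω : Sample d) :
    pop ⊤ 1 t ω = ((present ω t).encard : ℝ≥0∞) := by
  rw [← ENNReal.tsum_set_one, tsum_subtype _ fun _ => (1 : ℝ≥0∞), pop]
  refine tsum_congr fun w => ?_
  by_cases h : w ∈ present ω t <;> simp [Set.indicator, alive, h]

/-- Both sides assign `0` to an infinite set, so the passage to `ℝ≥0∞` is valid for every sample. -/
lemma toReal_encard {α : Type*} (s : Set α) : ((s.encard : ℝ≥0∞)).toReal = (s.ncard : ℝ) := by
  rcases s.finite_or_infinite with h | h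
  · rw [← h.cast_ncard_eq]
    simp
  · simp [h.encard_eq, h.ncard]

lemma count_eq (z : Site d) (t : ℝ) (ω : Sample d) : count z t ω = (popAt z t ω).toReal := by
  rw [popAt_eq_encard, toReal_encard, count]

lemma total_eq (t : ℝ) (ω : Sample d) : total t ω = (pop ⊤ 1 t ω).toReal := by
  rw [pop_one_eq_encard, toReal_encard, total]

lemma tsum_popAt (t : ℝ) (ω : Sample d) : ∑' z, popAt z t ω = pop ⊤ 1 t ω := by
  simp only [popAt, pop]
  rw [ENNReal.tsum_comm]
  refine tsum_congr fun w => ?_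
  by_cases h : w ∈ alive ⊤ t ω
  · simp only [Set.indicator_of_mem h]
    rw [tsum_eq_single (position w) fun z hz => by simp [Ne.symm hz]]
    simp
  · simp only [Set.indicator_of_notMem h, tsum_zero]

lemma popAt_le (z : Site d) (t : ℝ) (ω : Sample d) : popAt z t ω ≤ pop ⊤ 1 t ω := by
  rw [← tsum_popAt]
  exact ENNReal.le_tsum z

/-- The deviation of the number of balls at `z` from the fraction `α` of all balls. -/
def dev (z : Site d) (α t : ℝ) (ω : Sample d) : ℝ :=
  (popAt z t ω).toReal - α * (pop ⊤ 1 t ω).toReal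

lemma measurable_dev {γ : Type*} [MeasurableSpace γ] (z : Site d) (α : ℝ)
    {t : γ → ℝ} {ω : γ → Sample d} (ht : Measurable t) (hω : Measurable ω) :
    Measurable fun x => dev z α (t x) (ω x) :=
  (measurable_pop ⊤ _ ht hω).ennreal_toReal.sub
    ((measurable_pop ⊤ _ ht hω).ennreal_toReal.const_mul α)

/-- The contribution of the initial ball before its first ring. -/
def rootDev (z : Site d) (α t : ℝ) (p : ℝ × Config d) : ℝ :=
  (Set.Ico 0 p.1).indicator (fun _ => Set.indicator {z} (fun _ => (1 : ℝ)) 0 - α) t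

/-- Subtrees see the site shifted but inherit the level `α` unchanged, which is why `z` and `α` are
independent parameters. Finiteness is what makes `toReal` additive here. -/
lemma dev_eq (z : Site d) (α t : ℝ) {ω : Sample d} (h : pop ⊤ 1 t ω ≠ ∞) :
    dev z α t ω = rootDev z α t (ω []) +
      ∑ a ∈ letters (ω []).2, dev (z - letterSite a) α (t - (ω []).1) (subtree ω a) := by
  have h1 : pop ⊤ 1 t ω = rootPop 1 t (ω []) +
      ∑ a ∈ letters (ω []).2, pop ⊤ 1 (t - (ω []).1) (subtree ω a) := pop_succ ⊤ 1 t ω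
  have h2 : popAt z t ω = rootPop (Set.indicator {z} 1) t (ω []) +
      ∑ a ∈ letters (ω []).2, popAt (z - letterSite a) (t - (ω []).1) (subtree ω a) := by
    have := pop_succ ⊤ (Set.indicator {z} 1) t ω
    simp_rw [indicator_shift] at this
    exact this
  have h3 := h2 ▸ ne_top_of_le_ne_top h (popAt_le z t ω)
  rw [h1] at h
  obtain ⟨hr, hs⟩ := ENNReal.add_ne_top.1 h
  obtain ⟨hr', hs'⟩ := ENNReal.add_ne_top.1 h3
  have hs1 := ENNReal.sum_ne_top.1 hs
  have hs2 := ENNReal.sum_ne_top.1 hs'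
  simp only [dev]
  rw [h1, h2, ENNReal.toReal_add hr hs, ENNReal.toReal_add hr' hs', ENNReal.toReal_sum hs1,
    ENNReal.toReal_sum hs2, Finset.sum_sub_distrib, ← Finset.mul_sum]
  have h4 : rootDev z α t (ω []) = (rootPop (Set.indicator {z} 1) t (ω [])).toReal
      - α * (rootPop 1 t (ω [])).toReal := by
    by_cases ht : t ∈ Set.Ico 0 (ω []).1
    · by_cases hz : (0 : Site d) = z <;> simp [rootDev, rootPop, ht, hz]
    · simp [rootDev, rootPop, ht]
  rw [h4]
  ring

lemma dev_sq_le (z : Site d) {α : ℝ} (hα : 0 ≤ α) (t : ℝ) (ω : Sample d) :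
    ENNReal.ofReal (dev z α t ω ^ 2)
      ≤ popAt z t ω * pop ⊤ 1 t ω + ENNReal.ofReal (α ^ 2) * pop ⊤ 1 t ω ^ 2 := by
  have hof : ∀ x : ℝ≥0∞, ENNReal.ofReal (x.toReal ^ 2) ≤ x ^ 2 := fun x => by
    rw [ENNReal.ofReal_pow ENNReal.toReal_nonneg]
    exact pow_le_pow_left' ENNReal.ofReal_toReal_le 2
  have h1 : dev z α t ω ^ 2
      ≤ (popAt z t ω).toReal ^ 2 + α ^ 2 * (pop ⊤ 1 t ω).toReal ^ 2 := by
    have := mul_nonneg (ENNReal.toReal_nonneg (a := popAt z t ω))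
      (mul_nonneg hα (ENNReal.toReal_nonneg (a := pop ⊤ 1 t ω)))
    rw [dev]
    nlinarith
  refine (ENNReal.ofReal_le_ofReal h1).trans ?_
  rw [ENNReal.ofReal_add (sq_nonneg _) (by positivity), ENNReal.ofReal_mul (sq_nonneg _)]
  gcongr
  · refine (hof _).trans ?_
    rw [sq]
    gcongr
    exact popAt_le z t ω
  · exact hof _

variable {Φ : Measure (Config d)} [IsProbabilityMeasure Φ]

lemma ae_pop_one_ne_top (h : Integrable (mass (d := d)) Φ) (t : ℝ) :
    ∀ᵐ ω ∂law Φ, pop ⊤ 1 t ω ≠ ∞ := by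
  have hm : Measurable fun ω : Sample d => pop ⊤ 1 t ω :=
    measurable_pop ⊤ 1 measurable_const measurable_id
  have h1 : ∫⁻ ω, pop ⊤ 1 t ω ∂law Φ ≠ ∞ := by
    have := meanPop_one h t
    rw [meanPop] at this
    rw [this]
    exact causalExp_ne_top _ _
  filter_upwards [ae_lt_top hm h1] with ω hω using hω.ne

lemma ae_pop_one_eq_zero {t : ℝ} (ht : t < 0) :
    ∀ᵐ ω ∂law Φ, pop ⊤ 1 t ω = 0 := by
  have hm : Measurable fun ω : Sample d => pop ⊤ 1 t ω :=
    measurable_pop ⊤ 1 measurable_const measurable_id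
  exact (lintegral_eq_zero_iff hm).1 (meanPop_of_neg (Φ := Φ) ⊤ 1 ht)

lemma ae_dev_eq_zero {t : ℝ} (ht : t < 0) (z : Site d) (α : ℝ) :
    ∀ᵐ ω ∂law Φ, dev z α t ω = 0 := by
  filter_upwards [ae_pop_one_eq_zero (Φ := Φ) ht] with ω hω
  have : popAt z t ω = 0 := le_antisymm ((popAt_le z t ω).trans hω.le) zero_le
  simp [dev, hω, this]

variable (Φ) in
/-- The second moment of the deviation. -/
def devSq (z : Site d) (α t : ℝ) : ℝ≥0∞ := ∫⁻ ω, ENNReal.ofReal (dev z α t ω ^ 2) ∂law Φ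

variable (Φ) in
lemma measurable_devSq (z : Site d) (α : ℝ) : Measurable (devSq Φ z α) :=
  (((measurable_dev z α measurable_fst measurable_snd).pow_const 2).ennreal_ofReal
    (α := ℝ × Sample d)).lintegral_prod_right'

/-- The crude a priori bound that starts the final iteration: the local counts add up to the total,
and the squares of the profile add up to at most its mass `1`. -/
lemma tsum_devSq_le {β : Site d → ℝ} (hβ0 : ∀ z, 0 ≤ β z) (hβ1 : ∀ z, β z ≤ 1)
    (hβ : HasSum β 1) (x : Site d) (t : ℝ) :
    ∑' z, devSq Φ (z - x) (β z) t ≤ 2 * secondMoment Φ ⊤ t := by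
  have hm : ∀ z, Measurable fun ω : Sample d => ENNReal.ofReal (dev (z - x) (β z) t ω ^ 2) :=
    fun z => ((measurable_dev _ _ measurable_const measurable_id).pow_const 2).ennreal_ofReal
  have hN : Measurable fun ω : Sample d => pop ⊤ 1 t ω ^ 2 :=
    (measurable_pop ⊤ 1 measurable_const measurable_id).pow_const 2
  simp only [devSq]
  rw [← lintegral_tsum fun z => (hm z).aemeasurable, secondMoment, ← lintegral_const_mul _ hN]
  refine lintegral_mono fun ω => ?_
  have h1 : ∑' z, popAt (z - x) t ω = pop ⊤ 1 t ω := by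
    rw [← tsum_popAt]
    exact (Equiv.subRight x).tsum_eq fun z => popAt z t ω
  have h2 : ∑' z, ENNReal.ofReal (β z ^ 2) ≤ 1 := by
    have : ∑' z, ENNReal.ofReal (β z) = 1 := by
      rw [← ENNReal.ofReal_tsum_of_nonneg hβ0 hβ.summable, hβ.tsum_eq, ENNReal.ofReal_one]
    rw [← this]
    exact ENNReal.tsum_le_tsum fun z => ENNReal.ofReal_le_ofReal (by nlinarith [hβ0 z, hβ1 z])
  calc _ ≤ ∑' z, (popAt (z - x) t ω * pop ⊤ 1 t ω
        + ENNReal.ofReal (β z ^ 2) * pop ⊤ 1 t ω ^ 2) :=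
        ENNReal.tsum_le_tsum fun z => dev_sq_le _ (hβ0 z) t ω
    _ = pop ⊤ 1 t ω ^ 2 + (∑' z, ENNReal.ofReal (β z ^ 2)) * pop ⊤ 1 t ω ^ 2 := by
        rw [ENNReal.tsum_add, ENNReal.tsum_mul_right, ENNReal.tsum_mul_right, h1, ← sq]
    _ ≤ pop ⊤ 1 t ω ^ 2 + 1 * pop ⊤ 1 t ω ^ 2 := by gcongr
    _ = 2 * pop ⊤ 1 t ω ^ 2 := by ring

lemma secondMoment_ne_top (h : Integrable (fun φ => mass φ ^ 2) Φ) (hr : 0 < rate Φ) (t : ℝ) :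
    secondMoment Φ ⊤ t ≠ ∞ := by
  obtain ⟨A, -, hA⟩ := secondMoment_le h hr
  exact ne_top_of_le_ne_top (ENNReal.mul_ne_top ENNReal.ofReal_ne_top (causalExp_ne_top _ _)) (hA t)

lemma memLp_pop_toReal (h : Integrable (fun φ => mass φ ^ 2) Φ) (hr : 0 < rate Φ) (t : ℝ) :
    MemLp (fun ω => (pop ⊤ 1 t ω).toReal) 2 (law Φ) := by
  have hm : Measurable fun ω : Sample d => (pop ⊤ 1 t ω).toReal :=
    (measurable_pop ⊤ 1 measurable_const measurable_id).ennreal_toReal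
  rw [memLp_two_iff_integrable_sq hm.aestronglyMeasurable]
  have hm2 : Measurable fun ω : Sample d => pop ⊤ 1 t ω ^ 2 :=
    (measurable_pop ⊤ 1 measurable_const measurable_id).pow_const 2
  have := integrable_toReal_of_lintegral_ne_top hm2.aemeasurable (secondMoment_ne_top h hr t)
  simpa [ENNReal.toReal_pow] using this

lemma memLp_popAt_toReal (h : Integrable (fun φ => mass φ ^ 2) Φ) (hr : 0 < rate Φ) (z : Site d)
    (t : ℝ) : MemLp (fun ω => (popAt z t ω).toReal) 2 (law Φ) := by
  have hm : Measurable fun ω : Sample d => (popAt z t ω).toReal :=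
    (measurable_pop ⊤ _ measurable_const measurable_id).ennreal_toReal
  refine (memLp_pop_toReal h hr t).mono hm.aestronglyMeasurable ?_
  filter_upwards [ae_pop_one_ne_top (integrable_mass h) t] with ω hω
  rw [Real.norm_of_nonneg ENNReal.toReal_nonneg, Real.norm_of_nonneg ENNReal.toReal_nonneg]
  exact ENNReal.toReal_mono hω (popAt_le z t ω)

lemma memLp_dev (h : Integrable (fun φ => mass φ ^ 2) Φ) (hr : 0 < rate Φ) (z : Site d)
    (α t : ℝ) : MemLp (dev z α t) 2 (law Φ) :=
  (memLp_popAt_toReal h hr z t).sub ((memLp_pop_toReal h hr t).const_mul α)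

variable (Φ) in
/-- The mean of the deviation. -/
def devMean (z : Site d) (α t : ℝ) : ℝ := ∫ ω, dev z α t ω ∂law Φ

lemma integral_popAt (h : Integrable (mass (d := d)) Φ) (z : Site d) (t : ℝ) :
    ∫ ω, (popAt z t ω).toReal ∂law Φ = (meanPop Φ ⊤ (Set.indicator {z} 1) t).toReal := by
  have hm : Measurable fun ω : Sample d => popAt z t ω :=
    measurable_pop ⊤ _ measurable_const measurable_id
  exact integral_toReal hm.aemeasurable
    ((ae_pop_one_ne_top h t).mono fun ω hω => (popAt_le z t ω).trans_lt hω.lt_top)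

lemma devMean_eq (h : Integrable (fun φ => mass φ ^ 2) Φ) (hr : 0 < rate Φ) (z : Site d) (α : ℝ)
    {t : ℝ} (ht : 0 ≤ t) :
    devMean Φ z α t = Real.exp (rate Φ * t) * (heat Φ t z - α) := by
  have h1 : ∫ ω, (pop ⊤ 1 t ω).toReal ∂law Φ = Real.exp (rate Φ * t) := by
    have hm : Measurable fun ω : Sample d => pop ⊤ 1 t ω :=
      measurable_pop ⊤ _ measurable_const measurable_id
    rw [integral_toReal hm.aemeasurable
      ((ae_pop_one_ne_top (integrable_mass h) t).mono fun _ h => h.lt_top)]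
    have := meanPop_one (integrable_mass h) t
    rw [meanPop] at this
    rw [this, causalExp, causal_of_nonneg _ ht, ENNReal.toReal_ofReal (Real.exp_pos _).le]
  have h2 : ∫ ω, (popAt z t ω).toReal ∂law Φ = Real.exp (rate Φ * t) * heat Φ t z := by
    rw [integral_popAt (integrable_mass h), heat, ← mul_assoc, ← Real.exp_add, add_neg_cancel, Real.exp_zero, one_mul]
  have h3 : devMean Φ z α t = ∫ ω, (popAt z t ω).toReal ∂law Φ
      - α * ∫ ω, (pop ⊤ 1 t ω).toReal ∂law Φ := by
    rw [← integral_const_mul]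
    exact integral_sub ((memLp_popAt_toReal h hr z t).integrable one_le_two)
      (((memLp_pop_toReal h hr t).integrable one_le_two).const_mul α)
  rw [h3, h1, h2]
  ring

/-- Variances of independent terms add, and each is at most a second moment. The signed means
survive intact, and their cancellation is the source of the improved decay. -/
lemma lintegral_forest_sum_sq_le_real {g : Letter d → Sample d → ℝ} (hg : ∀ a, Measurable (g a))
    (hg2 : ∀ a, MemLp (g a) 2 (law Φ)) (s : Finset (Letter d)) :
    ∫⁻ η, ENNReal.ofReal ((∑ a ∈ s, g a (η a)) ^ 2) ∂forest Φ
      ≤ ∑ a ∈ s, ∫⁻ ω, ENNReal.ofReal (g a ω ^ 2) ∂law Φ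
        + ENNReal.ofReal ((∑ a ∈ s, ∫ ω, g a ω ∂law Φ) ^ 2) := by
  have hmp : ∀ a, MeasurePreserving (fun η : Letter d → Sample d => η a) (forest Φ) (law Φ) :=
    fun a => ⟨measurable_pi_apply a, map_forest_eval Φ a⟩
  have hL : ∀ a, MemLp (fun η : Letter d → Sample d => g a (η a)) 2 (forest Φ) :=
    fun a => (hg2 a).comp_measurePreserving (hmp a)
  have hS : MemLp (∑ a ∈ s, fun η : Letter d → Sample d => g a (η a)) 2 (forest Φ) :=
    memLp_finsetSum' s fun a _ => hL a
  have hmean : ∀ a, ∫ η, g a (η a) ∂forest Φ = ∫ ω, g a ω ∂law Φ := fun a => by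
    rw [← map_forest_eval Φ a,
      integral_map (measurable_pi_apply a).aemeasurable (hg a).aestronglyMeasurable]
  have hsq : ∀ a, ∫ η, g a (η a) ^ 2 ∂forest Φ = ∫ ω, g a ω ^ 2 ∂law Φ := fun a => by
    rw [← map_forest_eval Φ a,
      integral_map (measurable_pi_apply a).aemeasurable ((hg a).pow_const 2).aestronglyMeasurable]
  have hvar := IndepFun.variance_sum (X := fun a (η : Letter d → Sample d) => g a (η a))
    (μ := forest Φ) (s := s) (fun a _ => hL a)
    fun a _ b _ hab => (iIndepFun_forest Φ hg).indepFun hab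
  have h1 : ∫ η, (∑ a ∈ s, g a (η a)) ^ 2 ∂forest Φ
      ≤ ∑ a ∈ s, ∫ ω, g a ω ^ 2 ∂law Φ + (∑ a ∈ s, ∫ ω, g a ω ∂law Φ) ^ 2 := by
    have e1 := variance_eq_sub hS
    have e2 : ∫ η, (∑ a ∈ s, fun η : Letter d → Sample d => g a (η a)) η ∂forest Φ
        = ∑ a ∈ s, ∫ ω, g a ω ∂law Φ := by
      simp only [Finset.sum_apply]
      rw [integral_finsetSum s fun a _ => (hL a).integrable one_le_two]
      exact Finset.sum_congr rfl fun a _ => hmean a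
    have e3 : ∑ a ∈ s, variance (fun η : Letter d → Sample d => g a (η a)) (forest Φ)
        ≤ ∑ a ∈ s, ∫ ω, g a ω ^ 2 ∂law Φ := by
      refine Finset.sum_le_sum fun a _ => ?_
      rw [← hsq a]
      exact variance_le_expectation_sq (hL a).aestronglyMeasurable
    rw [e2, hvar] at e1
    have e4 : ∫ η, ((∑ a ∈ s, fun η : Letter d → Sample d => g a (η a)) ^ 2) η ∂forest Φ
        = ∫ η, (∑ a ∈ s, g a (η a)) ^ 2 ∂forest Φ := by
      refine integral_congr_ae (ae_of_all _ fun η => ?_)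
      simp [Finset.sum_apply]
    rw [e4] at e1
    linarith
  have hSi : Integrable (fun η : Letter d → Sample d => (∑ a ∈ s, g a (η a)) ^ 2) (forest Φ) := by
    have := hS.integrable_sq
    simpa [Finset.sum_apply] using this
  rw [← ofReal_integral_eq_lintegral_ofReal hSi (ae_of_all _ fun _ => sq_nonneg _)]
  refine (ENNReal.ofReal_le_ofReal h1).trans ?_
  rw [ENNReal.ofReal_add (Finset.sum_nonneg fun a _ => integral_nonneg fun _ => sq_nonneg _)
    (sq_nonneg _), ENNReal.ofReal_sum_of_nonneg fun a _ => integral_nonneg fun _ => sq_nonneg _]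
  gcongr with a _
  rw [ofReal_integral_eq_lintegral_ofReal (hg2 a).integrable_sq (ae_of_all _ fun _ => sq_nonneg _)]

lemma lintegral_rootDev_sq (z : Site d) (α t : ℝ) :
    ∫⁻ p, ENNReal.ofReal (rootDev z α t p ^ 2) ∂mark Φ = causalExp (-1) t *
      ENNReal.ofReal ((Set.indicator {z} (fun _ => (1 : ℝ)) 0 - α) ^ 2) := by
  rw [← lintegral_rootPop Φ (fun x => ENNReal.ofReal
    ((Set.indicator {z} (fun _ => (1 : ℝ)) x - α) ^ 2))]
  refine lintegral_congr fun p => ?_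
  by_cases h : t ∈ Set.Ico 0 p.1 <;> simp [rootPop, rootDev, h]

/-- The branching inequality for the second moment of the deviation. -/
lemma devSq_le (h : Integrable (fun φ => mass φ ^ 2) Φ) (hr : 0 < rate Φ) (z : Site d) (α t : ℝ) :
    devSq Φ z α t ≤ causalExp (-1) t *
        ENNReal.ofReal ((Set.indicator {z} (fun _ => (1 : ℝ)) 0 - α) ^ 2)
      + ∫⁻ p, (∑ a ∈ letters p.2, devSq Φ (z - letterSite a) α (t - p.1)
        + ENNReal.ofReal ((∑ a ∈ letters p.2, devMean Φ (z - letterSite a) α (t - p.1)) ^ 2))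
        ∂mark Φ := by
  have hrootm : Measurable fun p : ℝ × Config d => rootDev z α t p := by
    have : rootDev z α t = {p : ℝ × Config d | 0 ≤ t ∧ t < p.1}.indicator
        fun _ => Set.indicator {z} (fun _ => (1 : ℝ)) 0 - α := by
      ext p
      simp [rootDev, Set.indicator]
    rw [this]
    exact measurable_const.indicator
      ((MeasurableSet.const _).inter (measurableSet_lt measurable_const measurable_fst))
  have hm : Measurable fun q : (ℝ × Config d) × (Letter d → Sample d) =>
      ∑ a ∈ letters q.1.2, dev (z - letterSite a) α (t - q.1.1) (q.2 a) := by
    refine measurable_sum_letters measurable_fst.snd fun a => measurable_dev _ _ ?_ ?_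
    · exact measurable_const.sub measurable_fst.fst
    · exact (measurable_pi_apply a).comp measurable_snd
  have hG : Measurable fun q : (ℝ × Config d) × (Letter d → Sample d) =>
      ENNReal.ofReal ((rootDev z α t q.1
        + ∑ a ∈ letters q.1.2, dev (z - letterSite a) α (t - q.1.1) (q.2 a)) ^ 2) :=
    (((hrootm.comp measurable_fst).add hm).pow_const 2).ennreal_ofReal
  have hrec : (fun ω : Sample d => ENNReal.ofReal (dev z α t ω ^ 2)) =ᵐ[law Φ]
      fun ω => ENNReal.ofReal ((rootDev z α t (ω []) + ∑ a ∈ letters (ω []).2,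
        dev (z - letterSite a) α (t - (ω []).1) (subtree ω a)) ^ 2) := by
    filter_upwards [ae_pop_one_ne_top (integrable_mass h) t] with ω hω
    rw [dev_eq z α t hω]
  rw [devSq, lintegral_congr_ae hrec, lintegral_law Φ hG, ← lintegral_rootDev_sq (Φ := Φ),
    ← lintegral_add_left (hrootm.pow_const 2).ennreal_ofReal]
  refine lintegral_mono fun p => ?_
  have hdm : ∀ a : Letter d, Measurable (dev (z - letterSite a) α (t - p.1)) :=
    fun a => measurable_dev _ _ measurable_const measurable_id
  -- Before the first ring only the root counts, since subtrees at negative times vanish almost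
  -- surely; otherwise only the subtrees count. No cross term arises.
  by_cases ht : t ∈ Set.Ico 0 p.1
  · have h0 : ∀ᵐ η ∂forest Φ, ∀ a, dev (z - letterSite a) α (t - p.1) (η a) = 0 := by
      rw [ae_all_iff]
      intro a
      have := ae_dev_eq_zero (Φ := Φ) (sub_neg.2 ht.2) (z - letterSite a) α
      rw [← map_forest_eval Φ a] at this
      exact ae_of_ae_map (measurable_pi_apply a).aemeasurable this
    have h1 : ∫⁻ η, ENNReal.ofReal ((rootDev z α t p
        + ∑ a ∈ letters p.2, dev (z - letterSite a) α (t - p.1) (η a)) ^ 2) ∂forest Φ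
        = ∫⁻ _, ENNReal.ofReal (rootDev z α t p ^ 2) ∂forest Φ := by
      refine lintegral_congr_ae ?_
      filter_upwards [h0] with η hη
      simp [hη]
    beta_reduce
    rw [h1, lintegral_const, measure_univ, mul_one]
    exact le_self_add
  · have h1 : rootDev z α t p = 0 := by simp [rootDev, ht]
    simp only [h1, zero_add]
    refine le_add_left ?_
    exact lintegral_forest_sum_sq_le_real hdm (fun a => memLp_dev h hr _ _ _) _

end

section

/-! ### The total deviation -/

lemma siteNorm_zero : siteNorm (0 : Site d) = 0 := by
  have : (WithLp.toLp 2 fun i => (((0 : Site d) i : ℤ) : ℝ)) = 0 := by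
    ext i
    simp
  rw [siteNorm, this, norm_zero]

lemma siteNorm_add_le (x y : Site d) : siteNorm (x + y) ≤ siteNorm x + siteNorm y := by
  have : (WithLp.toLp 2 fun i => (((x + y) i : ℤ) : ℝ))
      = WithLp.toLp 2 (fun i => (x i : ℝ)) + WithLp.toLp 2 (fun i => (y i : ℝ)) := by
    ext i
    simp
  rw [siteNorm, this]
  exact norm_add_le _ _

/-- The triangle inequality in ℓ², obtained without square roots from Cauchy–Schwarz with weights `n
a`. -/
lemma tsum_ofReal_sum_sq_le {ι : Type*} (s : Finset ι) {G : ι → Site d → ℝ} {n : ι → ℝ} {K : ℝ}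
    (hn : ∀ a, 0 < n a) (hG : ∀ a, Summable fun z => G a z ^ 2)
    (hK : ∀ a, ∑' z, G a z ^ 2 ≤ K * n a ^ 2) :
    ∑' z, ENNReal.ofReal ((∑ a ∈ s, G a z) ^ 2) ≤ ENNReal.ofReal (K * (∑ a ∈ s, n a) ^ 2) := by
  have hN : 0 ≤ ∑ a ∈ s, n a := Finset.sum_nonneg fun a _ => (hn a).le
  have hpt : ∀ z, (∑ a ∈ s, G a z) ^ 2 ≤ (∑ a ∈ s, n a) * ∑ a ∈ s, G a z ^ 2 / n a := by
    intro z
    refine Finset.sum_sq_le_sum_mul_sum_of_sq_le_mul s (fun a _ => (hn a).le)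
      (fun a _ => div_nonneg (sq_nonneg _) (hn a).le) fun a _ => le_of_eq ?_
    rw [mul_div_cancel₀ _ (hn a).ne']
  have hs : ∀ a ∈ s, Summable fun z => G a z ^ 2 / n a := fun a _ => (hG a).div_const _
  have hsum : Summable fun z => (∑ a ∈ s, n a) * ∑ a ∈ s, G a z ^ 2 / n a :=
    (summable_sum hs).mul_left _
  refine (ENNReal.tsum_le_tsum fun z => ENNReal.ofReal_le_ofReal (hpt z)).trans ?_
  rw [← ENNReal.ofReal_tsum_of_nonneg (fun z => mul_nonneg hN
    (Finset.sum_nonneg fun a _ => div_nonneg (sq_nonneg _) (hn a).le)) hsum]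
  refine ENNReal.ofReal_le_ofReal ?_
  rw [tsum_mul_left, Summable.tsum_finsetSum hs]
  have h1 : ∑ a ∈ s, ∑' z, G a z ^ 2 / n a ≤ ∑ a ∈ s, K * n a := by
    refine Finset.sum_le_sum fun a _ => ?_
    rw [tsum_div_const, div_le_iff₀ (hn a)]
    exact (hK a).trans (le_of_eq (by ring))
  refine (mul_le_mul_of_nonneg_left h1 hN).trans (le_of_eq ?_)
  rw [← Finset.mul_sum]
  ring

/-- Separates the configuration from the starting site and the delay. Its first factor is integrable
precisely under the square moments of the mass and of the first displacement. -/
lemma sum_letters_siteNorm_le (φ : Config d) (x : Site d) {s : ℝ} (hs : 0 ≤ s) :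
    (∑ a ∈ letters φ, (1 + siteNorm (x + letterSite a) + s)) ^ 2
      ≤ (2 * (1 + mass φ) ^ 2 + 2 * displacement 1 φ ^ 2) * (1 + siteNorm x + s) ^ 2 := by
  have h1 : ∑ a ∈ letters φ, siteNorm (letterSite a) = displacement 1 φ := by
    rw [sum_letters φ siteNorm, siteNorm_zero, zero_add, displacement]
    refine Finsupp.sum_congr fun y _ => ?_
    rw [nsmul_eq_mul, pow_one, mul_comm]
  have hx := siteNorm_nonneg x
  have hD := displacement_nonneg 1 φ
  have hM := mass_nonneg φ
  have h2 : ∑ a ∈ letters φ, (1 + siteNorm (x + letterSite a) + s)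
      ≤ (1 + mass φ) * (1 + siteNorm x + s) + displacement 1 φ := by
    calc _ ≤ ∑ a ∈ letters φ, ((1 + siteNorm x + s) + siteNorm (letterSite a)) :=
          Finset.sum_le_sum fun a _ => by linarith [siteNorm_add_le x (letterSite a)]
      _ = _ := by rw [Finset.sum_add_distrib, h1, Finset.sum_const, nsmul_eq_mul, card_letters]
  have h3 : (1 + mass φ) * (1 + siteNorm x + s) + displacement 1 φ
      ≤ ((1 + mass φ) + displacement 1 φ) * (1 + siteNorm x + s) := by
    nlinarith [mul_nonneg hD (add_nonneg hx hs)]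
  have h0 : 0 ≤ ∑ a ∈ letters φ, (1 + siteNorm (x + letterSite a) + s) :=
    Finset.sum_nonneg fun a _ => by linarith [siteNorm_nonneg (x + letterSite a)]
  have h4 := pow_le_pow_left₀ h0 (h2.trans h3) 2
  refine h4.trans ?_
  rw [mul_pow]
  refine mul_le_mul_of_nonneg_right ?_ (sq_nonneg _)
  nlinarith [sq_nonneg ((1 + mass φ) - displacement 1 φ)]

lemma exists_one_add_pow_le (n : ℕ) {δ : ℝ} (hδ : 0 < δ) :
    ∃ C : ℝ, 0 < C ∧ ∀ s, 0 ≤ s → (1 + s) ^ n ≤ C * Real.exp (δ * s) := by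
  refine ⟨n.factorial * Real.exp δ / δ ^ n, by positivity, fun s hs => ?_⟩
  have h := Real.pow_div_factorial_le_exp (δ * (1 + s)) (by positivity) n
  rw [div_le_iff₀ (by positivity), mul_pow, mul_add, mul_one, Real.exp_add] at h
  rw [div_mul_eq_mul_div, le_div_iff₀ (by positivity)]
  linarith

/-- Polynomial corrections are absorbed by a small exponential. -/
lemma exists_growth_le {δ : ℝ} (hδ : 0 < δ) :
    ∃ C : ℝ, 0 < C ∧ ∀ r s, 0 ≤ r → 0 ≤ s → ∀ x, 0 ≤ x →
      (1 + r) ^ (-((d : ℝ) + 2) / 2) * (1 + x + s) ^ 2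
        ≤ C * (1 + (r + s)) ^ (-((d : ℝ) + 2) / 2) * Real.exp (δ * s) * (1 + x ^ 2) := by
  -- A power `d + 2` bounds `(1 + s) ^ p`, the cost of replacing `1 + r` by `1 + (r + s)`; two more
  -- powers come from the square.
  obtain ⟨C, hC, hCs⟩ := exists_one_add_pow_le (d + 4) hδ
  refine ⟨2 * C, by positivity, fun r s hr hs x hx => ?_⟩
  have hr1 : 0 < 1 + r := by linarith
  have hs1 : 0 < 1 + s := by linarith
  set p : ℝ := ((d : ℝ) + 2) / 2 with hp
  have hp0 : 0 ≤ p := by positivity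
  rw [show -((d : ℝ) + 2) / 2 = -p by rw [hp]; ring]
  have h1 : (1 + r) ^ (-p) ≤ (1 + s) ^ p * (1 + (r + s)) ^ (-p) := by
    have e1 : (1 + (r + s)) ^ p ≤ (1 + r) ^ p * (1 + s) ^ p := by
      rw [← Real.mul_rpow hr1.le hs1.le]
      exact Real.rpow_le_rpow (by positivity) (by nlinarith [mul_nonneg hr hs]) hp0
    rw [Real.rpow_neg hr1.le, Real.rpow_neg (by positivity), ← div_eq_mul_inv,
      le_div_iff₀ (by positivity), inv_mul_le_iff₀ (by positivity)]
    exact e1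
  have h2 : (1 + s) ^ p ≤ (1 + s) ^ (d + 2) := by
    rw [← Real.rpow_natCast]
    refine Real.rpow_le_rpow_of_exponent_le (by linarith) ?_
    push_cast
    rw [hp]
    have : (0 : ℝ) ≤ d := Nat.cast_nonneg d
    linarith
  have h3 : (1 + x + s) ^ 2 ≤ 2 * (1 + s) ^ 2 * (1 + x ^ 2) := by
    nlinarith [sq_nonneg (1 + s - x), mul_nonneg (mul_nonneg hs (by linarith : 0 ≤ 2 + s))
      (sq_nonneg x)]
  calc _ ≤ ((1 + s) ^ (d + 2) * (1 + (r + s)) ^ (-p)) * (2 * (1 + s) ^ 2 * (1 + x ^ 2)) := by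
        refine mul_le_mul (h1.trans ?_) h3 (sq_nonneg _) (by positivity)
        exact mul_le_mul_of_nonneg_right h2 (by positivity)
    _ = 2 * (1 + s) ^ (d + 4) * (1 + (r + s)) ^ (-p) * (1 + x ^ 2) := by ring
    _ ≤ 2 * (C * Real.exp (δ * s)) * (1 + (r + s)) ^ (-p) * (1 + x ^ 2) := by
        gcongr
        exact hCs s hs
    _ = _ := by ring

variable {Φ : Measure (Config d)} [IsProbabilityMeasure Φ]

/-- A quadratic Lyapunov function for the walk. -/
lemma exists_lyapunov (h : Integrable (mass (d := d)) Φ)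
    (h2 : Integrable (displacement (d := d) 2) Φ) {ε : ℝ} (hε : 0 < ε) :
    ∃ A : ℝ, 1 ≤ A ∧ ∀ x : Site d,
      ∑' y, step Φ y * ENNReal.ofReal (A + siteNorm (x + y) ^ 2)
        ≤ ENNReal.ofReal (1 + rate Φ + ε) * ENNReal.ofReal (A + siteNorm x ^ 2) := by
  have hl := rate_nonneg Φ
  have hl1 : 0 < 1 + rate Φ := by linarith
  set S := ∫ φ, displacement 2 φ ∂Φ with hS
  have hS0 : 0 ≤ S := integral_nonneg (displacement_nonneg 2)
  -- Weight in Young's inequality for the cross term `2 |x| |y|`: with it the excess in `|x|²` is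
  -- exactly `ε |x|²`. The constant `A` is then so large that `ε A` covers the remaining multiple of
  -- `S`.
  set η : ℝ := ε / (1 + rate Φ) with hη
  have hη0 : 0 < η := div_pos hε hl1
  have hηm : (1 + rate Φ) * η = ε := mul_div_cancel₀ _ hl1.ne'
  refine ⟨1 + (1 + η⁻¹) * S / ε, le_add_of_nonneg_right (by positivity), fun x => ?_⟩
  set A : ℝ := 1 + (1 + η⁻¹) * S / ε with hA
  have hA0 : 0 < A := by positivity
  have hAε : ε * A = ε + (1 + η⁻¹) * S := by
    rw [hA]
    field_simp
  have hstep : ∑' y, step Φ y * ENNReal.ofReal (siteNorm y ^ 2) = ENNReal.ofReal S := by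
    rw [hS, ← tsum_intensity_mul h2]
    refine tsum_congr fun y => ?_
    by_cases hy : y = 0
    · simp [hy, siteNorm_zero]
    · simp [step, hy]
  have hpt : ∀ y, ENNReal.ofReal (A + siteNorm (x + y) ^ 2)
      ≤ ENNReal.ofReal (A + (1 + η) * siteNorm x ^ 2)
        + ENNReal.ofReal (1 + η⁻¹) * ENNReal.ofReal (siteNorm y ^ 2) := by
    intro y
    rw [← ENNReal.ofReal_mul (by positivity), ← ENNReal.ofReal_add (by positivity) (by positivity)]
    refine ENNReal.ofReal_le_ofReal ?_
    have e1 := pow_le_pow_left₀ (siteNorm_nonneg _) (siteNorm_add_le x y) 2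
    have e2 : 2 * (siteNorm x * siteNorm y) ≤ η * siteNorm x ^ 2 + η⁻¹ * siteNorm y ^ 2 := by
      have e3 : 0 ≤ η * (siteNorm x - η⁻¹ * siteNorm y) ^ 2 := by positivity
      have e4 : η * (siteNorm x - η⁻¹ * siteNorm y) ^ 2
          = η * siteNorm x ^ 2 - 2 * (siteNorm x * siteNorm y) + η⁻¹ * siteNorm y ^ 2 := by
        field_simp
        ring
      linarith
    nlinarith
  calc _ ≤ ∑' y, step Φ y * (ENNReal.ofReal (A + (1 + η) * siteNorm x ^ 2)
        + ENNReal.ofReal (1 + η⁻¹) * ENNReal.ofReal (siteNorm y ^ 2)) :=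
        ENNReal.tsum_le_tsum fun y => mul_le_mul_right (hpt y) _
    _ = ENNReal.ofReal (1 + rate Φ) * ENNReal.ofReal (A + (1 + η) * siteNorm x ^ 2)
        + ENNReal.ofReal (1 + η⁻¹) * ENNReal.ofReal S := by
        rw [← hstep, ← tsum_step h, ← ENNReal.tsum_mul_right, ← ENNReal.tsum_mul_left,
          ← ENNReal.tsum_add]
        exact tsum_congr fun y => by ring
    _ ≤ _ := by
        rw [← ENNReal.ofReal_mul hl1.le, ← ENNReal.ofReal_mul (by positivity),
          ← ENNReal.ofReal_add (by positivity) (by positivity), ← ENNReal.ofReal_mul (by positivity)]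
        refine ENNReal.ofReal_le_ofReal ?_
        have e1 : (1 + rate Φ) * (A + (1 + η) * siteNorm x ^ 2)
            = (1 + rate Φ) * A + (1 + rate Φ) * siteNorm x ^ 2
              + ((1 + rate Φ) * η) * siteNorm x ^ 2 := by ring
        rw [e1, hηm]
        linarith

variable (Φ) in
/-- The total deviation at time `t` for a walk started at `x`, with respect to the profile of
the mean at time `T`. -/
def totalDev (T t : ℝ) (x : Site d) : ℝ≥0∞ := ∑' z, devSq Φ (z - x) (heat Φ T z) t

variable (Φ) in
lemma measurable_totalDev (T : ℝ) (x : Site d) : Measurable fun t => totalDev Φ T t x :=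
  Measurable.tsum fun _ => measurable_devSq Φ _ _

variable (Φ) in
lemma measurable_devMean (z : Site d) (α : ℝ) : Measurable (devMean Φ z α) := by
  have h : Measurable fun p : ℝ × Sample d => dev z α p.1 p.2 :=
    measurable_dev z α measurable_fst measurable_snd
  exact (h.stronglyMeasurable.integral_prod_right' (ν := law Φ)).measurable

lemma devMean_of_neg (z : Site d) (α : ℝ) {t : ℝ} (ht : t < 0) : devMean Φ z α t = 0 :=
  integral_eq_zero_of_ae (ae_dev_eq_zero ht z α)

lemma heat_le_one (h : Integrable (mass (d := d)) Φ) {T : ℝ} (hT : 0 ≤ T) (z : Site d) :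
    heat Φ T z ≤ 1 :=
  le_hasSum (hasSum_heat h hT) z fun y _ => heat_nonneg Φ T y

lemma ae_expMeasure_nonneg : ∀ᵐ s ∂expMeasure 1, 0 ≤ s := by
  have h : expMeasure 1 (Set.Iio 0) = 0 := by
    rw [← lintegral_indicator_one measurableSet_Iio,
      lintegral_expMeasure (measurable_one.indicator measurableSet_Iio)]
    refine setLIntegral_eq_zero measurableSet_Ici fun s hs => ?_
    simp [Set.mem_Ici.1 hs]
  rw [ae_iff]
  simp only [not_le]
  exact h

lemma ae_mark_nonneg (Φ : Measure (Config d)) : ∀ᵐ p ∂mark Φ, 0 ≤ p.1 :=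
  Measure.quasiMeasurePreserving_fst.ae ae_expMeasure_nonneg

/-- The forcing term, from the differences of the mean profiles. -/
lemma exists_forcing_le (hirr : Irreducible Φ) (h : Integrable (fun φ => mass φ ^ 2) Φ)
    (hr : 0 < rate Φ) (h1 : Integrable (fun φ => displacement (d := d) 1 φ ^ 2) Φ) {δ : ℝ}
    (hδ : 0 < δ) :
    ∃ C : ℝ, 0 < C ∧ ∀ T r, 0 ≤ r → r ≤ T → ∀ (x : Site d) (φ : Config d),
      ∑' z, ENNReal.ofReal ((∑ a ∈ letters φ,
          devMean Φ (z - x - letterSite a) (heat Φ T z) r) ^ 2)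
        ≤ ENNReal.ofReal (C * (1 + T) ^ (-((d : ℝ) + 2) / 2) * Real.exp (δ * T)
            * (1 + siteNorm x ^ 2))
          * ENNReal.ofReal (Real.exp ((2 * rate Φ - δ) * r))
          * ENNReal.ofReal (2 * (1 + mass φ) ^ 2 + 2 * displacement 1 φ ^ 2) := by
  have hm1 : AEStronglyMeasurable (displacement (d := d) 1) Φ :=
    (Measurable.of_discrete (f := displacement (d := d) 1)).aestronglyMeasurable
  have hi1 : Integrable (displacement (d := d) 1) Φ :=
    ((memLp_two_iff_integrable_sq hm1).2 h1).integrable one_le_two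
  obtain ⟨C, hC, hdiff⟩ := exists_tsum_heat_sub_sq_le hirr (integrable_mass h) hi1
  obtain ⟨C', hC', hgrow⟩ := exists_growth_le (d := d) hδ
  refine ⟨C * C', by positivity, fun T r hr0 hrT x φ => ?_⟩
  set s : ℝ := T - r with hs
  have hs0 : 0 ≤ s := sub_nonneg.2 hrT
  have hT : T = r + s := by rw [hs]; ring
  -- The profile stays frozen at `T = r + s` while the subtree has remaining time `r`, so its mean
  -- deviation is a difference of heat kernels in space and time.
  have hG : ∀ a z, devMean Φ (z - x - letterSite a) (heat Φ T z) r
      = Real.exp (rate Φ * r) * (heat Φ r (z - (x + letterSite a)) - heat Φ (r + s) z) := by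
    intro a z
    rw [devMean_eq h hr _ _ hr0, ← hT, sub_sub]
  have hr1 : 0 < 1 + r := by linarith
  have hexp : Real.exp (rate Φ * r) ^ 2 = Real.exp (2 * rate Φ * r) := by
    rw [← Real.exp_nat_mul]
    congr 1
    push_cast
    ring
  have hle := tsum_ofReal_sum_sq_le (letters φ)
    (G := fun a z => devMean Φ (z - x - letterSite a) (heat Φ T z) r)
    (n := fun a => 1 + siteNorm (x + letterSite a) + s)
    (K := Real.exp (2 * rate Φ * r) * (C * (1 + r) ^ (-((d : ℝ) + 2) / 2)))
    (fun a => by linarith [siteNorm_nonneg (x + letterSite a)])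
    (fun a => by
      simp_rw [hG, mul_pow]
      exact (hdiff r s hr0 hs0 _).1.mul_left _)
    (fun a => by
      simp_rw [hG, mul_pow, hexp]
      rw [tsum_mul_left, mul_assoc (Real.exp _)]
      refine mul_le_mul_of_nonneg_left
        ((hdiff r s hr0 hs0 (x + letterSite a)).2.trans ?_) (Real.exp_pos _).le
      have hn := siteNorm_nonneg (x + letterSite a)
      have : (siteNorm (x + letterSite a) + s) ^ 2 ≤ (1 + siteNorm (x + letterSite a) + s) ^ 2 :=
        pow_le_pow_left₀ (by linarith) (by linarith) 2
      calc _ = C * (1 + r) ^ (-((d : ℝ) + 2) / 2) * (siteNorm (x + letterSite a) + s) ^ 2 := by ring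
        _ ≤ _ := mul_le_mul_of_nonneg_left this (by positivity))
  refine hle.trans ?_
  have hM : 0 ≤ 2 * (1 + mass φ) ^ 2 + 2 * displacement 1 φ ^ 2 := by positivity
  have hx := siteNorm_nonneg x
  rw [← ENNReal.ofReal_mul (by have : 0 ≤ T := hr0.trans hrT; positivity),
    ← ENNReal.ofReal_mul (by have : 0 ≤ T := hr0.trans hrT; positivity)]
  refine ENNReal.ofReal_le_ofReal ?_
  have hg := hgrow r s hr0 hs0 (siteNorm x) hx
  rw [← hT] at hg
  calc _ ≤ Real.exp (2 * rate Φ * r) * (C * (1 + r) ^ (-((d : ℝ) + 2) / 2))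
        * ((2 * (1 + mass φ) ^ 2 + 2 * displacement 1 φ ^ 2) * (1 + siteNorm x + s) ^ 2) :=
        mul_le_mul_of_nonneg_left (sum_letters_siteNorm_le φ x hs0) (by positivity)
    _ = Real.exp (2 * rate Φ * r) * C * (2 * (1 + mass φ) ^ 2 + 2 * displacement 1 φ ^ 2)
        * ((1 + r) ^ (-((d : ℝ) + 2) / 2) * (1 + siteNorm x + s) ^ 2) := by ring
    _ ≤ Real.exp (2 * rate Φ * r) * C * (2 * (1 + mass φ) ^ 2 + 2 * displacement 1 φ ^ 2)
        * (C' * (1 + T) ^ (-((d : ℝ) + 2) / 2) * Real.exp (δ * s) * (1 + siteNorm x ^ 2)) :=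
        mul_le_mul_of_nonneg_left hg (by positivity)
    _ = _ := by
        -- Lowering the growth rate by `δ` turns the dependence on `s` into a constant in `T` and
        -- leaves a pure exponential in `r`; at `r = T` nothing is lost.
        have e : Real.exp (2 * rate Φ * r) * Real.exp (δ * s)
            = Real.exp (δ * T) * Real.exp ((2 * rate Φ - δ) * r) := by
          rw [← Real.exp_add, ← Real.exp_add, hs]
          congr 1
          ring
        linear_combination (C * (2 * (1 + mass φ) ^ 2 + 2 * displacement 1 φ ^ 2)
          * (C' * (1 + T) ^ (-((d : ℝ) + 2) / 2) * (1 + siteNorm x ^ 2))) * e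

/-- The branching inequality for the total deviation. -/
lemma exists_totalDev_le (hirr : Irreducible Φ) (h : Integrable (fun φ => mass φ ^ 2) Φ)
    (hr : 0 < rate Φ) (h1 : Integrable (fun φ => displacement (d := d) 1 φ ^ 2) Φ) {δ : ℝ}
    (hδ : 0 < δ) :
    ∃ C : ℝ, 0 < C ∧ ∀ T t, 0 ≤ T → t ≤ T → ∀ x : Site d,
      totalDev Φ T t x ≤ 2 * causalExp (-1) t
        + ∫⁻ s, (∑' y, step Φ y * totalDev Φ T (t - s) (x + y)
          + ENNReal.ofReal (C * (1 + T) ^ (-((d : ℝ) + 2) / 2) * Real.exp (δ * T)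
              * (1 + siteNorm x ^ 2)) * causalExp (2 * rate Φ - δ) (t - s)) ∂expMeasure 1 := by
  obtain ⟨C, hC, hforce⟩ := exists_forcing_le hirr h hr h1 hδ
  have hMi : Integrable (fun φ : Config d => 2 * (1 + mass φ) ^ 2 + 2 * displacement 1 φ ^ 2) Φ := by
    have h2 : Integrable (fun φ : Config d => (1 + mass φ) ^ 2) Φ := by
      refine (((integrable_const (1 : ℝ)).add ((integrable_mass h).const_mul 2)).add h).congr
        (ae_of_all _ fun φ => ?_)
      simp only [Pi.add_apply]
      ring
    exact (h2.const_mul 2).add (h1.const_mul 2)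
  have hM0 : ∀ φ : Config d, 0 ≤ 2 * (1 + mass φ) ^ 2 + 2 * displacement 1 φ ^ 2 :=
    fun φ => by positivity
  set K : ℝ := ∫ φ, (2 * (1 + mass φ) ^ 2 + 2 * displacement 1 φ ^ 2) ∂Φ with hK
  have hK0 : 0 ≤ K := integral_nonneg hM0
  refine ⟨C * (K + 1), by positivity, fun T t hT htT x => ?_⟩
  set β := heat Φ T with hβ
  have hβs := hasSum_heat (integrable_mass h) hT
  -- the initial ball
  have hroot : ∑' z, ENNReal.ofReal ((Set.indicator {z - x} (fun _ => (1 : ℝ)) 0 - β z) ^ 2)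
      ≤ 2 := by
    have hpt : ∀ z, ENNReal.ofReal ((Set.indicator {z - x} (fun _ => (1 : ℝ)) 0 - β z) ^ 2)
        ≤ (if z = x then 1 else 0) + ENNReal.ofReal (β z) := by
      intro z
      have hb0 : 0 ≤ β z := heat_nonneg Φ T z
      have hb1 : β z ≤ 1 := heat_le_one (integrable_mass h) hT z
      by_cases hz : z = x
      · simp only [hz, sub_self, Set.mem_singleton_iff, Set.indicator_of_mem, if_true]
        rw [← ENNReal.ofReal_one, ← ENNReal.ofReal_add zero_le_one (hz ▸ hb0)]
        subst hz
        exact ENNReal.ofReal_le_ofReal (by nlinarith)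
      · rw [Set.indicator_of_notMem (by simpa [eq_comm, sub_eq_zero] using hz), if_neg hz, zero_add]
        exact ENNReal.ofReal_le_ofReal (by nlinarith)
    refine (ENNReal.tsum_le_tsum hpt).trans (le_of_eq ?_)
    rw [ENNReal.tsum_add, tsum_ite_eq, ← ENNReal.ofReal_tsum_of_nonneg (heat_nonneg Φ T)
      hβs.summable, hβs.tsum_eq, ENNReal.ofReal_one]
    norm_num
  have hm1 : ∀ z, Measurable fun p : ℝ × Config d =>
      ∑ a ∈ letters p.2, devSq Φ (z - x - letterSite a) (β z) (t - p.1) := fun z =>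
    measurable_sum_letters measurable_snd fun a =>
      (measurable_devSq Φ _ _).comp (measurable_const.sub measurable_fst)
  have hm2 : ∀ z, Measurable fun p : ℝ × Config d => ENNReal.ofReal
      ((∑ a ∈ letters p.2, devMean Φ (z - x - letterSite a) (β z) (t - p.1)) ^ 2) := fun z =>
    ((measurable_sum_letters measurable_snd fun a =>
      (measurable_devMean Φ _ _).comp (measurable_const.sub measurable_fst)).pow_const
        2).ennreal_ofReal
  have hm12 : ∀ z, Measurable fun p : ℝ × Config d =>
      ∑ a ∈ letters p.2, devSq Φ (z - x - letterSite a) (β z) (t - p.1) + ENNReal.ofReal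
        ((∑ a ∈ letters p.2, devMean Φ (z - x - letterSite a) (β z) (t - p.1)) ^ 2) :=
    fun z => (hm1 z).add (hm2 z)
  set B : ℝ≥0∞ := ENNReal.ofReal (C * (1 + T) ^ (-((d : ℝ) + 2) / 2) * Real.exp (δ * T)
              * (1 + siteNorm x ^ 2)) with hB
  have hsum : ∀ p : ℝ × Config d,
      ∑' z, ∑ a ∈ letters p.2, devSq Φ (z - x - letterSite a) (β z) (t - p.1)
        = ∑ a ∈ letters p.2, totalDev Φ T (t - p.1) (x + letterSite a) := by
    intro p
    rw [Summable.tsum_finsetSum fun _ _ => ENNReal.summable]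
    refine Finset.sum_congr rfl fun a _ => tsum_congr fun z => ?_
    rw [sub_sub]
  have hmc : Measurable fun s => causalExp (2 * rate Φ - δ) (t - s) :=
    (measurable_causalExp _).comp (measurable_const.sub measurable_id)
  have hmt : ∀ y, Measurable fun s => totalDev Φ T (t - s) y := fun y =>
    (measurable_totalDev Φ T y).comp (measurable_const.sub measurable_id)
  calc totalDev Φ T t x
      ≤ ∑' z, (causalExp (-1) t
          * ENNReal.ofReal ((Set.indicator {z - x} (fun _ => (1 : ℝ)) 0 - β z) ^ 2)
        + ∫⁻ p, (∑ a ∈ letters p.2, devSq Φ (z - x - letterSite a) (β z) (t - p.1)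
          + ENNReal.ofReal
            ((∑ a ∈ letters p.2, devMean Φ (z - x - letterSite a) (β z) (t - p.1)) ^ 2)) ∂mark Φ) :=
        ENNReal.tsum_le_tsum fun z => devSq_le h hr (z - x) (β z) t
    _ = causalExp (-1) t * ∑' z,
          ENNReal.ofReal ((Set.indicator {z - x} (fun _ => (1 : ℝ)) 0 - β z) ^ 2)
        + ∫⁻ p, (∑ a ∈ letters p.2, totalDev Φ T (t - p.1) (x + letterSite a)
          + ∑' z, ENNReal.ofReal
            ((∑ a ∈ letters p.2, devMean Φ (z - x - letterSite a) (β z) (t - p.1)) ^ 2))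
          ∂mark Φ := by
        rw [ENNReal.tsum_add, ENNReal.tsum_mul_left,
          ← lintegral_tsum fun z => (hm12 z).aemeasurable]
        congr 1
        refine lintegral_congr fun p => ?_
        rw [← hsum p, ← ENNReal.tsum_add]
    _ ≤ causalExp (-1) t * 2
        + ∫⁻ p, (∑ a ∈ letters p.2, totalDev Φ T (t - p.1) (x + letterSite a)
          + B * causalExp (2 * rate Φ - δ) (t - p.1)
            * ENNReal.ofReal (2 * (1 + mass p.2) ^ 2 + 2 * displacement 1 p.2 ^ 2)) ∂mark Φ := by
        refine add_le_add (mul_le_mul_right hroot _) (lintegral_mono_ae ?_)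
        filter_upwards [ae_mark_nonneg Φ] with p hp
        refine add_le_add le_rfl ?_
        rcases lt_or_ge (t - p.1) 0 with hneg | hpos
        · simp [devMean_of_neg _ _ hneg]
        · refine (hforce T (t - p.1) hpos (by linarith) x p.2).trans (le_of_eq ?_)
          rw [causalExp, causal_of_nonneg _ hpos]
    _ = 2 * causalExp (-1) t
        + ∫⁻ s, (∑' y, step Φ y * totalDev Φ T (t - s) (x + y)
          + B * causalExp (2 * rate Φ - δ) (t - s) * ENNReal.ofReal K) ∂expMeasure 1 := by
        rw [mul_comm, lintegral_mark Φ (g := fun s φ =>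
          ∑ a ∈ letters φ, totalDev Φ T (t - s) (x + letterSite a)
          + B * causalExp (2 * rate Φ - δ) (t - s)
            * ENNReal.ofReal (2 * (1 + mass φ) ^ 2 + 2 * displacement 1 φ ^ 2))
          fun φ => (Finset.measurable_fun_sum (letters φ) fun a _ => hmt _).add
            ((hmc.const_mul B).mul_const _)]
        congr 1
        refine lintegral_congr fun s => ?_
        rw [lintegral_add_left Measurable.of_discrete,
          lintegral_letters Φ fun y => totalDev Φ T (t - s) (x + y),
          lintegral_const_mul _ Measurable.of_discrete,
          ← ofReal_integral_eq_lintegral_ofReal hMi (ae_of_all _ hM0)]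
    _ ≤ _ := by
        refine add_le_add le_rfl (lintegral_mono fun s => add_le_add le_rfl ?_)
        rw [mul_right_comm]
        refine mul_le_mul_left ?_ _
        rw [hB, ← ENNReal.ofReal_mul (by positivity)]
        refine ENNReal.ofReal_le_ofReal ?_
        have e : 0 ≤ C * (1 + T) ^ (-((d : ℝ) + 2) / 2) * Real.exp (δ * T)
          * (1 + siteNorm x ^ 2) := by positivity
        nlinarith

end

section

/-! ### Comparison -/

lemma mul_lintegral_causalExp_le {γ : ℝ} (hγ : -1 < γ) (t : ℝ) :
    ENNReal.ofReal (1 + γ) * ∫⁻ s, causalExp γ (t - s) ∂expMeasure 1 ≤ causalExp γ t := by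
  rw [← lintegral_causalExp hγ t]
  exact le_add_self

variable {Φ : Measure (Config d)} [IsProbabilityMeasure Φ]

/-- One application of the branching inequality to a supersolution. -/
lemma supersolution_step (h : Integrable (mass (d := d)) Φ) {f : ℝ → Site d → ℝ≥0∞}
    {H : Site d → ℝ≥0∞} {γ T : ℝ} {M D b θ R : ℝ≥0∞} (hγ : -1 < γ)
    (hH : ∀ x, ∑' y, step Φ y * H (x + y) ≤ b * H x)
    (hM : M * b + D ≤ M * ENNReal.ofReal (1 + γ))
    (hθ : ENNReal.ofReal (1 + rate Φ) = θ * ENNReal.ofReal (1 + 2 * rate Φ))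
    (hf : ∀ t, t ≤ T → ∀ x, f t x ≤ 2 * causalExp (-1) t
      + ∫⁻ s, (∑' y, step Φ y * f (t - s) (x + y) + D * H x * causalExp γ (t - s)) ∂expMeasure 1)
    (hR : ∀ t, t ≤ T → ∀ x, f t x ≤ 2 * causalExp (rate Φ) t + M * H x * causalExp γ t
      + R * causalExp (2 * rate Φ) t) {t : ℝ} (ht : t ≤ T) (x : Site d) :
    f t x ≤ 2 * causalExp (rate Φ) t + M * H x * causalExp γ t
      + R * θ * causalExp (2 * rate Φ) t := by
  have hr := rate_nonneg Φ
  have hm : ∀ γ', Measurable fun s => causalExp γ' (t - s) := fun γ' =>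
    (measurable_causalExp γ').comp (measurable_const.sub measurable_id)
  set L := ENNReal.ofReal (1 + rate Φ) with hL
  have hpt : ∀ s, 0 ≤ s →
      ∑' y, step Φ y * f (t - s) (x + y) + D * H x * causalExp γ (t - s)
        ≤ 2 * L * causalExp (rate Φ) (t - s)
          + (M * H x * ENNReal.ofReal (1 + γ)) * causalExp γ (t - s)
          + R * L * causalExp (2 * rate Φ) (t - s) := by
    intro s hs
    have e1 : ∑' y, step Φ y * f (t - s) (x + y)
        ≤ ∑' y, (step Φ y * (2 * causalExp (rate Φ) (t - s) + R * causalExp (2 * rate Φ) (t - s))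
          + step Φ y * H (x + y) * (M * causalExp γ (t - s))) := by
      refine ENNReal.tsum_le_tsum fun y => ?_
      refine (mul_le_mul_right (hR (t - s) (by linarith) (x + y)) _).trans (le_of_eq ?_)
      ring
    rw [ENNReal.tsum_add, ENNReal.tsum_mul_right, ENNReal.tsum_mul_right, tsum_step h, ← hL] at e1
    calc _ ≤ L * (2 * causalExp (rate Φ) (t - s) + R * causalExp (2 * rate Φ) (t - s))
          + b * H x * (M * causalExp γ (t - s)) + D * H x * causalExp γ (t - s) :=
          add_le_add (e1.trans (add_le_add le_rfl (mul_le_mul_left (hH x) _))) le_rfl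
      _ = 2 * L * causalExp (rate Φ) (t - s) + (M * b + D) * (H x * causalExp γ (t - s))
          + R * L * causalExp (2 * rate Φ) (t - s) := by ring
      _ ≤ 2 * L * causalExp (rate Φ) (t - s)
          + M * ENNReal.ofReal (1 + γ) * (H x * causalExp γ (t - s))
          + R * L * causalExp (2 * rate Φ) (t - s) :=
          add_le_add (add_le_add le_rfl (mul_le_mul_left hM _)) le_rfl
      _ = _ := by ring
  calc f t x ≤ _ := hf t ht x
    _ ≤ 2 * causalExp (-1) t + ∫⁻ s, (2 * L * causalExp (rate Φ) (t - s)
          + (M * H x * ENNReal.ofReal (1 + γ)) * causalExp γ (t - s)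
          + R * L * causalExp (2 * rate Φ) (t - s)) ∂expMeasure 1 := by
        refine add_le_add le_rfl (lintegral_mono_ae ?_)
        filter_upwards [ae_expMeasure_nonneg] with s hs using hpt s hs
    _ = 2 * (causalExp (-1) t + L * ∫⁻ s, causalExp (rate Φ) (t - s) ∂expMeasure 1)
        + M * H x * (ENNReal.ofReal (1 + γ) * ∫⁻ s, causalExp γ (t - s) ∂expMeasure 1)
        + R * θ * (ENNReal.ofReal (1 + 2 * rate Φ)
          * ∫⁻ s, causalExp (2 * rate Φ) (t - s) ∂expMeasure 1) := by
        rw [lintegral_add_right _ ((hm (2 * rate Φ)).const_mul (R * L)),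
          lintegral_add_right _ ((hm γ).const_mul (M * H x * ENNReal.ofReal (1 + γ))), lintegral_const_mul _ (hm _),
          lintegral_const_mul _ (hm _), lintegral_const_mul _ (hm _), hθ]
        ring
    -- The first exponential reproduces itself through the source term. The other two have no source
    -- and only decrease, the last one by the factor `θ`.
    _ ≤ _ := by
        rw [lintegral_causalExp (by linarith)]
        exact add_le_add (add_le_add le_rfl
          (mul_le_mul_right (mul_lintegral_causalExp_le hγ t) _))
          (mul_le_mul_right (mul_lintegral_causalExp_le (by linarith) t) _)

/-- The mean square deviations from the profile of the mean are of lower order than the second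
moment. -/
lemma exists_tsum_devSq_heat_le (hirr : Irreducible Φ) (h : Integrable (fun φ => mass φ ^ 2) Φ)
    (hr : 0 < rate Φ) (h1 : Integrable (fun φ => displacement (d := d) 1 φ ^ 2) Φ)
    (h2 : Integrable (displacement (d := d) 2) Φ) :
    ∃ C : ℝ, 0 < C ∧ ∀ T, 0 ≤ T → ∑' z, devSq Φ z (heat Φ T z) T
      ≤ ENNReal.ofReal (C * (1 + T) ^ (-((d : ℝ) + 2) / 2) * Real.exp (2 * rate Φ * T)) := by
  have hmass := integrable_mass h
  set l := rate Φ with hl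
  -- With `δ = l / 2` the forcing has rate `γ = 3l/2`, while `H` grows along the walk at rate at
  -- most `l + l/4`. The gap `l / 4` determines the supersolution coefficient `4 * D / l`.
  obtain ⟨A, hA, hlyap⟩ := exists_lyapunov hmass h2 (ε := l / 4) (by positivity)
  obtain ⟨C, hC, hrec⟩ := exists_totalDev_le hirr h hr h1 (δ := l / 2) (by positivity)
  obtain ⟨A₂, hA₂, hsecond⟩ := secondMoment_le h hr
  obtain ⟨K, hK, hpow⟩ := exists_one_add_pow_le (d + 2) hr
  refine ⟨2 * K + 4 * C / l * A, by positivity, fun T hT => ?_⟩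
  have hT1 : 0 < 1 + T := by linarith
  set p : ℝ := ((d : ℝ) + 2) / 2 with hp
  have hpn : -((d : ℝ) + 2) / 2 = -p := by rw [hp]; ring
  simp_rw [hpn] at hrec
  rw [hpn]
  set D : ℝ := C * (1 + T) ^ (-p) * Real.exp (l / 2 * T) with hD
  have hD0 : 0 < D := by positivity
  set γ : ℝ := 2 * l - l / 2 with hγ
  set H : Site d → ℝ≥0∞ := fun x => ENNReal.ofReal (A + siteNorm x ^ 2) with hH
  set θ : ℝ≥0∞ := ENNReal.ofReal ((1 + l) / (1 + 2 * l)) with hθ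
  have hθ1 : θ < 1 := by
    rw [hθ, ← ENNReal.ofReal_one, ENNReal.ofReal_lt_ofReal_iff one_pos,
      div_lt_one (by positivity)]
    linarith
  have hθmul : ENNReal.ofReal (1 + l) = θ * ENNReal.ofReal (1 + 2 * l) := by
    rw [hθ, ← ENNReal.ofReal_mul (by positivity), div_mul_cancel₀ _ (by positivity)]
  have hγ1 : (-1 : ℝ) < γ := by rw [hγ]; linarith
  have hM : ENNReal.ofReal (4 * D / l) * ENNReal.ofReal (1 + l + l / 4) + ENNReal.ofReal D
      ≤ ENNReal.ofReal (4 * D / l) * ENNReal.ofReal (1 + γ) := by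
    rw [← ENNReal.ofReal_mul (by positivity), ← ENNReal.ofReal_mul (by positivity),
      ← ENNReal.ofReal_add (by positivity) hD0.le]
    refine ENNReal.ofReal_le_ofReal (le_of_eq ?_)
    rw [hγ]
    field_simp
    ring
  have hf : ∀ t, t ≤ T → ∀ x, totalDev Φ T t x ≤ 2 * causalExp (-1) t
      + ∫⁻ s, (∑' y, step Φ y * totalDev Φ T (t - s) (x + y)
        + ENNReal.ofReal D * H x * causalExp γ (t - s)) ∂expMeasure 1 := by
    intro t ht x
    refine (hrec T t hT ht x).trans (add_le_add le_rfl (lintegral_mono fun s =>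
      add_le_add le_rfl (mul_le_mul_left ?_ _)))
    rw [hH, ← ENNReal.ofReal_mul hD0.le]
    exact ENNReal.ofReal_le_ofReal (mul_le_mul_of_nonneg_left (by linarith) hD0.le)
  have hiter : ∀ n : ℕ, ∀ t, t ≤ T → ∀ x, totalDev Φ T t x
      ≤ 2 * causalExp l t + ENNReal.ofReal (4 * D / l) * H x * causalExp γ t
        + 2 * ENNReal.ofReal A₂ * θ ^ n * causalExp (2 * l) t := by
    intro n
    induction n with
    -- The whole a priori bound is taken as remainder here; each later step multiplies it by `θ <
    -- 1`.
    | zero =>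
      intro t _ x
      refine le_add_left ?_
      refine (tsum_devSq_le (heat_nonneg Φ T) (heat_le_one hmass hT) (hasSum_heat hmass hT)
        x t).trans ?_
      rw [pow_zero, mul_one, mul_assoc]
      exact mul_le_mul_right (hsecond t) _
    | succ n ih =>
      intro t ht x
      rw [pow_succ, ← mul_assoc (2 * ENNReal.ofReal A₂)]
      exact supersolution_step hmass hγ1 hlyap hM hθmul hf ih ht x
  have hlim : totalDev Φ T T 0
      ≤ 2 * causalExp l T + ENNReal.ofReal (4 * D / l) * H 0 * causalExp γ T := by
    have ht : Filter.Tendsto (fun n : ℕ => 2 * causalExp l T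
        + ENNReal.ofReal (4 * D / l) * H 0 * causalExp γ T
        + 2 * ENNReal.ofReal A₂ * θ ^ n * causalExp (2 * l) T) Filter.atTop
        (nhds (2 * causalExp l T + ENNReal.ofReal (4 * D / l) * H 0 * causalExp γ T
          + 2 * ENNReal.ofReal A₂ * 0 * causalExp (2 * l) T)) := by
      refine tendsto_const_nhds.add ?_
      refine ENNReal.Tendsto.mul_const (ENNReal.Tendsto.const_mul
        (ENNReal.tendsto_pow_atTop_nhds_zero_of_lt_one hθ1) (Or.inr ?_))
        (Or.inr (causalExp_ne_top _ _))
      exact ENNReal.mul_ne_top (by simp) ENNReal.ofReal_ne_top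
    have := ge_of_tendsto' ht fun n => hiter n T le_rfl 0
    simpa only [mul_zero, zero_mul, add_zero] using this
  have htot : totalDev Φ T T 0 = ∑' z, devSq Φ z (heat Φ T z) T :=
    tsum_congr fun z => by rw [sub_zero]
  rw [← htot]
  refine hlim.trans ?_
  simp only [hH, causalExp, causal_of_nonneg _ hT]
  rw [← ENNReal.ofReal_mul (by positivity), ← ENNReal.ofReal_mul (by positivity),
    ← ENNReal.ofReal_ofNat 2, ← ENNReal.ofReal_mul (by positivity),
    ← ENNReal.ofReal_add (by positivity) (by positivity)]
  refine ENNReal.ofReal_le_ofReal ?_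
  -- The contribution of the initial ball is of lower order, because `exp (l * T)` beats the power
  -- of `1 + T`.
  have e1 : Real.exp (l * T) ≤ K * (1 + T) ^ (-p) * Real.exp (2 * l * T) := by
    have a1 : (1 + T) ^ p ≤ K * Real.exp (l * T) := by
      refine le_trans ?_ (hpow T hT)
      rw [← Real.rpow_natCast]
      refine Real.rpow_le_rpow_of_exponent_le (by linarith) ?_
      push_cast
      rw [hp]
      have : (0 : ℝ) ≤ d := Nat.cast_nonneg d
      linarith
    have a2 : Real.exp (2 * l * T) = Real.exp (l * T) * Real.exp (l * T) := by
      rw [← Real.exp_add]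
      congr 1
      ring
    rw [Real.rpow_neg hT1.le, a2]
    have a3 : 0 < (1 + T) ^ p := by positivity
    calc Real.exp (l * T) = (1 + T) ^ p * ((1 + T) ^ p)⁻¹ * Real.exp (l * T) := by
          rw [mul_inv_cancel₀ a3.ne', one_mul]
      _ ≤ K * Real.exp (l * T) * ((1 + T) ^ p)⁻¹ * Real.exp (l * T) := by gcongr
      _ = _ := by ring
  have e2 : Real.exp (l / 2 * T) * Real.exp (γ * T) = Real.exp (2 * l * T) := by
    rw [← Real.exp_add, hγ]
    congr 1
    ring
  have e3 : 4 * D / l * (A + siteNorm (0 : Site d) ^ 2) * Real.exp (γ * T)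
      = 4 * C / l * A * (1 + T) ^ (-p) * Real.exp (2 * l * T) := by
    rw [← e2, hD, siteNorm_zero]
    ring
  rw [e3]
  linarith

lemma meanShare_eq (h : Integrable (mass (d := d)) Φ) (z : Site d) (t : ℝ) :
    meanShare Φ z t = heat Φ t (-z) := by
  rw [meanShare, heat, ← integral_popAt h]
  simp_rw [count_eq]

lemma finite_present (h : Integrable (mass (d := d)) Φ) (t : ℝ) :
    ∀ᵐ ω ∂law Φ, (present ω t).Finite := by
  filter_upwards [ae_pop_one_ne_top h t] with ω hω
  rw [pop_one_eq_encard] at hω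
  exact Set.encard_ne_top_iff.1 fun h => hω (by rw [h]; rfl)

lemma rpow_one_add_le {t p : ℝ} (ht : 1 ≤ t) (hp : p ≤ 0) : (1 + t) ^ p ≤ t ^ p :=
  Real.rpow_le_rpow_of_nonpos (by linarith) (by linarith) hp

/-- Mean square deviations of the numbers of balls. -/
lemma exists_meanSquare_le (hirr : Irreducible Φ) (h : Integrable (fun φ => mass φ ^ 2) Φ)
    (hr : 0 < rate Φ) (h1 : Integrable (fun φ => displacement (d := d) 1 φ ^ 2) Φ)
    (h2 : Integrable (displacement (d := d) 2) Φ) :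
    ∃ C : ℝ, 0 < C ∧ ∀ t, 1 ≤ t →
      Summable (fun z => ∫ ω, dev z (heat Φ t z) t ω ^ 2 ∂law Φ) ∧
      Real.exp (-(2 * rate Φ * t)) * ∑' z, ∫ ω, dev z (heat Φ t z) t ω ^ 2 ∂law Φ
        ≤ C * t ^ (-((d : ℝ) + 2) / 2) := by
  obtain ⟨C, hC, hle⟩ := exists_tsum_devSq_heat_le hirr h hr h1 h2
  refine ⟨C, hC, fun t ht => ?_⟩
  have ht0 : 0 ≤ t := by linarith
  have hi : ∀ z, ∫ ω, dev z (heat Φ t z) t ω ^ 2 ∂law Φ = (devSq Φ z (heat Φ t z) t).toReal := by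
    intro z
    rw [devSq, ← ofReal_integral_eq_lintegral_ofReal (memLp_dev h hr z _ t).integrable_sq
      (ae_of_all _ fun ω => sq_nonneg _),
      ENNReal.toReal_ofReal (integral_nonneg fun ω => sq_nonneg _)]
  have hfin : ∑' z, devSq Φ z (heat Φ t z) t ≠ ∞ :=
    ((hle t ht0).trans_lt ENNReal.ofReal_lt_top).ne
  simp_rw [hi]
  refine ⟨ENNReal.summable_toReal hfin, ?_⟩
  rw [← ENNReal.tsum_toReal_eq fun z => ENNReal.ne_top_of_tsum_ne_top hfin z]
  have hb := ENNReal.toReal_le_of_le_ofReal (by positivity) (hle t ht0)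
  calc _ ≤ Real.exp (-(2 * rate Φ * t))
        * (C * (1 + t) ^ (-((d : ℝ) + 2) / 2) * Real.exp (2 * rate Φ * t)) :=
        mul_le_mul_of_nonneg_left hb (Real.exp_pos _).le
    _ = C * (1 + t) ^ (-((d : ℝ) + 2) / 2) := by
        rw [mul_comm, mul_assoc, ← Real.exp_add, add_neg_cancel, Real.exp_zero, mul_one]
    _ ≤ _ := by
        refine mul_le_mul_of_nonneg_left (rpow_one_add_le ht ?_) hC.le
        have : (0 : ℝ) ≤ d := Nat.cast_nonneg d
        linarith

end

end BranchingWalk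

end

/-! ### Assembly of the three estimates. -/

theorem proposition2p4 (d : ℕ) (hd : 1 ≤ d)
    (Φ : Measure (BranchingWalk.Config d)) [IsProbabilityMeasure Φ]
    (hirr : BranchingWalk.Irreducible Φ)
    (hmass : Integrable (fun φ => BranchingWalk.mass φ ^ 2) Φ)
    (hdisp1 : Integrable (fun φ => BranchingWalk.displacement 1 φ ^ 2) Φ)
    (hdisp2 : Integrable (fun φ => BranchingWalk.displacement 2 φ) Φ) :
    ∃ c C : ℝ, 0 < c ∧ 0 < C ∧ ∀ t : ℝ, 1 ≤ t →
      -- the process is well defined: almost surely finite, with finite means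
      ((∀ᵐ ω ∂(BranchingWalk.law Φ), (BranchingWalk.present ω t).Finite) ∧
        Integrable (BranchingWalk.total t) (BranchingWalk.law Φ) ∧
        ∀ z, Integrable (BranchingWalk.count z t) (BranchingWalk.law Φ)) ∧
      -- the supremum
      (BddAbove (Set.range fun z => BranchingWalk.meanShare Φ z t) ∧
        (⨆ z, BranchingWalk.meanShare Φ z t) ≤ C * t ^ (-(d : ℝ) / 2)) ∧
      -- the sum of squares, from both sides
      (Summable (fun z => BranchingWalk.meanShare Φ z t ^ 2) ∧
        c * t ^ (-(d : ℝ) / 2) ≤ ∑' z, BranchingWalk.meanShare Φ z t ^ 2 ∧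
        ∑' z, BranchingWalk.meanShare Φ z t ^ 2 ≤ C * t ^ (-(d : ℝ) / 2)) ∧
      -- the mean square deviations
      ((∀ z, Integrable (fun ω => (BranchingWalk.count z t ω
            - BranchingWalk.meanShare Φ (-z) t * BranchingWalk.total t ω) ^ 2)
          (BranchingWalk.law Φ)) ∧
        Summable (fun z => ∫ ω, (BranchingWalk.count z t ω
            - BranchingWalk.meanShare Φ (-z) t * BranchingWalk.total t ω) ^ 2
          ∂(BranchingWalk.law Φ)) ∧
        Real.exp (-(2 * BranchingWalk.rate Φ * t)) *
            ∑' z, ∫ ω, (BranchingWalk.count z t ω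
              - BranchingWalk.meanShare Φ (-z) t * BranchingWalk.total t ω) ^ 2
              ∂(BranchingWalk.law Φ)
          ≤ C * t ^ (-((d : ℝ) + 2) / 2)) := by
  obtain ⟨C₁, hC₁, hsup⟩ := BranchingWalk.exists_heat_le hirr (BranchingWalk.integrable_mass hmass)
  have hm := BranchingWalk.integrable_mass hmass
  have hr := BranchingWalk.rate_pos hd hirr hm
  obtain ⟨c, hc, hlow⟩ := BranchingWalk.exists_le_tsum_heat_sq hm hdisp2
  obtain ⟨C₂, hC₂, hdev⟩ := BranchingWalk.exists_meanSquare_le hirr hmass hr hdisp1 hdisp2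
  refine ⟨c, C₁ + C₂, hc, by positivity, fun t ht => ?_⟩
  have ht0 : 0 ≤ t := by linarith
  have hd0 : (0 : ℝ) ≤ d := Nat.cast_nonneg d
  have hheat : ∀ z, BranchingWalk.heat Φ t z ≤ C₁ * t ^ (-(d : ℝ) / 2) := fun z =>
    (hsup t ht0 z).trans (mul_le_mul_of_nonneg_left
      (BranchingWalk.rpow_one_add_le ht (by linarith)) hC₁.le)
  have hC₁le : C₁ * t ^ (-(d : ℝ) / 2) ≤ (C₁ + C₂) * t ^ (-(d : ℝ) / 2) :=
    mul_le_mul_of_nonneg_right (by linarith) (by positivity)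
  have hC₂le : C₂ * t ^ (-((d : ℝ) + 2) / 2) ≤ (C₁ + C₂) * t ^ (-((d : ℝ) + 2) / 2) :=
    mul_le_mul_of_nonneg_right (by linarith) (by positivity)
  have hsum := BranchingWalk.hasSum_heat hm ht0
  -- The upper ℓ² bound is the sup bound times the total mass `1`; no separate Fourier estimate is
  -- needed.
  have hsqle : ∀ z, BranchingWalk.heat Φ t z ^ 2
      ≤ C₁ * t ^ (-(d : ℝ) / 2) * BranchingWalk.heat Φ t z := fun z => by
    rw [sq]
    exact mul_le_mul_of_nonneg_right (hheat z) (BranchingWalk.heat_nonneg Φ t z)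
  have hsq : Summable fun z => BranchingWalk.heat Φ t z ^ 2 :=
    Summable.of_nonneg_of_le (fun _ => sq_nonneg _) hsqle (hsum.summable.mul_left _)
  have hup : ∑' z, BranchingWalk.heat Φ t z ^ 2 ≤ C₁ * t ^ (-(d : ℝ) / 2) := by
    refine (hsq.tsum_le_tsum hsqle (hsum.summable.mul_left _)).trans (le_of_eq ?_)
    rw [tsum_mul_left, hsum.tsum_eq, mul_one]
  have hneg : ∑' z, BranchingWalk.heat Φ t (-z) ^ 2 = ∑' z, BranchingWalk.heat Φ t z ^ 2 :=
    (Equiv.neg _).tsum_eq fun z => BranchingWalk.heat Φ t z ^ 2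
  have hfun : ∀ z ω, BranchingWalk.count z t ω
      - BranchingWalk.meanShare Φ (-z) t * BranchingWalk.total t ω
      = BranchingWalk.dev z (BranchingWalk.heat Φ t z) t ω := fun z ω => by
    rw [BranchingWalk.meanShare_eq hm, neg_neg, BranchingWalk.count_eq, BranchingWalk.total_eq]
    rfl
  simp_rw [hfun, BranchingWalk.meanShare_eq hm]
  refine ⟨⟨BranchingWalk.finite_present hm t, ?_, fun z => ?_⟩, ⟨?_, ?_⟩, ⟨?_, ?_, ?_⟩,
    fun z => ?_, (hdev t ht).1, (hdev t ht).2.trans hC₂le⟩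
  · rw [funext (BranchingWalk.total_eq t)]
    exact (BranchingWalk.memLp_pop_toReal hmass hr t).integrable one_le_two
  · rw [funext (BranchingWalk.count_eq z t)]
    exact (BranchingWalk.memLp_popAt_toReal hmass hr z t).integrable one_le_two
  · exact ⟨_, Set.forall_mem_range.2 fun z => hheat (-z)⟩
  · exact ciSup_le fun z => (hheat (-z)).trans hC₁le
  · exact hsq.comp_injective neg_injective
  · exact (hlow t ht).trans hneg.ge
  · exact hneg.le.trans (hup.trans hC₁le)
  · exact (BranchingWalk.memLp_dev hmass hr z _ t).integrable_sq
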